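/- **Setting.** Consider a two-player zero-sum simultaneous-move episodic Markov game with measurable state space $\mathcal S$, a finite action set $\mathcal A$ for both players, $H$ steps per episode, deterministic rewards $r_h(x,a,b)\in[-1,1]$ and transition kernels $P_h(\cdot\mid x,a,b)$. A policy of a player is a sequence of measurable maps $\pi_h:\mathcal S\to\Delta(\mathcal A)$, $h\in[H]$, and $V_h^{\pi,\nu}(x)=\mathbb E\big[\sum_{t=h}^H r_t(x_t,a_t,b_t)\mid x_h=x\big]$ where $a_t\sim\pi_t(x_t)$ and $b_t\sim\nu_t(x_t)$ independently and $x_{t+1}\sim P_t(\cdot\mid x_t,a_t,b_t)$. Assume that the game has a Nash equilibrium $(\pi^*,\nu^*)$, i.e. $V_1^{\pi^*,\nu^*}(x)=\max_\pi V_1^{\pi,\nu^*}(x)=\min_\nu V_1^{\pi^*,\nu}(x)$ for every $x$, and let $V_1^*=V_1^{\pi^*,\nu^*}$. **Assumption (linearity and boundedness).** There are a known measurable feature map $\phi:\mathcal S\times\mathcal A\times\mathcal A\to\mathbb R^d$, unknown vectors $\theta_h\in\mathbb R^d$ and unknown vectors $\mu_h=(\mu_h^{(i)})_{i\in[d]}$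 of finite signed measures on $\mathcal S$ such that for all $h\in[H]$ and all $(x,a,b)$ $$r_h(x,a,b)=\phi(x,a,b)^\top\theta_h,\qquad P_h(\cdot\mid x,a,b)=\phi(x,a,b)^\top\mu_h(\cdot),$$ with $\|\phi\|\le 1$, $\|\theta_h\|\le\sqrt d$, and $\big\|\int f\,d\mu_h\big\|\le\sqrt d$ for every measurable $f:\mathcal S\to[-1,1]$. **Algorithm (player 1), with bonus parameter $\beta$.** In episode $k$, set $V_{H+1}^k=0$ and for $h=H,\dots,1$, with $\phi_h^\tau=\phi(x_h^\tau,a_h^\tau,b_h^\tau)$, compute $$\Lambda_h^k=I+\sum_{\tau<k}\phi_h^\tau(\phi_h^\tau)^\top,\qquad w_h^k=(\Lambda_h^k)^{-1}\sum_{\tau<k}\phi_h^\tau\big[r_h(x_h^\tau,a_h^\tau,b_h^\tau)+V_{h+1}^k(x_{h+1}^\tau)\big],$$ $$Q_h^k=\max\Big\{\min\big\{(w_h^k)^\top\phi+\beta\sqrt{\phi^\top(\Lambda_h^k)^{-1}\phi},\,H\big\},-H\Big\};$$ for each $x$ let $(\pi_h^k(x),B_h^k(x))$ be a Nash equilibrium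 of the zero-sum matrix game with payoff matrix $Q_h^k(x,\cdot,\cdot)$ (chosen measurably), and let $V_h^k(x)=\mathbb E_{a\sim\pi_h^k(x),\,b\sim B_h^k(x)}[Q_h^k(x,a,b)]$. Then player 1 plays $\pi^k$ throughout episode $k$, while player 2 plays a policy $\nu^k$. The initial state $x_1^k$ and the policy $\nu^k$ are arbitrary and may depend on everything that happened before the first actions of episode $k$ (including $\pi^k$). **Theorem.** There are absolute constants $c,C>0$ such that for every such game, all $d$ and $K$, every $p\in(0,1)$, every policy sequence $\nu=(\nu^k)$ of player 2 and all initial states $(x_1^k)$ the following holds. Let $T=KH$, $\iota=\log(2dT/p)$ and $\beta=c\,dH\sqrt{\iota}$. Then with probability at least $1-p$, $$\mathrm{Regret}_\nu(K)=\sum_{k=1}^K\big[V_1^*(x_1^k)-V_1^{\pi^k,\nu^k}(x_1^k)\big]\le C\sqrt{d^3H^3T\iota^2}.$$ -/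

import Mathlib

open MeasureTheory ProbabilityTheory
open scoped Matrix

noncomputable section

namespace OmniVI

/-! ### Zero-sum Markov games, policies, value functions

Steps are numbered `1, …, horizon` and episodes `1, …, K`. -/

/-- A two-player zero-sum simultaneous-move episodic Markov game with state space `S`, common
action set `A`, deterministic rewards with values in `[-1, 1]`, and `horizon` steps. -/
structure MarkovGame (S A : Type*) [MeasurableSpace S] [MeasurableSpace A] where
  horizon : ℕ
  reward : ℕ → S × A × A → ℝ
  trans : ℕ → Kernel (S × A × A) S
  measurable_reward : ∀ h, Measurable (reward h)
  abs_reward_le : ∀ h z, |reward h z| ≤ 1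
  markov : ∀ h, IsMarkovKernel (trans h)

attribute [instance] MarkovGame.markov

/-- A stochastic (Markov) policy of one player: at step `h` and state `x` the action has law
`act h x`. -/
structure Policy (S A : Type*) [MeasurableSpace S] [MeasurableSpace A] where
  act : ℕ → Kernel S A
  markov : ∀ h, IsMarkovKernel (act h)

attribute [instance] Policy.markov

section Game

variable {S A : Type*} [MeasurableSpace S] [MeasurableSpace A]

/-- The law of the `n` triples `(state, action of player 1, action of player 2)` at the steps
`h, h + 1, …, h + n - 1`, started from a given state at step `h`, when the players choose their
actions independently according to `π` and `ν`. -/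
def MarkovGame.traj (G : MarkovGame S A) (π ν : Policy S A) :
    (n : ℕ) → (h : ℕ) → Kernel S (Fin n → S × A × A)
  | 0, _ => Kernel.const S (Measure.dirac Fin.elim0)
  | n + 1, h =>
    ((Kernel.id ×ₖ (π.act h ×ₖ ν.act h)) ⊗ₖ
      Kernel.prodMkLeft S (G.traj π ν n (h + 1) ∘ₖ G.trans h)).map
        (fun q => (Fin.cons q.1 q.2 : Fin (n + 1) → S × A × A))

/-- The value function `V_h^{π,ν}(x) = E[∑_{t=h}^H r_t(x_t, a_t, b_t) | x_h = x]`. -/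
def MarkovGame.value (G : MarkovGame S A) (π ν : Policy S A) (h : ℕ) (x : S) : ℝ :=
  ∫ τ, ∑ i : Fin (G.horizon + 1 - h), G.reward (h + (i : ℕ)) (τ i) ∂(G.traj π ν (G.horizon + 1 - h) h x)

/-- `(π, ν)` is a Nash equilibrium of the game: for every initial state `x`,
`V_1^{π,ν}(x) = max_{π'} V_1^{π',ν}(x) = min_{ν'} V_1^{π,ν'}(x)`. -/
def MarkovGame.IsNash (G : MarkovGame S A) (π ν : Policy S A) : Prop :=
  ∀ x, IsGreatest (Set.range fun π' => G.value π' ν 1 x) (G.value π ν 1 x) ∧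
    IsLeast (Set.range fun ν' => G.value π ν' 1 x) (G.value π ν 1 x)

/-- The integral of `f` against a signed measure. -/
def signedIntegral (μ : SignedMeasure S) (f : S → ℝ) : ℝ :=
  ∫ x, f x ∂μ.toJordanDecomposition.posPart - ∫ x, f x ∂μ.toJordanDecomposition.negPart

/-- Linearity and boundedness of the game with respect to the feature map `φ`: with vectors `θ_h`
and vectors `μ_h` of `d` signed measures, `r_h = φᵀ θ_h`, `P_h = φᵀ μ_h`, `‖φ‖ ≤ 1`,
`‖θ_h‖ ≤ √d`, and `‖∫ f dμ_h‖ ≤ √d` for each measurable `f` with values in `[-1, 1]`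
(for `f = 1` the integral is the vector `μ_h(S)`, and for nonnegative measures this case implies
all the others). -/
def MarkovGame.IsLinear (G : MarkovGame S A) {d : ℕ} (φ : S × A × A → EuclideanSpace ℝ (Fin d)) :
    Prop :=
  Measurable φ ∧ (∀ z, ‖φ z‖ ≤ 1) ∧
    ∃ (θ : ℕ → EuclideanSpace ℝ (Fin d)) (μ : ℕ → Fin d → SignedMeasure S),
      ∀ h, 1 ≤ h → h ≤ G.horizon →
        (∀ z, G.reward h z = ∑ i, φ z i * θ h i) ∧
        (∀ z, ∀ E, MeasurableSet E → (G.trans h z).real E = ∑ i, φ z i * μ h i E) ∧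
        ‖θ h‖ ≤ √d ∧
        (∀ f : S → ℝ, Measurable f → (∀ x, |f x| ≤ 1) →
          ‖WithLp.toLp 2 (fun i => signedIntegral (μ h i) f)‖ ≤ √d)

/-! ### Zero-sum matrix games -/

/-- Expected payoff of a matrix game under independent mixed strategies `p` and `q`. -/
def payoff [Fintype A] (M : A → A → ℝ) (p q : Measure A) : ℝ :=
  ∑ a, ∑ b, p.real {a} * q.real {b} * M a b

/-- `(p, q)` is a Nash equilibrium of the zero-sum matrix game `M`, in which the first player
maximizes and the second one minimizes. -/
def IsMatrixNash [Fintype A] (M : A → A → ℝ) (p q : Measure A) : Prop :=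
  IsProbabilityMeasure p ∧ IsProbabilityMeasure q ∧
    (∀ p' : Measure A, IsProbabilityMeasure p' → payoff M p' q ≤ payoff M p q) ∧
    (∀ q' : Measure A, IsProbabilityMeasure q' → payoff M p q ≤ payoff M p q')

/-! ### Optimistic minimax value iteration (one-sided, online) -/

/-- Observed data: the state `x_h^k` and the actions `a_h^k`, `b_h^k` for episode `k`, step `h`. -/
structure Record (S A : Type*) where
  state : ℕ → ℕ → S
  act1 : ℕ → ℕ → A
  act2 : ℕ → ℕ → A

/-- The triple `(x_h^k, a_h^k, b_h^k)`. -/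
def Record.triple {S A : Type*} (D : Record S A) (k h : ℕ) : S × A × A :=
  (D.state k h, D.act1 k h, D.act2 k h)

/-- Clipping to `[-H, H]`. -/
def clip (H u : ℝ) : ℝ := max (min u H) (-H)

variable {d : ℕ}

/-- The regularized Gram matrix `Λ_h^k = ∑_{τ<k} φ_h^τ (φ_h^τ)ᵀ + I`. -/
def gram (φ : S × A × A → EuclideanSpace ℝ (Fin d)) (D : Record S A) (k h : ℕ) :
    Matrix (Fin d) (Fin d) ℝ :=
  ∑ τ ∈ Finset.Ico 1 k,
    Matrix.vecMulVec (φ (D.triple τ h)).ofLp (φ (D.triple τ h)).ofLp + 1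

/-- The least-squares weight
`w_h^k = (Λ_h^k)⁻¹ ∑_{τ<k} φ_h^τ [r_h(x_h^τ, a_h^τ, b_h^τ) + V(x_{h+1}^τ)]`, where `V` is the
current estimate for step `h + 1`. -/
def weight (G : MarkovGame S A) (φ : S × A × A → EuclideanSpace ℝ (Fin d)) (D : Record S A)
    (k h : ℕ) (V : S → ℝ) : Fin d → ℝ :=
  (gram φ D k h)⁻¹ *ᵥ ∑ τ ∈ Finset.Ico 1 k,
    (G.reward h (D.triple τ h) + V (D.state τ (h + 1))) • (φ (D.triple τ h)).ofLp

/-- The optimistic estimate `Q_h^k`, computed from the estimate `V` for step `h + 1`. -/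
def optQStep (G : MarkovGame S A) (φ : S × A × A → EuclideanSpace ℝ (Fin d)) (β : ℝ)
    (D : Record S A) (k h : ℕ) (V : S → ℝ) (z : S × A × A) : ℝ :=
  clip G.horizon (weight G φ D k h V ⬝ᵥ (φ z).ofLp +
    β * √((φ z).ofLp ⬝ᵥ ((gram φ D k h)⁻¹ *ᵥ (φ z).ofLp)))

/-- The estimate `V_h^k` when `n = H + 1 - h` steps remain: it is `0` for `n = 0`, and otherwise
the expectation of `Q_h^k` under the strategies `π_h^k(x)` and `B_h^k(x)` that the algorithm
computed at step `h`. -/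
def optVAux [Fintype A] (G : MarkovGame S A) (φ : S × A × A → EuclideanSpace ℝ (Fin d)) (β : ℝ)
    (D : Record S A) (k : ℕ) (π B : Policy S A) : (n : ℕ) → (h : ℕ) → S → ℝ
  | 0, _, _ => 0
  | n + 1, h, x =>
    payoff (fun a b => optQStep G φ β D k h (optVAux G φ β D k π B n (h + 1)) (x, a, b))
      (π.act h x) (B.act h x)

/-- The estimate `V_h^k`, for `1 ≤ h ≤ H + 1`. -/
def optV [Fintype A] (G : MarkovGame S A) (φ : S × A × A → EuclideanSpace ℝ (Fin d)) (β : ℝ)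
    (D : Record S A) (k : ℕ) (π B : Policy S A) (h : ℕ) : S → ℝ :=
  optVAux G φ β D k π B (G.horizon + 1 - h) h

/-- The estimate `Q_h^k`, for `1 ≤ h ≤ H`. -/
def optQ [Fintype A] (G : MarkovGame S A) (φ : S × A × A → EuclideanSpace ℝ (Fin d)) (β : ℝ)
    (D : Record S A) (k : ℕ) (π B : Policy S A) (h : ℕ) : S × A × A → ℝ :=
  optQStep G φ β D k h (optV G φ β D k π B (h + 1))

/-- `π` and `B` are the strategies that the algorithm computes at the beginning of episode `k`
from the data of the episodes before `k`: at each step `h` and each state `x`,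
`(π_h(x), B_h(x))` is a Nash equilibrium of the matrix game `Q_h^k(x, ·, ·)`. -/
def IsOmniPolicy [Fintype A] (G : MarkovGame S A) (φ : S × A × A → EuclideanSpace ℝ (Fin d))
    (β : ℝ) (D : Record S A) (k : ℕ) (π B : Policy S A) : Prop :=
  ∀ h, 1 ≤ h → h ≤ G.horizon → ∀ x,
    IsMatrixNash (fun a b => optQ G φ β D k π B h (x, a, b)) (π.act h x) (B.act h x)

end Game

/-- A random policy `π`, indexed by `ω`, is determined by the information `m`: its action
probabilities at the steps `1, …, H` are measurable in `ω` (for `m`) and the state, jointly. -/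
def PolicyMeasurable {Ω S A : Type*} [mS : MeasurableSpace S] [MeasurableSpace A] (H : ℕ)
    (m : MeasurableSpace Ω) (π : Ω → Policy S A) : Prop :=
  ∀ h, 1 ≤ h → h ≤ H → ∀ a : A,
    Measurable[m.prod mS] (fun q : Ω × S => ((π q.1).act h q.2).real {a})

/-- `K` episodes of online play: player 1 follows the algorithm with bonus parameter `β`, and
player 2 follows the policy `ν k` in episode `k`.

`info k h` is the information available just before the actions of step `h` of episode `k`, and
`infoAct k h` the information just after them. The initial states, and the policies of player 2,
may depend in any way on the information available at the beginning of the episode. -/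
structure OnlineRun {Ω S A : Type*} [mΩ : MeasurableSpace Ω] [MeasurableSpace S]
    [Fintype A] [MeasurableSpace A] (P : Measure Ω) (G : MarkovGame S A) {d : ℕ}
    (φ : S × A × A → EuclideanSpace ℝ (Fin d)) (β : ℝ) (K : ℕ)
    (D : Ω → Record S A) (π B ν : ℕ → Ω → Policy S A)
    (info infoAct : ℕ → ℕ → MeasurableSpace Ω) : Prop where
  /-- Information only increases with time. -/
  info_le : ∀ k h, 1 ≤ k → k ≤ K → 1 ≤ h → h ≤ G.horizon + 1 → info k h ≤ mΩ
  info_le_infoAct : ∀ k h, 1 ≤ k → k ≤ K → 1 ≤ h → h ≤ G.horizon → info k h ≤ infoAct k h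
  infoAct_le_info : ∀ k h, 1 ≤ k → k ≤ K → 1 ≤ h → h ≤ G.horizon → infoAct k h ≤ info k (h + 1)
  info_le_next : ∀ k, 1 ≤ k → k < K → info k (G.horizon + 1) ≤ info (k + 1) 1
  /-- States and actions are observed. -/
  measurable_state : ∀ k h, 1 ≤ k → k ≤ K → 1 ≤ h → h ≤ G.horizon + 1 →
    Measurable[info k h] (fun ω => (D ω).state k h)
  measurable_act1 : ∀ k h, 1 ≤ k → k ≤ K → 1 ≤ h → h ≤ G.horizon →
    Measurable[infoAct k h] (fun ω => (D ω).act1 k h)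
  measurable_act2 : ∀ k h, 1 ≤ k → k ≤ K → 1 ≤ h → h ≤ G.horizon →
    Measurable[infoAct k h] (fun ω => (D ω).act2 k h)
  /-- All policies of an episode are fixed at its beginning. -/
  measurable_pi : ∀ k, 1 ≤ k → k ≤ K → PolicyMeasurable G.horizon (info k 1) (π k)
  measurable_aux : ∀ k, 1 ≤ k → k ≤ K → PolicyMeasurable G.horizon (info k 1) (B k)
  measurable_nu : ∀ k, 1 ≤ k → k ≤ K → PolicyMeasurable G.horizon (info k 1) (ν k)
  /-- Player 1 uses the policy computed by the algorithm. -/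
  omni : ∀ k, 1 ≤ k → k ≤ K → ∀ ω, IsOmniPolicy G φ β (D ω) k (π k ω) (B k ω)
  /-- Given the information before step `h`, the players draw their actions independently from
  their policies. -/
  law_act : ∀ k h, 1 ≤ k → k ≤ K → 1 ≤ h → h ≤ G.horizon → ∀ a b : A,
    P⟦{ω | (D ω).act1 k h = a ∧ (D ω).act2 k h = b} | info k h⟧ =ᵐ[P] fun ω =>
      ((π k ω).act h ((D ω).state k h)).real {a} * ((ν k ω).act h ((D ω).state k h)).real {b}
  /-- Given the information after the actions, the next state is drawn from the transition
  kernel. -/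
  law_state : ∀ k h, 1 ≤ k → k ≤ K → 1 ≤ h → h ≤ G.horizon → ∀ E : Set S, MeasurableSet E →
    P⟦{ω | (D ω).state k (h + 1) ∈ E} | infoAct k h⟧ =ᵐ[P] fun ω =>
      (G.trans h ((D ω).triple k h)).real E

/-- `Regret_ν(K) = ∑_{k=1}^K [V_1^*(x_1^k) - V_1^{π^k,ν^k}(x_1^k)]`, where `V_1^*` is the value
of the Nash equilibrium `(πs, νs)`, along one realization of the play. -/
def regret {S A : Type*} [MeasurableSpace S] [MeasurableSpace A] (G : MarkovGame S A)
    (πs νs : Policy S A) (K : ℕ) (D : Record S A) (π ν : ℕ → Policy S A) : ℝ :=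
  ∑ k ∈ Finset.Icc 1 K,
    (G.value πs νs 1 (D.state k 1) - G.value (π k) (ν k) 1 (D.state k 1))

/-- `ι = log(2dT/p)` with `T = K H`. -/
def iota (d K H : ℕ) (p : ℝ) : ℝ := Real.log (2 * d * (K * H) / p)

end OmniVI

end

open OmniVI

/-! The proof is optimism for least-squares value iteration, with a union bound over a grid.

*Regret is at most the expected bonus.* Suppose that the least-squares predictions of every
episode are accurate up to `β √(φᵀ Λ⁻¹ φ)` (`IsAccurate`). Since `π_h^k` is a best response to
`B_h^k` in the matrix game `Q_h^k`, backward induction gives `V_1^k ≥ V_1^{π', B^k}` for every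
policy `π'` (`cumul_reward_le_optV`); with `π' = π*`, and because `ν*` minimizes the value against
`π*`, this is at least `V_1^*`. No equilibrium property after the first step is needed. Conversely
`B_h^k` is a best response to `π_h^k`, so `V_1^k - V_1^{π^k, ν^k}` is at most the expected total
of the doubled bonuses along the play of `π^k` against `ν^k` (`optV_sub_cumul_reward_le`). All
expectations along a trajectory are computed by the backward recursion `cumul`.

*Accuracy.* In a linear game the Bellman backup of a bounded function is linear in `φ`, so the
prediction error is governed by the norm for `Λ⁻¹` of the noise `∑ φ_τ (V(x_{h+1}^τ) - E
V(x_{h+1}^τ))`, where `V = V_{h+1}^k` depends on the past. The value of a matrix game is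
`1`-Lipschitz in the payoffs, hence `V` lies in a class of functions that is Hölder continuous in
`d + d²` real parameters (`classValue`). For a fixed `V` and a fixed vector `v`, Hoeffding's lemma
makes `exp (∑ ⟨v, φ_τ⟩ (V - E V) - (H² / 2) ∑ ⟨v, φ_τ⟩²)` a supermartingale
(`lintegral_exp_noise_le_one`). The exponent, as a function of `v`, is maximal at a multiple of
`Λ⁻¹ ∑ φ_τ (V - E V)`, where it is essentially the squared norm for `Λ⁻¹`. So it suffices to let
`v`, too, range over a fine grid (`selfNormalized_le_of_grid`), and a union bound over all `2 d +
d²` parameters, whose cost is of order `d² ι`, gives accuracy (`measure_exists_noise_gt_le`,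
`isAccurate_of_grid`).

*From expected to realized bonuses.* The bonuses are nonnegative and capped, so the expected
bonuses of all episodes are at most twice the realized ones plus a term `O(H² ι)`, by a
multiplicative Chernoff bound with one step for each episode (`measure_sum_cumul_gt_le`). An
additive bound of Azuma–Hoeffding type for whole episodes would lose a power of `H`. The realized
bonuses are summed by the elliptical potential lemma (`sum_dotProduct_inv_regGram_le`). -/

namespace OmniVI

/-! ### Linear algebra of regularized Gram matrices -/

section LinearAlgebra

variable {n : Type*} [Fintype n]

theorem dotProduct_self_nonneg (x : n → ℝ) : 0 ≤ x ⬝ᵥ x :=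
  Finset.sum_nonneg fun i _ => mul_self_nonneg (x i)

theorem abs_dotProduct_le_sqrt (x y : n → ℝ) : |x ⬝ᵥ y| ≤ √(x ⬝ᵥ x) * √(y ⬝ᵥ y) := by
  have h : (x ⬝ᵥ y) ^ 2 ≤ (x ⬝ᵥ x) * (y ⬝ᵥ y) := by
    have := Finset.sum_mul_sq_le_sq_mul_sq Finset.univ x y
    simpa [dotProduct, sq] using this
  rw [← Real.sqrt_mul (dotProduct_self_nonneg x), ← Real.sqrt_sq_eq_abs]
  exact Real.sqrt_le_sqrt h

theorem dotProduct_mulVec_symm {M : Matrix n n ℝ} (hM : M.IsHermitian) (x y : n → ℝ) :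
    x ⬝ᵥ (M *ᵥ y) = y ⬝ᵥ (M *ᵥ x) := by
  have h : Mᵀ = M := by simpa [Matrix.IsHermitian] using hM
  rw [Matrix.dotProduct_mulVec, dotProduct_comm, ← Matrix.mulVec_transpose, h]

theorem dotProduct_mulVec_self_nonneg {M : Matrix n n ℝ} (hM : M.PosSemidef) (x : n → ℝ) :
    0 ≤ x ⬝ᵥ (M *ᵥ x) := by
  simpa using hM.dotProduct_mulVec_nonneg x

/-- Cauchy–Schwarz for the semi-inner product of a positive semidefinite matrix. -/
theorem abs_dotProduct_mulVec_le {M : Matrix n n ℝ} (hM : M.PosSemidef) (x y : n → ℝ) :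
    |x ⬝ᵥ (M *ᵥ y)| ≤ √(x ⬝ᵥ (M *ᵥ x)) * √(y ⬝ᵥ (M *ᵥ y)) := by
  classical
  have h : (x ⬝ᵥ (M *ᵥ y)) ^ 2 ≤ (x ⬝ᵥ (M *ᵥ x)) * (y ⬝ᵥ (M *ᵥ y)) := by
    have := LinearMap.BilinForm.apply_mul_apply_le_of_forall_zero_le (Matrix.toLinearMap₂' ℝ M)
      (fun x => by simpa [Matrix.toLinearMap₂'_apply'] using dotProduct_mulVec_self_nonneg hM x) x y
    simp only [Matrix.toLinearMap₂'_apply'] at this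
    rwa [dotProduct_mulVec_symm hM.1 y x, ← sq] at this
  rw [← Real.sqrt_mul (dotProduct_mulVec_self_nonneg hM x), ← Real.sqrt_sq_eq_abs]
  exact Real.sqrt_le_sqrt h

theorem vecMulVec_mulVec_eq (u x : n → ℝ) : Matrix.vecMulVec u u *ᵥ x = (u ⬝ᵥ x) • u := by
  ext i
  simp only [Matrix.mulVec, Matrix.vecMulVec, dotProduct, Matrix.of_apply, Pi.smul_apply,
    smul_eq_mul, Finset.sum_mul]
  exact Finset.sum_congr rfl fun j _ => by ring

variable [DecidableEq n] {M : Matrix n n ℝ}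

theorem mulVec_inv_mulVec (hM : M.PosDef) (y : n → ℝ) : M *ᵥ (M⁻¹ *ᵥ y) = y := by
  rw [Matrix.mulVec_mulVec, Matrix.mul_nonsing_inv _ ((Matrix.isUnit_iff_isUnit_det _).1 hM.isUnit),
    Matrix.one_mulVec]

/-- If `M ≥ 1`, then `M⁻¹` does not increase the Euclidean norm. -/
theorem inv_mulVec_dotProduct_self_le (hM : M.PosDef) (h1 : ∀ x, x ⬝ᵥ x ≤ x ⬝ᵥ (M *ᵥ x))
    (y : n → ℝ) : (M⁻¹ *ᵥ y) ⬝ᵥ (M⁻¹ *ᵥ y) ≤ y ⬝ᵥ y := by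
  set x := M⁻¹ *ᵥ y with hx
  have h2 := h1 x
  rw [hx, mulVec_inv_mulVec hM, ← hx] at h2
  have h3 := (abs_le.1 (abs_dotProduct_le_sqrt x y)).2
  have h4 : √(x ⬝ᵥ x) * √(x ⬝ᵥ x) ≤ √(x ⬝ᵥ x) * √(y ⬝ᵥ y) := by
    rw [Real.mul_self_sqrt (dotProduct_self_nonneg x)]; linarith
  have h5 : √(x ⬝ᵥ x) ≤ √(y ⬝ᵥ y) := by
    rcases (Real.sqrt_nonneg (x ⬝ᵥ x)).eq_or_lt with h | h
    · rw [← h]; positivity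
    · exact le_of_mul_le_mul_left h4 h
  exact (Real.sqrt_le_sqrt_iff (dotProduct_self_nonneg y)).1 h5

theorem dotProduct_inv_mulVec_self_le (hM : M.PosDef) (h1 : ∀ x, x ⬝ᵥ x ≤ x ⬝ᵥ (M *ᵥ x))
    (y : n → ℝ) : y ⬝ᵥ (M⁻¹ *ᵥ y) ≤ y ⬝ᵥ y := by
  have h3 := (abs_le.1 (abs_dotProduct_le_sqrt y (M⁻¹ *ᵥ y))).2
  have h4 := Real.sqrt_le_sqrt (inv_mulVec_dotProduct_self_le hM h1 y)
  have h5 : √(y ⬝ᵥ y) * √((M⁻¹ *ᵥ y) ⬝ᵥ (M⁻¹ *ᵥ y)) ≤ √(y ⬝ᵥ y) * √(y ⬝ᵥ y) := by gcongr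
  rw [Real.mul_self_sqrt (dotProduct_self_nonneg y)] at h5
  linarith

/-- Completing the square: `v ↦ ⟨v, y⟩ - (s / 2) ⟨v, M v⟩` is maximal at `s⁻¹ M⁻¹ y`. -/
theorem dotProduct_sub_eq_of_posDef (hM : M.PosDef) {s : ℝ} (hs : s ≠ 0) (y u : n → ℝ) :
    (s⁻¹ • (M⁻¹ *ᵥ y) + u) ⬝ᵥ y
        - s / 2 * ((s⁻¹ • (M⁻¹ *ᵥ y) + u) ⬝ᵥ (M *ᵥ (s⁻¹ • (M⁻¹ *ᵥ y) + u)))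
      = (2 * s)⁻¹ * (y ⬝ᵥ (M⁻¹ *ᵥ y)) - s / 2 * (u ⬝ᵥ (M *ᵥ u)) := by
  have h1 : (M⁻¹ *ᵥ y) ⬝ᵥ (M *ᵥ u) = u ⬝ᵥ y := by
    rw [dotProduct_mulVec_symm hM.1, mulVec_inv_mulVec hM]
  have h2 : (M⁻¹ *ᵥ y) ⬝ᵥ y = y ⬝ᵥ (M⁻¹ *ᵥ y) := dotProduct_comm _ _
  simp only [Matrix.mulVec_add, Matrix.mulVec_smul, mulVec_inv_mulVec hM, add_dotProduct,
    dotProduct_add, smul_dotProduct, dotProduct_smul, smul_eq_mul, h1, h2]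
  field_simp
  ring

/-- Matrix determinant lemma for a symmetric rank-one update. -/
theorem det_add_vecMulVec_self (hM : M.PosDef) (u : n → ℝ) :
    (M + Matrix.vecMulVec u u).det = M.det * (1 + u ⬝ᵥ (M⁻¹ *ᵥ u)) := by
  have h := Matrix.det_add_replicateCol_mul_replicateRow (ι := Unit)
    ((Matrix.isUnit_iff_isUnit_det _).1 hM.isUnit) u u
  rw [Matrix.vecMulVec_eq Unit, h, Matrix.det_unique (n := Unit)]
  congr 1
  rw [Matrix.add_apply, Matrix.one_apply_eq, Matrix.mul_assoc, ← Matrix.replicateCol_mulVec]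
  simp [Matrix.mul_apply, dotProduct]

/-- The determinant of a positive definite matrix is at most `(tr M)^n`, since no eigenvalue
exceeds the trace. -/
theorem det_le_trace_pow (hM : M.PosDef) : M.det ≤ M.trace ^ Fintype.card n := by
  have hpos := hM.posSemidef.eigenvalues_nonneg
  have htr : M.trace = ∑ i, hM.1.eigenvalues i := by
    simpa using hM.1.trace_eq_sum_eigenvalues
  have hdet : M.det = ∏ i, hM.1.eigenvalues i := by
    simpa using hM.1.det_eq_prod_eigenvalues
  rw [hdet, ← Finset.card_univ, ← Finset.prod_const]
  refine Finset.prod_le_prod (fun i _ => hpos i) fun i _ => ?_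
  rw [htr]
  exact Finset.single_le_sum (fun i _ => hpos i) (Finset.mem_univ i)

/-- The regularized Gram matrix of the vectors `φ 1, …, φ (k - 1)`. -/
def regGram (φ : ℕ → n → ℝ) (k : ℕ) : Matrix n n ℝ :=
  ∑ τ ∈ Finset.Ico 1 k, Matrix.vecMulVec (φ τ) (φ τ) + 1

variable (φ : ℕ → n → ℝ)

theorem posDef_regGram (k : ℕ) : (regGram φ k).PosDef := by
  refine Matrix.PosDef.posSemidef_add ?_ Matrix.PosDef.one
  exact Matrix.posSemidef_sum _ fun τ _ => by
    simpa using Matrix.posSemidef_vecMulVec_self_star (φ τ)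

theorem dotProduct_regGram_mulVec (k : ℕ) (x : n → ℝ) :
    x ⬝ᵥ (regGram φ k *ᵥ x) = ∑ τ ∈ Finset.Ico 1 k, (φ τ ⬝ᵥ x) ^ 2 + x ⬝ᵥ x := by
  rw [regGram, Matrix.add_mulVec, Matrix.one_mulVec, dotProduct_add, Matrix.sum_mulVec,
    dotProduct_sum]
  congr 1
  refine Finset.sum_congr rfl fun τ _ => ?_
  rw [vecMulVec_mulVec_eq, dotProduct_smul, dotProduct_comm x, smul_eq_mul, sq]

theorem dotProduct_self_le_regGram (k : ℕ) (x : n → ℝ) :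
    x ⬝ᵥ x ≤ x ⬝ᵥ (regGram φ k *ᵥ x) := by
  rw [dotProduct_regGram_mulVec]
  linarith [Finset.sum_nonneg fun τ (_ : τ ∈ Finset.Ico 1 k) => sq_nonneg (φ τ ⬝ᵥ x)]

omit [Fintype n] in
theorem regGram_succ {k : ℕ} (hk : 1 ≤ k) :
    regGram φ (k + 1) = regGram φ k + Matrix.vecMulVec (φ k) (φ k) := by
  rw [regGram, regGram, Finset.sum_Ico_succ_top hk]
  abel

theorem trace_regGram_le (hφ : ∀ τ, φ τ ⬝ᵥ φ τ ≤ 1) (k : ℕ) :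
    (regGram φ (k + 1)).trace ≤ k + Fintype.card n := by
  rw [regGram, Matrix.trace_add, Matrix.trace_one, Matrix.trace_sum]
  have h : ∑ τ ∈ Finset.Ico 1 (k + 1), (Matrix.vecMulVec (φ τ) (φ τ)).trace
      ≤ ∑ τ ∈ Finset.Ico 1 (k + 1), (1 : ℝ) :=
    Finset.sum_le_sum fun τ _ => by simpa [Matrix.trace_vecMulVec] using hφ τ
  simp only [Finset.sum_const, Nat.card_Ico, nsmul_eq_mul, mul_one, Nat.add_sub_cancel] at h
  linarith

/-- Elliptical potential: the squared norms of the vectors `φ k`, each measured by the inverse of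
the Gram matrix of its predecessors, add up to a logarithm. -/
theorem sum_dotProduct_inv_regGram_le (hφ : ∀ τ, φ τ ⬝ᵥ φ τ ≤ 1) (K : ℕ) :
    ∑ k ∈ Finset.Icc 1 K, φ k ⬝ᵥ ((regGram φ k)⁻¹ *ᵥ φ k)
      ≤ 2 * (Fintype.card n * Real.log (K + Fintype.card n)) := by
  have key : ∑ k ∈ Finset.Icc 1 K, φ k ⬝ᵥ ((regGram φ k)⁻¹ *ᵥ φ k)
      ≤ 2 * Real.log (regGram φ (K + 1)).det := by
    induction K with
    | zero => simp [regGram]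
    | succ K ih =>
      have hx0 := dotProduct_mulVec_self_nonneg (posDef_regGram φ (K + 1)).inv.posSemidef
        (φ (K + 1))
      have hx1 := (dotProduct_inv_mulVec_self_le (posDef_regGram φ (K + 1))
        (dotProduct_self_le_regGram φ (K + 1)) (φ (K + 1))).trans (hφ (K + 1))
      rw [Finset.sum_Icc_succ_top (by omega), regGram_succ φ (by omega : 1 ≤ K + 1),
        det_add_vecMulVec_self (posDef_regGram φ (K + 1)),
        Real.log_mul (posDef_regGram φ (K + 1)).det_pos.ne' (by positivity)]
      set x := φ (K + 1) ⬝ᵥ ((regGram φ (K + 1))⁻¹ *ᵥ φ (K + 1))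
      -- `x ≤ 2 log (1 + x)` on `[0, 1]`, from `log (1 + x) ≥ 1 - 1 / (1 + x)`
      have h1 : x ≤ 2 * Real.log (1 + x) := by
        have h := Real.one_sub_inv_le_log_of_pos (by positivity : 0 < 1 + x)
        have h' : x / 2 ≤ 1 - (1 + x)⁻¹ := by
          rw [← sub_nonneg]
          have : 1 - (1 + x)⁻¹ - x / 2 = x * (1 - x) / (2 * (1 + x)) := by field_simp; ring
          rw [this]
          exact div_nonneg (mul_nonneg hx0 (by linarith)) (by positivity)
        linarith
      linarith
  refine key.trans ?_
  rw [← Real.log_pow]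
  gcongr
  · exact (posDef_regGram φ (K + 1)).det_pos
  · refine (det_le_trace_pow (posDef_regGram φ (K + 1))).trans ?_
    gcongr
    · exact (posDef_regGram φ (K + 1)).posSemidef.trace_nonneg
    · exact trace_regGram_le φ hφ K

end LinearAlgebra

/-! ### Backward recursion, matrix games and linear games -/

theorem abs_integral_le {T : Type*} [MeasurableSpace T] (μ : Measure T) [IsProbabilityMeasure μ]
    {f : T → ℝ} {c : ℝ} (h : ∀ x, |f x| ≤ c) : |∫ x, f x ∂μ| ≤ c := by
  simpa using norm_integral_le_of_norm_le_const (μ := μ) (f := f) (C := c)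
    (.of_forall fun x => by simpa using h x)

theorem integrable_of_abs_le {T : Type*} [MeasurableSpace T] (μ : Measure T) [IsFiniteMeasure μ]
    {f : T → ℝ} (hf : Measurable f) {c : ℝ} (h : ∀ x, |f x| ≤ c) : Integrable f μ :=
  Integrable.of_bound hf.aestronglyMeasurable c (.of_forall h)

theorem measurable_finCons {T : Type*} [MeasurableSpace T] (n : ℕ) :
    Measurable fun q : T × (Fin n → T) => (Fin.cons q.1 q.2 : Fin (n + 1) → T) := by
  refine measurable_pi_lambda _ fun i => ?_
  refine Fin.cases ?_ (fun j => ?_) i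
  · simpa using measurable_fst
  · simpa [Function.comp_def] using (measurable_pi_apply j).comp measurable_snd

section Recursion

variable {S A : Type*} [MeasurableSpace S] [MeasurableSpace A]

theorem Policy.measurable_act [MeasurableSingletonClass A] (π : Policy S A) (h : ℕ) (a : A) :
    Measurable fun x => (π.act h x).real {a} :=
  ((π.act h).measurable_coe (measurableSet_singleton a)).ennreal_toReal

theorem measurable_integral_trans (G : MarkovGame S A) (h : ℕ) {f : S → ℝ} (hf : Measurable f) :
    Measurable fun z => ∫ y, f y ∂G.trans h z :=
  (hf.stronglyMeasurable.integral_kernel (κ := G.trans h)).measurable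

variable [Fintype A]

theorem measurable_payoff {T : Type*} [MeasurableSpace T] {p q : T → Measure A}
    {M : T → A → A → ℝ} (hp : ∀ a, Measurable fun x => (p x).real {a})
    (hq : ∀ a, Measurable fun x => (q x).real {a}) (hM : ∀ a b, Measurable fun x => M x a b) :
    Measurable fun x => payoff (M x) (p x) (q x) :=
  Finset.measurable_fun_sum _ fun a _ => Finset.measurable_fun_sum _ fun b _ =>
    ((hp a).mul (hq b)).mul (hM a b)

theorem sum_real_singleton [MeasurableSingletonClass A] (p : Measure A) [IsProbabilityMeasure p] :
    ∑ a, p.real {a} = 1 := by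
  simp

theorem payoff_mono {p q : Measure A} {M N : A → A → ℝ} (h : ∀ a b, M a b ≤ N a b) :
    payoff M p q ≤ payoff N p q :=
  Finset.sum_le_sum fun a _ => Finset.sum_le_sum fun b _ =>
    mul_le_mul_of_nonneg_left (h a b) (by positivity)

theorem payoff_add (p q : Measure A) (M N : A → A → ℝ) :
    payoff (fun a b => M a b + N a b) p q = payoff M p q + payoff N p q := by
  simp only [payoff, mul_add, Finset.sum_add_distrib]

theorem payoff_const [MeasurableSingletonClass A] (p q : Measure A) [IsProbabilityMeasure p]
    [IsProbabilityMeasure q] (c : ℝ) : payoff (fun _ _ => c) p q = c := by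
  simp only [payoff, ← Finset.sum_mul, ← Finset.mul_sum, sum_real_singleton, mul_one, one_mul]

theorem abs_payoff_le [MeasurableSingletonClass A] {p q : Measure A} [IsProbabilityMeasure p]
    [IsProbabilityMeasure q] {M : A → A → ℝ} {c : ℝ} (h : ∀ a b, |M a b| ≤ c) :
    |payoff M p q| ≤ c := by
  rw [abs_le]
  constructor
  · rw [← payoff_const p q (-c)]
    exact payoff_mono fun a b => (abs_le.1 (h a b)).1
  · rw [← payoff_const p q c]
    exact payoff_mono fun a b => (abs_le.1 (h a b)).2

theorem integral_prod_eq_payoff [MeasurableSingletonClass A] (p q : Measure A)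
    [IsProbabilityMeasure p] [IsProbabilityMeasure q] (M : A × A → ℝ) :
    ∫ c, M c ∂(p.prod q) = payoff (fun a b => M (a, b)) p q := by
  rw [integral_fintype .of_finite, Fintype.sum_prod_type]
  refine Finset.sum_congr rfl fun a _ => Finset.sum_congr rfl fun b _ => ?_
  rw [← Set.singleton_prod_singleton, measureReal_prod_prod, smul_eq_mul]

/-- The expected total of the costs `g h, …, g (h + n - 1)` along the play of `π` against `ν`
started in a given state at step `h`, defined by backward recursion. -/
noncomputable def cumul (G : MarkovGame S A) (π ν : Policy S A) (g : ℕ → S × A × A → ℝ) :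
    (n : ℕ) → (h : ℕ) → S → ℝ
  | 0, _, _ => 0
  | n + 1, h, x =>
    payoff (fun a b => g h (x, a, b) + ∫ y, cumul G π ν g n (h + 1) y ∂G.trans h (x, a, b))
      (π.act h x) (ν.act h x)

instance (G : MarkovGame S A) (π ν : Policy S A) (n h : ℕ) : IsMarkovKernel (G.traj π ν n h) := by
  induction n generalizing h with
  | zero => rw [MarkovGame.traj]; infer_instance
  | succ n ih =>
    rw [MarkovGame.traj]
    have := ih (h + 1)
    exact Kernel.IsMarkovKernel.map _ (measurable_finCons n)

theorem cumul_nonneg (G : MarkovGame S A) (π ν : Policy S A) {g : ℕ → S × A × A → ℝ}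
    (hg : ∀ h z, 0 ≤ g h z) (n h : ℕ) (x : S) : 0 ≤ cumul G π ν g n h x := by
  induction n generalizing h x with
  | zero => simp [cumul]
  | succ n ih =>
    refine Finset.sum_nonneg fun a _ => Finset.sum_nonneg fun b _ => ?_
    exact mul_nonneg (by positivity) (add_nonneg (hg _ _) (integral_nonneg (ih (h + 1))))

variable [MeasurableSingletonClass A]


theorem measurable_cumul (G : MarkovGame S A) (π ν : Policy S A) {g : ℕ → S × A × A → ℝ}
    (hg : ∀ h, Measurable (g h)) (n h : ℕ) : Measurable (cumul G π ν g n h) := by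
  induction n generalizing h with
  | zero => exact measurable_const
  | succ n ih =>
    refine measurable_payoff (π.measurable_act h) (ν.measurable_act h) fun a b => ?_
    have h1 : Measurable fun x : S => (x, a, b) := by fun_prop
    exact ((hg h).comp h1).add ((measurable_integral_trans G h (ih (h + 1))).comp h1)

theorem abs_cumul_le (G : MarkovGame S A) (π ν : Policy S A) {g : ℕ → S × A × A → ℝ} {c : ℝ}
    (hg : ∀ h z, |g h z| ≤ c) (n h : ℕ) (x : S) : |cumul G π ν g n h x| ≤ n * c := by
  induction n generalizing h x with
  | zero => simp [cumul]
  | succ n ih =>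
    refine abs_payoff_le fun a b => (abs_add_le _ _).trans ?_
    have h1 := hg h (x, a, b)
    have h2 := abs_integral_le (G.trans h (x, a, b)) (ih (h + 1))
    push_cast
    linarith

/-- Bellman's recursion: the total expected along the law of the trajectory is the one given by
backward recursion. -/
theorem integral_traj_eq_cumul (G : MarkovGame S A) (π ν : Policy S A) {g : ℕ → S × A × A → ℝ}
    (hg : ∀ h, Measurable (g h)) {c : ℝ} (hc : ∀ h z, |g h z| ≤ c) (n h : ℕ) (x : S) :
    ∫ τ, ∑ i : Fin n, g (h + (i : ℕ)) (τ i) ∂G.traj π ν n h x = cumul G π ν g n h x := by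
  have hmeas : ∀ n h, Measurable fun τ : Fin n → S × A × A => ∑ i : Fin n, g (h + (i : ℕ)) (τ i) :=
    fun n h => Finset.measurable_fun_sum _ fun i _ => (hg _).comp (measurable_pi_apply i)
  have hbd : ∀ n h, ∀ τ : Fin n → S × A × A, |∑ i : Fin n, g (h + (i : ℕ)) (τ i)| ≤ n * c := by
    intro n h τ
    refine (Finset.abs_sum_le_sum_abs _ _).trans ?_
    refine (Finset.sum_le_sum fun i _ => hc _ _).trans_eq (by simp)
  induction n generalizing h x with
  | zero => simp [cumul]
  | succ n ih =>
    have hcons := measurable_finCons (T := S × A × A) n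
    have hF : Measurable fun q : (S × A × A) × (Fin n → S × A × A) =>
        ∑ i : Fin (n + 1), g (h + (i : ℕ)) ((Fin.cons q.1 q.2 : Fin (n + 1) → S × A × A) i) :=
      (hmeas (n + 1) h).comp hcons
    have hFb := fun q : (S × A × A) × (Fin n → S × A × A) => hbd (n + 1) h (Fin.cons q.1 q.2)
    have hG : Measurable fun z => ∫ τ, ∑ i : Fin (n + 1),
        g (h + (i : ℕ)) ((Fin.cons z τ : Fin (n + 1) → S × A × A) i)
          ∂(G.traj π ν n (h + 1) ∘ₖ G.trans h) z :=
      (hF.stronglyMeasurable.integral_kernel_prod_right'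
        (κ := G.traj π ν n (h + 1) ∘ₖ G.trans h)).measurable
    rw [MarkovGame.traj, Kernel.map_apply _ hcons,
      integral_map hcons.aemeasurable (hmeas _ _).aestronglyMeasurable,
      integral_compProd (integrable_of_abs_le _ hF hFb),
      Kernel.prod_apply, Kernel.id_apply, Measure.dirac_prod]
    simp only [Kernel.prodMkLeft_apply]
    rw [integral_map (by fun_prop) hG.aestronglyMeasurable, Kernel.prod_apply,
      integral_prod_eq_payoff, cumul]
    congr 1
    funext a b
    have hint := integrable_of_abs_le ((G.traj π ν n (h + 1) ∘ₖ G.trans h) (x, a, b))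
      (hmeas n (h + 1)) (hbd n (h + 1))
    have hsum : ∀ τ : Fin n → S × A × A, ∑ i : Fin (n + 1),
        g (h + (i : ℕ)) ((Fin.cons (x, a, b) τ : Fin (n + 1) → S × A × A) i)
          = g h (x, a, b) + ∑ i : Fin n, g (h + 1 + (i : ℕ)) (τ i) := by
      intro τ
      rw [Fin.sum_univ_succ]
      simp [add_comm, add_left_comm]
    simp only [hsum]
    rw [integral_add (integrable_const _) hint, Kernel.integral_comp hint]
    simp [ih]

/-- The value function of the game is the expected total reward. -/
theorem value_eq_cumul (G : MarkovGame S A) (π ν : Policy S A) (h : ℕ) (x : S) :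
    G.value π ν h x = cumul G π ν G.reward (G.horizon + 1 - h) h x :=
  integral_traj_eq_cumul G π ν G.measurable_reward G.abs_reward_le _ h x

end Recursion

section MatrixGame

theorem abs_entry_le_norm {A : Type*} [Fintype A] (M : A → A → ℝ) (a b : A) : |M a b| ≤ ‖M‖ :=
  (norm_le_pi_norm (M a) b).trans (norm_le_pi_norm M a)

variable {A : Type*} [Fintype A] [MeasurableSpace A]

/-- The lower value `sup_p inf_q` of the zero-sum matrix game `M`. -/
noncomputable def lowerValue (M : A → A → ℝ) : ℝ :=
  ⨆ p : ProbabilityMeasure A, ⨅ q : ProbabilityMeasure A, payoff M p q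

variable [MeasurableSingletonClass A]

theorem bddBelow_payoff (M : A → A → ℝ) (p : ProbabilityMeasure A) :
    BddBelow (Set.range fun q : ProbabilityMeasure A => payoff M p q) := by
  refine ⟨-‖M‖, ?_⟩
  rintro _ ⟨q, rfl⟩
  exact (abs_le.1 (abs_payoff_le (abs_entry_le_norm M))).1

theorem bddAbove_iInf_payoff (M : A → A → ℝ) :
    BddAbove (Set.range fun p : ProbabilityMeasure A =>
      ⨅ q : ProbabilityMeasure A, payoff M p q) := by
  refine ⟨‖M‖, ?_⟩
  rintro _ ⟨p, rfl⟩
  exact (ciInf_le (bddBelow_payoff M p) p).trans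
    (abs_le.1 (abs_payoff_le (abs_entry_le_norm M))).2

/-- At a Nash equilibrium the payoff is the lower value; no minimax theorem is involved, because
the equilibrium is given. -/
theorem IsMatrixNash.payoff_eq_lowerValue {M : A → A → ℝ} {p q : Measure A}
    (h : IsMatrixNash M p q) : payoff M p q = lowerValue M := by
  obtain ⟨hp, hq, hmax, hmin⟩ := h
  have : Nonempty (ProbabilityMeasure A) := ⟨⟨p, hp⟩⟩
  refine le_antisymm ?_ ?_
  · exact (le_ciInf fun q' : ProbabilityMeasure A => hmin q' q'.2).trans
      (le_ciSup (bddAbove_iInf_payoff M) ⟨p, hp⟩)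
  · exact ciSup_le fun p' => (ciInf_le (bddBelow_payoff M p') ⟨q, hq⟩).trans (hmax p' p'.2)

theorem lowerValue_le_add {M N : A → A → ℝ} {ε : ℝ} (hε : 0 ≤ ε)
    (h : ∀ a b, M a b ≤ N a b + ε) : lowerValue M ≤ lowerValue N + ε := by
  rcases isEmpty_or_nonempty (ProbabilityMeasure A) with hA | hA
  · simpa [lowerValue] using hε
  refine ciSup_le fun p => ?_
  rw [← sub_le_iff_le_add]
  refine le_trans ?_ (le_ciSup (bddAbove_iInf_payoff N) p)
  refine le_ciInf fun q => ?_
  rw [sub_le_iff_le_add, ← payoff_const (p : Measure A) (q : Measure A) ε, ← payoff_add]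
  exact (ciInf_le (bddBelow_payoff M p) q).trans (payoff_mono h)

theorem abs_lowerValue_sub_le {M N : A → A → ℝ} {ε : ℝ} (hε : 0 ≤ ε)
    (h : ∀ a b, |M a b - N a b| ≤ ε) : |lowerValue M - lowerValue N| ≤ ε := by
  have h1 : lowerValue M ≤ lowerValue N + ε :=
    lowerValue_le_add hε fun a b => by linarith [(abs_le.1 (h a b)).2]
  have h2 : lowerValue N ≤ lowerValue M + ε :=
    lowerValue_le_add hε fun a b => by linarith [(abs_le.1 (h a b)).1]
  rw [abs_le]
  constructor <;> linarith

theorem abs_lowerValue_le {M : A → A → ℝ} {c : ℝ} (hc : 0 ≤ c) (h : ∀ a b, |M a b| ≤ c) :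
    |lowerValue M| ≤ c := by
  rcases isEmpty_or_nonempty (ProbabilityMeasure A) with hA | hA
  · simpa [lowerValue] using hc
  have h0 : lowerValue (fun _ _ : A => (0 : ℝ)) = 0 := by
    simp [lowerValue, payoff]
  have h1 := abs_lowerValue_sub_le (M := M) (N := fun _ _ => 0) hc (by simpa using h)
  rwa [h0, sub_zero] at h1

theorem measurable_lowerValue : Measurable (lowerValue : (A → A → ℝ) → ℝ) := by
  refine (LipschitzWith.of_le_add fun M N => ?_).continuous.measurable
  refine lowerValue_le_add dist_nonneg fun a b => ?_
  have h := abs_entry_le_norm (M - N) a b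
  rw [← dist_eq_norm] at h
  linarith [(abs_le.1 h).2, show (M - N) a b = M a b - N a b from rfl]

end MatrixGame

section Linear

variable {S : Type*} [MeasurableSpace S]

theorem measureReal_sum {ι : Type*} [Fintype ι] (m : ι → Measure S) [∀ i, IsFiniteMeasure (m i)]
    (E : Set S) : (∑ i, m i).real E = ∑ i, (m i).real E := by
  simp [measureReal_def, ENNReal.toReal_sum]

theorem signedMeasure_apply_eq (μ : SignedMeasure S) {E : Set S} (hE : MeasurableSet E) :
    μ E = μ.toJordanDecomposition.posPart.real E - μ.toJordanDecomposition.negPart.real E := by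
  conv_lhs => rw [← μ.toSignedMeasure_toJordanDecomposition]
  simp [JordanDecomposition.toSignedMeasure, Measure.toSignedMeasure_apply_measurable hE]

/-- A measure that is a linear combination of signed measures integrates bounded functions by the
same linear combination. The terms with negative coefficients and the negative parts are moved to
the side of `P`, so that both sides are honest measures. -/
theorem integral_eq_sum_signedIntegral {ι : Type*} [Fintype ι] {P : Measure S} [IsFiniteMeasure P]
    {μ : ι → SignedMeasure S} {c : ι → ℝ}
    (h : ∀ E, MeasurableSet E → P.real E = ∑ i, c i * μ i E) {f : S → ℝ} (hf : Measurable f)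
    {r : ℝ} (hr : ∀ x, |f x| ≤ r) : ∫ x, f x ∂P = ∑ i, c i * signedIntegral (μ i) f := by
  set mp := fun i => (μ i).toJordanDecomposition.posPart with hmp
  set mn := fun i => (μ i).toJordanDecomposition.negPart with hmn
  have hfin_p : ∀ i, IsFiniteMeasure (mp i) := fun i => inferInstance
  have hfin_n : ∀ i, IsFiniteMeasure (mn i) := fun i => inferInstance
  set lhs := ∑ i, ((c i).toNNReal • mn i + (-c i).toNNReal • mp i) with hlhs
  set rhs := ∑ i, ((c i).toNNReal • mp i + (-c i).toNNReal • mn i) with hrhs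
  have hc : ∀ i, c i = ((c i).toNNReal : ℝ) - ((-c i).toNNReal : ℝ) := fun i => by
    simp only [Real.coe_toNNReal']
    rcases le_total 0 (c i) with h | h <;> simp [h]
  have hmeas : P + lhs = rhs := by
    refine Measure.ext fun E hE => ?_
    have hE' : P.real E + lhs.real E = rhs.real E := by
      rw [h E hE, hlhs, hrhs, measureReal_sum, measureReal_sum, ← Finset.sum_add_distrib]
      refine Finset.sum_congr rfl fun i _ => ?_
      rw [measureReal_add_apply, measureReal_add_apply]
      simp only [measureReal_nnreal_smul_apply, signedMeasure_apply_eq (μ i) hE]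
      linear_combination ((mp i).real E - (mn i).real E) * hc i
    rw [← measureReal_add_apply] at hE'
    exact (measureReal_eq_measureReal_iff).1 hE'
  have hint : ∀ (m : Measure S) [IsFiniteMeasure m], Integrable f m := fun m _ =>
    integrable_of_abs_le m hf hr
  have key : ∫ x, f x ∂(P + lhs) = ∫ x, f x ∂rhs := by rw [hmeas]
  rw [integral_add_measure (hint _) (hint _), hlhs, hrhs,
    integral_finsetSum_measure fun i _ => hint _,
    integral_finsetSum_measure fun i _ => hint _, ← eq_sub_iff_add_eq,
    ← Finset.sum_sub_distrib] at key
  rw [key]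
  refine Finset.sum_congr rfl fun i _ => ?_
  rw [integral_add_measure (hint _) (hint _), integral_add_measure (hint _) (hint _)]
  simp only [integral_smul_nnreal_measure, NNReal.smul_def, smul_eq_mul, signedIntegral]
  linear_combination (-(∫ x, f x ∂(mp i) - ∫ x, f x ∂(mn i))) * hc i

/-- In a linear game the right-hand side of the Bellman equation is linear in the features, with
a weight vector of norm at most `2 H √d`. -/
theorem exists_weight_of_isLinear {A : Type*} [MeasurableSpace A] {G : MarkovGame S A} {d : ℕ}
    {φ : S × A × A → EuclideanSpace ℝ (Fin d)} (hG : G.IsLinear φ) {h : ℕ} (h1 : 1 ≤ h)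
    (hH : h ≤ G.horizon) {f : S → ℝ} (hf : Measurable f) (hr : ∀ x, |f x| ≤ G.horizon) :
    ∃ w : Fin d → ℝ, √(w ⬝ᵥ w) ≤ 2 * G.horizon * √d ∧
      ∀ z, G.reward h z + ∫ y, f y ∂G.trans h z = w ⬝ᵥ (φ z).ofLp := by
  obtain ⟨-, -, θ, μ, hlin⟩ := hG
  obtain ⟨hrew, htrans, hθ, hμ⟩ := hlin h h1 hH
  have hHpos : (1 : ℝ) ≤ G.horizon := by exact_mod_cast h1.trans hH
  set H : ℝ := (G.horizon : ℝ)
  -- the bound on `∫ f dμ` is available for functions with values in `[-1, 1]`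
  set f' : S → ℝ := fun x => H⁻¹ * f x with hf'
  have hf'1 : ∀ x, |f' x| ≤ 1 := fun x => by
    rw [hf', abs_mul, abs_of_pos (by positivity : 0 < H⁻¹), inv_mul_le_iff₀ (by linarith)]
    simpa using hr x
  have hfeq : ∀ i, signedIntegral (μ h i) f = H * signedIntegral (μ h i) f' := fun i => by
    simp only [signedIntegral, hf', integral_const_mul]
    field_simp
  set u : EuclideanSpace ℝ (Fin d) := WithLp.toLp 2 fun i => signedIntegral (μ h i) f' with hu
  refine ⟨(θ h + H • u).ofLp, ?_, fun z => ?_⟩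
  · have h2 : √((θ h + H • u).ofLp ⬝ᵥ (θ h + H • u).ofLp) = ‖θ h + H • u‖ := by
      rw [EuclideanSpace.norm_eq]
      simp [dotProduct, sq]
    rw [h2]
    refine (norm_add_le _ _).trans ?_
    rw [norm_smul, Real.norm_of_nonneg (by positivity)]
    have h3 : ‖u‖ ≤ √d := hμ f' (hf.const_mul _) hf'1
    have h4 : √(d : ℝ) ≤ H * √d := le_mul_of_one_le_left (by positivity) hHpos
    have h5 : H * ‖u‖ ≤ H * √d := by gcongr
    linarith
  · rw [hrew, integral_eq_sum_signedIntegral (htrans z) hf hr, ← Finset.sum_add_distrib]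
    refine Finset.sum_congr rfl fun i _ => ?_
    rw [hfeq]
    simp [hu]
    ring

end Linear

/-! ### Optimism and the expected bonuses -/

section Clip

theorem abs_clip_le {H : ℝ} (hH : 0 ≤ H) (u : ℝ) : |clip H u| ≤ H := by
  rw [abs_le, clip]
  exact ⟨le_max_right _ _, max_le (min_le_right _ _) (by linarith)⟩

theorem abs_clip_sub_clip_le (H u v : ℝ) : |clip H u - clip H v| ≤ |u - v| :=
  (abs_max_sub_max_le_abs _ _ _).trans (abs_min_sub_min_le_max _ _ _ _ |>.trans (by simp))

theorem measurable_clip (H : ℝ) : Measurable (clip H) := by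
  unfold clip
  fun_prop

theorem le_clip {H u v : ℝ} (huv : v ≤ u) (hv : v ≤ H) : v ≤ clip H u :=
  le_max_of_le_left (le_min huv hv)

theorem clip_le {H u v : ℝ} (huv : u ≤ v) (hv : -H ≤ v) : clip H u ≤ v :=
  max_le ((min_le_left _ _).trans huv) hv

end Clip

section Estimates

variable {S A : Type*} {d : ℕ}

theorem gram_eq_regGram (φ : S × A × A → EuclideanSpace ℝ (Fin d)) (D : Record S A) (k h : ℕ) :
    gram φ D k h = regGram (fun τ => (φ (D.triple τ h)).ofLp) k := rfl

/-- The elliptical norm of the features, `√(φᵀ (Λ_h^k)⁻¹ φ)`. -/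
noncomputable def bonus (φ : S × A × A → EuclideanSpace ℝ (Fin d)) (D : Record S A) (k h : ℕ)
    (z : S × A × A) : ℝ :=
  √((φ z).ofLp ⬝ᵥ ((gram φ D k h)⁻¹ *ᵥ (φ z).ofLp))

variable [MeasurableSpace S] [MeasurableSpace A]

/-- The bonus is doubled, since it enters the estimation error from both sides, and capped at the
trivial bound on the error. -/
noncomputable def cappedBonus (G : MarkovGame S A) (φ : S × A × A → EuclideanSpace ℝ (Fin d))
    (β : ℝ) (D : Record S A) (k h : ℕ) (z : S × A × A) : ℝ :=
  min (2 * β * bonus φ D k h z) (3 * G.horizon)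

theorem cappedBonus_nonneg (G : MarkovGame S A) (φ : S × A × A → EuclideanSpace ℝ (Fin d))
    {β : ℝ} (hβ : 0 ≤ β) (D : Record S A) (k h : ℕ) (z : S × A × A) :
    0 ≤ cappedBonus G φ β D k h z :=
  le_min (mul_nonneg (by positivity) (Real.sqrt_nonneg _)) (by positivity)

theorem abs_cappedBonus_le (G : MarkovGame S A) (φ : S × A × A → EuclideanSpace ℝ (Fin d))
    {β : ℝ} (hβ : 0 ≤ β) (D : Record S A) (k h : ℕ) (z : S × A × A) :
    |cappedBonus G φ β D k h z| ≤ 3 * G.horizon := by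
  rw [abs_of_nonneg (cappedBonus_nonneg G φ hβ D k h z)]
  exact min_le_right _ _

theorem measurable_dotProduct {T ι : Type*} [Fintype ι] [MeasurableSpace T] {f g : T → ι → ℝ}
    (hf : ∀ i, Measurable fun x => f x i) (hg : ∀ i, Measurable fun x => g x i) :
    Measurable fun x => f x ⬝ᵥ g x :=
  Finset.measurable_fun_sum _ fun i _ => (hf i).mul (hg i)

theorem measurable_coord {T : Type*} [MeasurableSpace T] {f : T → EuclideanSpace ℝ (Fin d)}
    (hf : Measurable f) (i : Fin d) : Measurable fun x => (f x).ofLp i :=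
  (measurable_pi_apply i).comp ((WithLp.measurable_ofLp 2 _).comp hf)

theorem measurable_quadratic {T : Type*} [MeasurableSpace T] {f : T → EuclideanSpace ℝ (Fin d)}
    (hf : Measurable f) (M : Matrix (Fin d) (Fin d) ℝ) :
    Measurable fun x => (f x).ofLp ⬝ᵥ (M *ᵥ (f x).ofLp) :=
  measurable_dotProduct (measurable_coord hf) fun _ =>
    measurable_dotProduct (fun _ => measurable_const) (measurable_coord hf)

variable (G : MarkovGame S A) {φ : S × A × A → EuclideanSpace ℝ (Fin d)} {β : ℝ}
  (D : Record S A) (k : ℕ)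

theorem measurable_optQStep (hφ : Measurable φ) (h : ℕ) (V : S → ℝ) :
    Measurable (optQStep G φ β D k h V) := by
  refine (measurable_clip _).comp ?_
  have h1 : Measurable fun z => weight G φ D k h V ⬝ᵥ (φ z).ofLp :=
    measurable_dotProduct (fun _ => measurable_const) (measurable_coord hφ)
  exact h1.add ((measurable_quadratic hφ (gram φ D k h)⁻¹).sqrt.const_mul β)

theorem measurable_cappedBonus (hφ : Measurable φ) (h : ℕ) :
    Measurable (cappedBonus G φ β D k h) :=
  ((measurable_quadratic hφ _).sqrt.const_mul _).min measurable_const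

variable [Fintype A] (π B : Policy S A)

theorem optV_eq_payoff {h : ℕ} (hH : h ≤ G.horizon) (x : S) :
    optV G φ β D k π B h x
      = payoff (fun a b => optQ G φ β D k π B h (x, a, b)) (π.act h x) (B.act h x) := by
  rw [optV, show G.horizon + 1 - h = G.horizon + 1 - (h + 1) + 1 by omega]
  rfl

theorem optV_of_horizon_lt {h : ℕ} (hH : G.horizon < h) (x : S) :
    optV G φ β D k π B h x = 0 := by
  rw [optV, show G.horizon + 1 - h = 0 by omega]
  rfl

variable [MeasurableSingletonClass A]

theorem measurable_optVAux (hφ : Measurable φ) (n h : ℕ) :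
    Measurable (optVAux G φ β D k π B n h) := by
  cases n with
  | zero => exact measurable_const
  | succ n =>
    refine measurable_payoff (π.measurable_act h) (B.measurable_act h) fun a b => ?_
    have h1 : Measurable fun x : S => (x, a, b) := by fun_prop
    exact (measurable_optQStep G D k hφ h _).comp h1

theorem measurable_optV (hφ : Measurable φ) (h : ℕ) : Measurable (optV G φ β D k π B h) :=
  measurable_optVAux G D k π B hφ _ h

theorem abs_optV_le (h : ℕ) (x : S) : |optV G φ β D k π B h x| ≤ G.horizon := by
  rw [optV]
  cases G.horizon + 1 - h with
  | zero => simp [optVAux]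
  | succ n => exact abs_payoff_le fun a b => abs_clip_le (by positivity) _

/-- The least-squares predictions of episode `k` are accurate up to the bonus. -/
def IsAccurate (φ : S × A × A → EuclideanSpace ℝ (Fin d)) (β : ℝ) : Prop :=
  ∀ h, 1 ≤ h → h ≤ G.horizon → ∀ z,
    |weight G φ D k h (optV G φ β D k π B (h + 1)) ⬝ᵥ (φ z).ofLp
      - (G.reward h z + ∫ y, optV G φ β D k π B (h + 1) y ∂G.trans h z)| ≤ β * bonus φ D k h z

variable {G D k π B}

/-- Optimism: the estimate dominates the value of every policy `π'` against the auxiliary policy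
`B`, because `π` maximizes the payoff of `Q_h^k` against `B`. -/
theorem cumul_reward_le_optV (hφ : Measurable φ) (hacc : IsAccurate G D k π B φ β)
    (homni : IsOmniPolicy G φ β D k π B) (π' : Policy S A) (n : ℕ) :
    ∀ h, 1 ≤ h → h + n = G.horizon + 1 → ∀ x,
      cumul G π' B G.reward n h x ≤ optV G φ β D k π B h x := by
  induction n with
  | zero =>
    intro h _ hn x
    rw [optV_of_horizon_lt G D k π B (by omega)]
    rfl
  | succ n ih =>
    intro h h1 hn x
    rw [optV_eq_payoff G D k π B (by omega)]
    refine le_trans (payoff_mono fun a b => ?_)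
      ((homni h h1 (by omega) x).2.2.1 (π'.act h x) inferInstance)
    have hint : ∫ y, cumul G π' B G.reward n (h + 1) y ∂G.trans h (x, a, b)
        ≤ ∫ y, optV G φ β D k π B (h + 1) y ∂G.trans h (x, a, b) :=
      integral_mono
        (integrable_of_abs_le _ (measurable_cumul G π' B G.measurable_reward n (h + 1))
          (abs_cumul_le G π' B G.abs_reward_le n (h + 1)))
        (integrable_of_abs_le _ (measurable_optV G D k π B hφ (h + 1))
          (abs_optV_le G D k π B (h + 1)))
        (ih (h + 1) (by omega) (by omega))
    have hacc' := (abs_le.1 (hacc h h1 (by omega) (x, a, b))).1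
    refine le_clip ?_ ?_
    · rw [bonus] at hacc'
      linarith
    · have h2 := (abs_le.1 (abs_integral_le (G.trans h (x, a, b))
        (abs_cumul_le G π' B G.abs_reward_le n (h + 1)))).2
      have h3 := (abs_le.1 (G.abs_reward_le h (x, a, b))).2
      have h4 : (n : ℝ) + 1 ≤ G.horizon := by exact_mod_cast (by omega : n + 1 ≤ G.horizon)
      linarith

/-- Along the play of `π` against any `ν`, the excess of the estimate over the value is at most
the expected total of the capped bonuses, because `B` minimizes the payoff of `Q_h^k`
against `π`. -/
theorem optV_sub_cumul_reward_le (hφ : Measurable φ) (hβ : 0 ≤ β)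
    (hacc : IsAccurate G D k π B φ β) (homni : IsOmniPolicy G φ β D k π B) (ν : Policy S A)
    (n : ℕ) : ∀ h, 1 ≤ h → h + n = G.horizon + 1 → ∀ x,
      optV G φ β D k π B h x
        ≤ cumul G π ν G.reward n h x + cumul G π ν (cappedBonus G φ β D k) n h x := by
  induction n with
  | zero =>
    intro h _ hn x
    rw [optV_of_horizon_lt G D k π B (by omega)]
    simp [cumul]
  | succ n ih =>
    intro h h1 hn x
    have hH : h ≤ G.horizon := by omega
    rw [optV_eq_payoff G D k π B hH]
    refine le_trans ((homni h h1 hH x).2.2.2 (ν.act h x) inferInstance) ?_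
    rw [cumul, cumul, ← payoff_add]
    refine payoff_mono fun a b => ?_
    set z := (x, a, b) with hz
    have hi1 := integrable_of_abs_le (G.trans h z)
      (measurable_cumul G π ν G.measurable_reward n (h + 1))
      (abs_cumul_le G π ν G.abs_reward_le n (h + 1))
    have hi2 := integrable_of_abs_le (G.trans h z)
      (measurable_cumul G π ν (measurable_cappedBonus (β := β) G D k hφ) n (h + 1))
      (abs_cumul_le G π ν (abs_cappedBonus_le G φ hβ D k) n (h + 1))
    have hint : ∫ y, optV G φ β D k π B (h + 1) y ∂G.trans h z
        ≤ ∫ y, cumul G π ν G.reward n (h + 1) y ∂G.trans h z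
          + ∫ y, cumul G π ν (cappedBonus G φ β D k) n (h + 1) y ∂G.trans h z := by
      rw [← integral_add hi1 hi2]
      exact integral_mono
        (integrable_of_abs_le _ (measurable_optV G D k π B hφ (h + 1))
          (abs_optV_le G D k π B (h + 1)))
        (hi1.add hi2) (ih (h + 1) (by omega) (by omega))
    suffices hQ : optQ G φ β D k π B h z ≤ G.reward h z
        + ∫ y, optV G φ β D k π B (h + 1) y ∂G.trans h z + cappedBonus G φ β D k h z by
      linarith
    have hacc' := (abs_le.1 (hacc h h1 hH z)).2
    have hr := (abs_le.1 (G.abs_reward_le h z)).1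
    have hH1 : (1 : ℝ) ≤ G.horizon := by exact_mod_cast h1.trans hH
    have hb : 0 ≤ β * bonus φ D k h z := mul_nonneg hβ (Real.sqrt_nonneg _)
    have hQH : optQ G φ β D k π B h z ≤ G.horizon :=
      (abs_le.1 (abs_clip_le (by positivity) _)).2
    have hV := (abs_le.1 (abs_integral_le (G.trans h z) (abs_optV_le G D k π B (φ := φ) (β := β)
      (h + 1)))).1
    -- optimism keeps the lower clipping at `-H` harmless
    have hlow : -(n : ℝ) ≤ ∫ y, optV G φ β D k π B (h + 1) y ∂G.trans h z := by
      have h2 : ∀ y, -(n : ℝ) ≤ optV G φ β D k π B (h + 1) y := fun y => by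
        refine le_trans ?_ (cumul_reward_le_optV hφ hacc homni π n (h + 1) (by omega)
          (by omega) y)
        simpa using (abs_le.1 (abs_cumul_le G π B G.abs_reward_le n (h + 1) y)).1
      simpa using integral_mono (μ := G.trans h z) (integrable_const (-(n : ℝ)))
        (integrable_of_abs_le _ (measurable_optV G D k π B hφ (h + 1))
          (abs_optV_le G D k π B (h + 1))) h2
    have hn' : (n : ℝ) + 1 ≤ G.horizon := by exact_mod_cast (by omega : n + 1 ≤ G.horizon)
    rw [cappedBonus, ← min_add_add_left]
    refine le_min ?_ (by linarith)
    refine clip_le ?_ ?_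
    · rw [← bonus]
      linarith
    · linarith [mul_assoc 2 β (bonus φ D k h z)]

end Estimates

/-! ### Disintegration and concentration -/

section Disintegration

section JointLaw

variable {Ω Ω' T S : Type*} [MeasurableSpace Ω] [mΩ' : MeasurableSpace Ω'] [MeasurableSpace T]
  [MeasurableSpace S] {P : Measure Ω} [IsProbabilityMeasure P] {Y : Ω → Ω'} {X : Ω → S} {Z : Ω' → T}

/-- If the conditional law of `X` given `Y` is `κ (Z Y)`, in the sense that it holds on
rectangles, then the joint law of `(Y, X)` is the law of `Y` followed by `κ ∘ Z`. -/
theorem map_prodMk_eq_compProd (hY : Measurable Y) (hX : Measurable X) (hZ : Measurable Z)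
    (κ : Kernel T S) [IsMarkovKernel κ]
    (h : ∀ F E, MeasurableSet F → MeasurableSet E →
      P (Y ⁻¹' F ∩ X ⁻¹' E) = ∫⁻ ω in Y ⁻¹' F, κ (Z (Y ω)) E ∂P) :
    P.map (fun ω => (Y ω, X ω)) = (P.map Y) ⊗ₘ (κ.comap Z hZ) := by
  refine Measure.ext_prod fun {F E} hF hE => ?_
  rw [Measure.map_apply (hY.prodMk hX) (hF.prod hE), Measure.compProd_apply_prod hF hE,
    Measure.restrict_map hY hF, lintegral_map ((κ.comap Z hZ).measurable_coe hE) hY]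
  exact h F E hF hE

theorem lintegral_eq_of_rectangles (hY : Measurable Y) (hX : Measurable X) (hZ : Measurable Z)
    (κ : Kernel T S) [IsMarkovKernel κ]
    (h : ∀ F E, MeasurableSet F → MeasurableSet E →
      P (Y ⁻¹' F ∩ X ⁻¹' E) = ∫⁻ ω in Y ⁻¹' F, κ (Z (Y ω)) E ∂P)
    {F : Ω' × S → ENNReal} (hF : Measurable F) :
    ∫⁻ ω, F (Y ω, X ω) ∂P = ∫⁻ ω, ∫⁻ x, F (Y ω, x) ∂κ (Z (Y ω)) ∂P := by
  have := Measure.isProbabilityMeasure_map (μ := P) hY.aemeasurable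
  rw [← lintegral_map hF (hY.prodMk hX), map_prodMk_eq_compProd hY hX hZ κ h,
    Measure.lintegral_compProd hF,
    lintegral_map (hF.lintegral_kernel_prod_right' (κ := κ.comap Z hZ)) hY]
  rfl

theorem integral_eq_of_rectangles (hY : Measurable Y) (hX : Measurable X) (hZ : Measurable Z)
    (κ : Kernel T S) [IsMarkovKernel κ]
    (h : ∀ F E, MeasurableSet F → MeasurableSet E →
      P (Y ⁻¹' F ∩ X ⁻¹' E) = ∫⁻ ω in Y ⁻¹' F, κ (Z (Y ω)) E ∂P)
    {F : Ω' × S → ℝ} (hF : Measurable F) {c : ℝ} (hc : ∀ q, |F q| ≤ c) :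
    ∫ ω, F (Y ω, X ω) ∂P = ∫ ω, ∫ x, F (Y ω, x) ∂κ (Z (Y ω)) ∂P := by
  have := Measure.isProbabilityMeasure_map (μ := P) hY.aemeasurable
  rw [← integral_map (hY.prodMk hX).aemeasurable hF.aestronglyMeasurable,
    map_prodMk_eq_compProd hY hX hZ κ h,
    Measure.integral_compProd (integrable_of_abs_le _ hF hc),
    integral_map hY.aemeasurable (hF.stronglyMeasurable.integral_kernel_prod_right'
      (κ := κ.comap Z hZ)).aestronglyMeasurable]
  rfl

end JointLaw

/-- Conditional probabilities on the sets of a sub-σ-algebra, in rectangle form. -/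
theorem measure_inter_eq_setLIntegral {Ω T S : Type*} {m mΩ : MeasurableSpace Ω}
    [MeasurableSpace T] [MeasurableSpace S] {P : Measure Ω} [IsProbabilityMeasure P] (hm : m ≤ mΩ)
    {Z : Ω → T} (hZ : Measurable[m] Z) {X : Ω → S} (hX : Measurable X) (κ : Kernel T S)
    [IsMarkovKernel κ]
    (hlaw : ∀ E : Set S, MeasurableSet E →
      P⟦{ω | X ω ∈ E} | m⟧ =ᵐ[P] fun ω => (κ (Z ω)).real E)
    {F : Set Ω} {E : Set S} (hF : MeasurableSet[m] F) (hE : MeasurableSet E) :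
    P (F ∩ X ⁻¹' E) = ∫⁻ ω in F, κ (Z ω) E ∂P := by
  have hXE : MeasurableSet {ω | X ω ∈ E} := hX hE
  have h1 := setIntegral_condExp (μ := P) hm
    ((integrable_const (1 : ℝ)).indicator hXE) hF
  have h2 : ∫ ω in F, (P⟦{ω | X ω ∈ E} | m⟧) ω ∂P = ∫ ω in F, (κ (Z ω)).real E ∂P :=
    setIntegral_congr_ae (hm F hF) ((hlaw E hE).mono fun ω h _ => h)
  rw [h2, setIntegral_indicator hXE, setIntegral_const, smul_eq_mul, mul_one] at h1
  have hmeas : Measurable fun ω => κ (Z ω) E :=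
    (κ.measurable_coe hE).comp (hZ.mono hm le_rfl)
  have hlt : ∫⁻ ω in F, κ (Z ω) E ∂P ≠ ⊤ := by
    refine ne_top_of_le_ne_top (measure_ne_top P F) ?_
    refine (lintegral_mono fun ω => prob_le_one).trans (by simp)
  rw [← ENNReal.toReal_eq_toReal_iff' (measure_ne_top _ _) hlt]
  refine h1.symm.trans ?_
  exact integral_toReal hmeas.aemeasurable (.of_forall fun ω => measure_lt_top _ _)

variable {Ω T S : Type*} {m mΩ : MeasurableSpace Ω}
  [MeasurableSpace T] [mS : MeasurableSpace S] {P : Measure Ω} [IsProbabilityMeasure P]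

/-- Integration of a function of `ω` and `X ω`, which depends on `ω` through the σ-algebra `m`
only, when the conditional law of `X` given `m` is `κ (Z ω)`. -/
theorem lintegral_of_condLaw (hm : m ≤ mΩ)
    {Z : Ω → T} (hZ : Measurable[m] Z) {X : Ω → S} (hX : Measurable X) (κ : Kernel T S)
    [IsMarkovKernel κ]
    (hlaw : ∀ E : Set S, MeasurableSet E →
      P⟦{ω | X ω ∈ E} | m⟧ =ᵐ[P] fun ω => (κ (Z ω)).real E)
    {F : Ω × S → ENNReal} (hF : Measurable[m.prod mS] F) :
    ∫⁻ ω, F (ω, X ω) ∂P = ∫⁻ ω, ∫⁻ x, F (ω, x) ∂κ (Z ω) ∂P :=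
  lintegral_eq_of_rectangles (mΩ' := m) (Y := id) (measurable_id'' hm) hX hZ κ
    (fun _ _ hF hE => measure_inter_eq_setLIntegral hm hZ hX κ hlaw hF hE) hF

theorem integral_of_condLaw (hm : m ≤ mΩ)
    {Z : Ω → T} (hZ : Measurable[m] Z) {X : Ω → S} (hX : Measurable X) (κ : Kernel T S)
    [IsMarkovKernel κ]
    (hlaw : ∀ E : Set S, MeasurableSet E →
      P⟦{ω | X ω ∈ E} | m⟧ =ᵐ[P] fun ω => (κ (Z ω)).real E)
    {F : Ω × S → ℝ} (hF : Measurable[m.prod mS] F) {c : ℝ} (hc : ∀ q, |F q| ≤ c) :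
    ∫ ω, F (ω, X ω) ∂P = ∫ ω, ∫ x, F (ω, x) ∂κ (Z ω) ∂P :=
  integral_eq_of_rectangles (mΩ' := m) (Y := id) (measurable_id'' hm) hX hZ κ
    (fun _ _ hF hE => measure_inter_eq_setLIntegral hm hZ hX κ hlaw hF hE) hF hc

/-- Averaging over an event of known conditional probability. -/
theorem integral_mul_indicator_of_condLaw (hm : m ≤ mΩ) {s : Set Ω} (hs : MeasurableSet s)
    {q : Ω → ℝ} (hq : P⟦s | m⟧ =ᵐ[P] q) {f : Ω → ℝ} (hf : Measurable[m] f) {c : ℝ}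
    (hc : ∀ ω, |f ω| ≤ c) :
    ∫ ω, f ω * s.indicator (fun _ => (1 : ℝ)) ω ∂P = ∫ ω, f ω * q ω ∂P := by
  have hind : Integrable (s.indicator fun _ => (1 : ℝ)) P := (integrable_const 1).indicator hs
  have hfi : Integrable (f * s.indicator fun _ => (1 : ℝ)) P :=
    hind.bdd_mul (hf.mono hm le_rfl).aestronglyMeasurable (.of_forall hc)
  have h1 := condExp_mul_of_stronglyMeasurable_left (μ := P) (m := m)
    (hf.stronglyMeasurable) hfi hind
  have h2 := integral_condExp (μ := P) (f := f * s.indicator fun _ => (1 : ℝ)) hm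
  rw [← Pi.mul_def, ← h2]
  refine integral_congr_ae ?_
  filter_upwards [h1, hq] with ω h3 h4
  rw [h3, Pi.mul_apply, h4]

end Disintegration

section Concentration

/-- Hoeffding's lemma for a bounded function, in exponential supermartingale form. -/
theorem lintegral_exp_centered_le_one {S : Type*} [MeasurableSpace S] (μ : Measure S)
    [IsProbabilityMeasure μ] {f : S → ℝ} (hf : Measurable f) {H : ℝ} (hH : 0 ≤ H)
    (hb : ∀ x, |f x| ≤ H) (s : ℝ) :
    ∫⁻ x, ENNReal.ofReal (Real.exp (s * (f x - ∫ y, f y ∂μ) - H ^ 2 / 2 * s ^ 2)) ∂μ ≤ 1 := by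
  have h := hasSubgaussianMGF_of_mem_Icc (μ := μ) (a := -H) (b := H) hf.aemeasurable
    (.of_forall fun x => abs_le.1 (hb x))
  have h1 := h.mgf_le s
  have h2 := h.integrable_exp_mul s
  have hc : (((‖H - -H‖₊ / 2) ^ 2 : NNReal) : ℝ) = H ^ 2 := by
    push_cast
    rw [Real.norm_of_nonneg (by linarith)]
    ring
  rw [hc] at h1
  simp only [Real.exp_sub]
  rw [← ofReal_integral_eq_lintegral_ofReal (h2.div_const _)
    (.of_forall fun x => by positivity), integral_div, ENNReal.ofReal_le_one,
    div_le_one (by positivity)]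
  refine h1.trans_eq ?_
  congr 1
  ring

variable {Ω T S : Type*} [mΩ : MeasurableSpace Ω] [MeasurableSpace T] [mS : MeasurableSpace S]
  {P : Measure Ω} [IsProbabilityMeasure P] {K : ℕ} {m : ℕ → MeasurableSpace Ω} {Z : ℕ → Ω → T}
  {X : ℕ → Ω → S} {κ : Kernel T S} [IsMarkovKernel κ] {ψ : T → ℝ} {f : S → ℝ} {H : ℝ}

/-- The exponential supermartingale of the noise `f (X τ) - E[f (X τ) | m τ]`, with the predictable
weights `ψ (Z τ)` and the compensator given by Hoeffding's lemma. -/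
theorem lintegral_exp_noise_le_one (hm : ∀ τ, 1 ≤ τ → τ ≤ K → m τ ≤ mΩ)
    (hmono : ∀ τ τ', 1 ≤ τ → τ ≤ τ' → τ' ≤ K → m τ ≤ m τ')
    (hZ : ∀ τ, 1 ≤ τ → τ ≤ K → Measurable[m τ] (Z τ))
    (hX : ∀ τ, 1 ≤ τ → τ ≤ K → Measurable (X τ))
    (hX' : ∀ τ τ', 1 ≤ τ → τ < τ' → τ' ≤ K → Measurable[m τ'] (X τ))
    (hlaw : ∀ τ, 1 ≤ τ → τ ≤ K → ∀ E : Set S, MeasurableSet E →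
      P⟦{ω | X τ ω ∈ E} | m τ⟧ =ᵐ[P] fun ω => (κ (Z τ ω)).real E)
    (hψ : Measurable ψ) (hf : Measurable f) (hH : 0 ≤ H) (hb : ∀ x, |f x| ≤ H) {k : ℕ}
    (hk : k ≤ K) :
    ∫⁻ ω, ENNReal.ofReal (Real.exp (∑ τ ∈ Finset.Ico 1 (k + 1),
      (ψ (Z τ ω) * (f (X τ ω) - ∫ y, f y ∂κ (Z τ ω)) - H ^ 2 / 2 * ψ (Z τ ω) ^ 2))) ∂P ≤ 1 := by
  have hg : Measurable fun z => ∫ y, f y ∂κ z :=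
    (hf.stronglyMeasurable.integral_kernel (κ := κ)).measurable
  have hterm : Measurable fun q : T × S =>
      ψ q.1 * (f q.2 - ∫ y, f y ∂κ q.1) - H ^ 2 / 2 * ψ q.1 ^ 2 :=
    ((hψ.comp measurable_fst).mul ((hf.comp measurable_snd).sub (hg.comp measurable_fst))).sub
      (((hψ.comp measurable_fst).pow_const 2).const_mul _)
  induction k with
  | zero => simp
  | succ k ih =>
    have ih := ih (by omega)
    have h1 : 1 ≤ k + 1 := by omega
    have hpast : Measurable[m (k + 1)] fun ω => ∑ τ ∈ Finset.Ico 1 (k + 1),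
        (ψ (Z τ ω) * (f (X τ ω) - ∫ y, f y ∂κ (Z τ ω)) - H ^ 2 / 2 * ψ (Z τ ω) ^ 2) := by
      refine Finset.measurable_fun_sum _ fun τ hτ => ?_
      obtain ⟨hτ1, hτ2⟩ := Finset.mem_Ico.1 hτ
      exact hterm.comp (((hZ τ hτ1 (by omega)).mono (hmono τ (k + 1) hτ1 hτ2.le hk) le_rfl).prodMk
        (hX' τ (k + 1) hτ1 hτ2 hk))
    set past := fun ω => ∑ τ ∈ Finset.Ico 1 (k + 1),
        (ψ (Z τ ω) * (f (X τ ω) - ∫ y, f y ∂κ (Z τ ω)) - H ^ 2 / 2 * ψ (Z τ ω) ^ 2) with hpast_def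
    let F : Ω × S → ENNReal := fun q => ENNReal.ofReal (Real.exp (past q.1)) *
      ENNReal.ofReal (Real.exp (ψ (Z (k + 1) q.1) * (f q.2 - ∫ y, f y ∂κ (Z (k + 1) q.1))
        - H ^ 2 / 2 * ψ (Z (k + 1) q.1) ^ 2))
    have hF : Measurable[(m (k + 1)).prod mS] F := by
      have hfst : Measurable[(m (k + 1)).prod mS, m (k + 1)] (Prod.fst : Ω × S → Ω) :=
        @measurable_fst Ω S (m (k + 1)) mS
      have hsnd : Measurable[(m (k + 1)).prod mS] (Prod.snd : Ω × S → S) :=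
        @measurable_snd Ω S (m (k + 1)) mS
      have e1 : Measurable[(m (k + 1)).prod mS] fun q : Ω × S =>
          ENNReal.ofReal (Real.exp (past q.1)) :=
        ENNReal.measurable_ofReal.comp (Real.measurable_exp.comp (hpast.comp hfst))
      have e2 : Measurable[(m (k + 1)).prod mS] fun q : Ω × S => (Z (k + 1) q.1, q.2) :=
        ((hZ (k + 1) h1 hk).comp hfst).prodMk hsnd
      exact e1.mul (ENNReal.measurable_ofReal.comp (Real.measurable_exp.comp (hterm.comp e2)))
    calc _ = ∫⁻ ω, F (ω, X (k + 1) ω) ∂P := by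
          refine lintegral_congr fun ω => ?_
          rw [Finset.sum_Ico_succ_top h1, Real.exp_add, ENNReal.ofReal_mul (by positivity)]
      _ = ∫⁻ ω, ∫⁻ x, F (ω, x) ∂κ (Z (k + 1) ω) ∂P :=
          lintegral_of_condLaw (hm _ h1 hk) (hZ _ h1 hk) (hX _ h1 hk) κ (hlaw _ h1 hk) hF
      _ ≤ ∫⁻ ω, ENNReal.ofReal (Real.exp (past ω)) ∂P := by
          refine lintegral_mono fun ω => ?_
          simp only [F]
          rw [lintegral_const_mul' _ _ ENNReal.ofReal_ne_top]
          refine (mul_le_mul_right ?_ _).trans_eq (mul_one _)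
          have h := lintegral_exp_centered_le_one (κ (Z (k + 1) ω)) hf hH hb (ψ (Z (k + 1) ω))
          exact h
      _ ≤ 1 := ih

/-- Chernoff bound from an exponential moment at most `1`. -/
theorem measure_ge_le_exp_neg {Ω : Type*} [MeasurableSpace Ω] {P : Measure Ω} {g : Ω → ℝ}
    (hg : ∫⁻ ω, ENNReal.ofReal (Real.exp (g ω)) ∂P ≤ 1) (hgm : Measurable g) (L : ℝ) :
    P {ω | L ≤ g ω} ≤ ENNReal.ofReal (Real.exp (-L)) := by
  have h := mul_meas_ge_le_lintegral (μ := P) (f := fun ω => ENNReal.ofReal (Real.exp (g ω)))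
    (by fun_prop) (ENNReal.ofReal (Real.exp L))
  have hset : {ω | ENNReal.ofReal (Real.exp L) ≤ ENNReal.ofReal (Real.exp (g ω))}
      = {ω | L ≤ g ω} := by
    ext ω
    rw [Set.mem_ofPred_eq, Set.mem_ofPred_eq, ENNReal.ofReal_le_ofReal_iff (by positivity),
      Real.exp_le_exp]
  rw [hset] at h
  rw [Real.exp_neg, ENNReal.ofReal_inv_of_pos (by positivity), ← one_div,
    ENNReal.le_div_iff_mul_le (.inl (by simp [Real.exp_pos])) (.inl (by simp)), mul_comm]
  exact h.trans hg

end Concentration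

/-! ### Grids and the self-normalized bound -/

section Grid

/-- The integers `-N, …, N`, indices of the points of a one-dimensional grid. -/
abbrev GridIndex (N : ℕ) : Type := Finset.Icc (-(N : ℤ)) N

theorem card_gridIndex (N : ℕ) : Fintype.card (GridIndex N) = 2 * N + 1 := by
  rw [Fintype.card_coe, Int.card_Icc]
  omega

theorem exists_grid_near {η : ℝ} (hη : 0 < η) {N : ℕ} {x : ℝ} (hx : |x| ≤ η * N) :
    ∃ j : GridIndex N, |η * (j : ℤ) - x| ≤ η := by
  have hx' : |x / η| ≤ N := by
    rw [abs_div, abs_of_pos hη, div_le_iff₀ hη]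
    linarith
  refine ⟨⟨⌊x / η⌋, Finset.mem_Icc.2 ⟨?_, ?_⟩⟩, ?_⟩
  · exact Int.le_floor.2 (by push_cast; exact (abs_le.1 hx').1)
  · exact_mod_cast (Int.floor_le _).trans (abs_le.1 hx').2
  · have h1 := Int.floor_le (x / η)
    have h2 := (Int.lt_floor_add_one (x / η)).le
    have h3 : x = η * (x / η) := by field_simp
    calc |η * (⌊x / η⌋ : ℝ) - x| = η * |(⌊x / η⌋ : ℝ) - x / η| := by
          rw [← abs_of_pos hη, ← abs_mul, abs_of_pos hη, mul_sub, ← h3]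
      _ ≤ η * 1 := by
          refine mul_le_mul_of_nonneg_left ?_ hη.le
          rw [abs_le]
          constructor <;> linarith
      _ = η := mul_one η

theorem exists_grid_near_vec {ι : Type*} {η : ℝ} (hη : 0 < η) {N : ℕ} {x : ι → ℝ}
    (hx : ∀ i, |x i| ≤ η * N) : ∃ j : ι → GridIndex N, ∀ i, |η * (j i : ℤ) - x i| ≤ η := by
  choose j hj using fun i => exists_grid_near hη (hx i)
  exact ⟨j, hj⟩

end Grid

section SelfNormalized

variable {d : ℕ}

theorem sqrt_dotProduct_self_eq_norm (x : EuclideanSpace ℝ (Fin d)) :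
    √(x.ofLp ⬝ᵥ x.ofLp) = ‖x‖ := by
  rw [EuclideanSpace.norm_eq]
  simp [dotProduct, sq]

theorem abs_apply_le_sqrt_dotProduct (x : Fin d → ℝ) (i : Fin d) : |x i| ≤ √(x ⬝ᵥ x) := by
  rw [← Real.sqrt_sq_eq_abs]
  refine Real.sqrt_le_sqrt ?_
  rw [sq]
  exact Finset.single_le_sum (f := fun i => x i * x i) (fun i _ => mul_self_nonneg _)
    (Finset.mem_univ i)

theorem abs_apply_le_one {x : Fin d → ℝ} (hx : x ⬝ᵥ x ≤ 1) (i : Fin d) : |x i| ≤ 1 :=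
  (abs_apply_le_sqrt_dotProduct x i).trans (Real.sqrt_le_one.2 hx)

theorem dotProduct_self_le_of_abs_le {x : Fin d → ℝ} {η : ℝ} (hx : ∀ i, |x i| ≤ η) :
    x ⬝ᵥ x ≤ d * η ^ 2 := by
  refine (Finset.sum_le_sum (g := fun _ => η ^ 2) fun i _ => ?_).trans_eq (by simp)
  rw [← sq, ← sq_abs]
  exact pow_le_pow_left₀ (abs_nonneg _) (hx i) 2

theorem abs_dotProduct_le_of_abs_le {x y : Fin d → ℝ} {η : ℝ} (hx : ∀ i, |x i| ≤ η)
    (hy : ∀ i, |y i| ≤ 1) : |x ⬝ᵥ y| ≤ d * η := by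
  refine (Finset.abs_sum_le_sum_abs _ _).trans ?_
  refine (Finset.sum_le_sum (g := fun _ => η) fun i _ => ?_).trans_eq (by simp)
  rw [abs_mul]
  exact (mul_le_mul_of_nonneg_left (hy i) (abs_nonneg _)).trans (by simpa using hx i)

variable {φ : ℕ → Fin d → ℝ}

theorem sqrt_dotProduct_sum_smul_le (hφ : ∀ τ, φ τ ⬝ᵥ φ τ ≤ 1) {ε : ℕ → ℝ} {c : ℝ} {s : Finset ℕ}
    (hε : ∀ τ ∈ s, |ε τ| ≤ c) :
    √((∑ τ ∈ s, ε τ • φ τ) ⬝ᵥ (∑ τ ∈ s, ε τ • φ τ)) ≤ s.card * c := by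
  have h1 : ∀ τ, ‖(WithLp.toLp 2 (φ τ) : EuclideanSpace ℝ (Fin d))‖ ≤ 1 := fun τ => by
    rw [← sqrt_dotProduct_self_eq_norm]
    exact Real.sqrt_le_one.2 (hφ τ)
  have h2 : ∑ τ ∈ s, ε τ • φ τ
      = (∑ τ ∈ s, ε τ • (WithLp.toLp 2 (φ τ) : EuclideanSpace ℝ (Fin d))).ofLp := by
    simp [WithLp.ofLp_sum]
  rw [h2, sqrt_dotProduct_self_eq_norm]
  refine (norm_sum_le _ _).trans ((Finset.sum_le_sum fun τ hτ => ?_).trans_eq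
    (by rw [Finset.sum_const, nsmul_eq_mul]))
  rw [norm_smul, Real.norm_eq_abs]
  have := mul_le_mul (hε τ hτ) (h1 τ) (norm_nonneg _) ((abs_nonneg _).trans (hε τ hτ))
  simpa using this

theorem regGram_mulVec (φ : ℕ → Fin d → ℝ) (k : ℕ) (x : Fin d → ℝ) :
    regGram φ k *ᵥ x = ∑ τ ∈ Finset.Ico 1 k, (φ τ ⬝ᵥ x) • φ τ + x := by
  rw [regGram, Matrix.add_mulVec, Matrix.one_mulVec, Matrix.sum_mulVec]
  simp only [vecMulVec_mulVec_eq]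

theorem sqrt_dotProduct_inv_le (φ : ℕ → Fin d → ℝ) (k : ℕ) (y : Fin d → ℝ) :
    √(y ⬝ᵥ ((regGram φ k)⁻¹ *ᵥ y)) ≤ √(y ⬝ᵥ y) :=
  Real.sqrt_le_sqrt (dotProduct_inv_mulVec_self_le (posDef_regGram φ k)
    (dotProduct_self_le_regGram φ k) y)

theorem sqrt_inv_mulVec_le (φ : ℕ → Fin d → ℝ) (k : ℕ) (y : Fin d → ℝ) :
    √(((regGram φ k)⁻¹ *ᵥ y) ⬝ᵥ ((regGram φ k)⁻¹ *ᵥ y)) ≤ √(y ⬝ᵥ y) :=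
  Real.sqrt_le_sqrt (inv_mulVec_dotProduct_self_le (posDef_regGram φ k)
    (dotProduct_self_le_regGram φ k) y)

/-- Self-normalized bound. If `∑ ε_τ ⟨v, φ_τ⟩ - (s / 2) ∑ ⟨v, φ_τ⟩² ≤ L` for all `v` in a grid
fine enough, then this holds up to a constant at the maximizer `v = s⁻¹ Λ⁻¹ ∑ ε_τ φ_τ`, where the
left-hand side is essentially the squared norm of `∑ ε_τ φ_τ` for `Λ⁻¹`. -/
theorem selfNormalized_le_of_grid (hφ : ∀ τ, φ τ ⬝ᵥ φ τ ≤ 1) {k : ℕ} {ε : ℕ → ℝ} {s η L : ℝ}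
    (hs : 0 < s) (hη : 0 < η) {N : ℕ}
    (hrange : s⁻¹ * √((∑ τ ∈ Finset.Ico 1 k, ε τ • φ τ) ⬝ᵥ (∑ τ ∈ Finset.Ico 1 k, ε τ • φ τ))
      ≤ η * N)
    (hfine : s * ((k - 1 : ℕ) * (d * η) ^ 2 + d * η ^ 2) ≤ 2)
    (hgrid : ∀ j : Fin d → GridIndex N, ∑ τ ∈ Finset.Ico 1 k,
      (((fun i => η * (j i : ℤ)) ⬝ᵥ φ τ) * ε τ - s / 2 * ((fun i => η * (j i : ℤ)) ⬝ᵥ φ τ) ^ 2)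
        ≤ L) :
    (∑ τ ∈ Finset.Ico 1 k, ε τ • φ τ) ⬝ᵥ ((regGram φ k)⁻¹ *ᵥ ∑ τ ∈ Finset.Ico 1 k, ε τ • φ τ)
      ≤ 2 * s * (L + 1) := by
  set y := ∑ τ ∈ Finset.Ico 1 k, ε τ • φ τ with hy
  set M := regGram φ k
  have hr : ∀ i, |(s⁻¹ • (M⁻¹ *ᵥ y)) i| ≤ η * N := fun i => by
    refine le_trans ?_ hrange
    rw [Pi.smul_apply, smul_eq_mul, abs_mul, abs_of_pos (inv_pos.2 hs)]
    exact mul_le_mul_of_nonneg_left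
      ((abs_apply_le_sqrt_dotProduct _ i).trans (sqrt_inv_mulVec_le φ k y)) (inv_pos.2 hs).le
  obtain ⟨j, hj⟩ := exists_grid_near_vec hη hr
  set v : Fin d → ℝ := fun i => η * (j i : ℤ) with hv
  set u : Fin d → ℝ := v - s⁻¹ • (M⁻¹ *ᵥ y) with hu
  have hvu : s⁻¹ • (M⁻¹ *ᵥ y) + u = v := by rw [hu]; abel
  have hsq := dotProduct_sub_eq_of_posDef (posDef_regGram φ k) hs.ne' y u
  rw [hvu, dotProduct_regGram_mulVec, dotProduct_regGram_mulVec] at hsq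
  have hsum := hgrid j
  rw [Finset.sum_sub_distrib, ← Finset.mul_sum] at hsum
  have h1 : ∑ τ ∈ Finset.Ico 1 k, (v ⬝ᵥ φ τ) * ε τ = v ⬝ᵥ y := by
    rw [hy, dotProduct_sum]
    exact Finset.sum_congr rfl fun τ _ => by rw [dotProduct_smul, smul_eq_mul, mul_comm]
  have h2 : ∑ τ ∈ Finset.Ico 1 k, (φ τ ⬝ᵥ v) ^ 2 = ∑ τ ∈ Finset.Ico 1 k, (v ⬝ᵥ φ τ) ^ 2 :=
    Finset.sum_congr rfl fun τ _ => by rw [dotProduct_comm]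
  have h3 : ∑ τ ∈ Finset.Ico 1 k, (φ τ ⬝ᵥ u) ^ 2 ≤ (k - 1 : ℕ) * (d * η) ^ 2 := by
    refine (Finset.sum_le_sum (g := fun _ => (d * η) ^ 2) fun τ _ => ?_).trans_eq (by simp)
    rw [dotProduct_comm, ← sq_abs]
    exact pow_le_pow_left₀ (abs_nonneg _)
      (abs_dotProduct_le_of_abs_le hj (abs_apply_le_one (hφ τ))) 2
  have h4 : u ⬝ᵥ u ≤ d * η ^ 2 := dotProduct_self_le_of_abs_le hj
  have h5 := dotProduct_self_nonneg v
  rw [h2] at hsq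
  rw [h1] at hsum
  have h6 : (2 * s)⁻¹ * (y ⬝ᵥ (M⁻¹ *ᵥ y)) ≤ L + 1 := by
    have e1 : s / 2 * (∑ τ ∈ Finset.Ico 1 k, (φ τ ⬝ᵥ u) ^ 2 + u ⬝ᵥ u) ≤ 1 := by
      have : s * (∑ τ ∈ Finset.Ico 1 k, (φ τ ⬝ᵥ u) ^ 2 + u ⬝ᵥ u) ≤ 2 :=
        (mul_le_mul_of_nonneg_left (add_le_add h3 h4) hs.le).trans hfine
      linarith
    have e2 : 0 ≤ s / 2 * (v ⬝ᵥ v) := by positivity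
    rw [mul_add] at hsq
    linarith
  rwa [inv_mul_le_iff₀ (by positivity)] at h6

end SelfNormalized

/-! ### The class of value functions and the accuracy of least squares -/

section ValueClass

theorem abs_sqrt_sub_sqrt_le (x y : ℝ) : |√x - √y| ≤ √|x - y| := by
  have key : ∀ x y : ℝ, √x - √y ≤ √|x - y| := fun x y => by
    have h : √x ≤ √y + √|x - y| := by
      rcases le_total 0 y with hy | hy
      · refine Real.sqrt_le_iff.2 ⟨by positivity, ?_⟩
        have := Real.sq_sqrt hy
        have := Real.sq_sqrt (abs_nonneg (x - y))
        nlinarith [le_abs_self (x - y), mul_nonneg (Real.sqrt_nonneg y) (Real.sqrt_nonneg |x - y|)]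
      · rw [Real.sqrt_eq_zero_of_nonpos hy, zero_add]
        exact Real.sqrt_le_sqrt ((by linarith : x ≤ x - y).trans (le_abs_self _))
    linarith
  rw [abs_le]
  constructor
  · have := key y x
    rw [abs_sub_comm] at this
    linarith
  · exact key x y

variable {S A : Type*} {d : ℕ}

theorem dotProduct_ofLp_self_le_one {φ : S × A × A → EuclideanSpace ℝ (Fin d)}
    (hφ : ∀ z, ‖φ z‖ ≤ 1) (z : S × A × A) :
    (φ z).ofLp ⬝ᵥ (φ z).ofLp ≤ 1 := by
  rw [← Real.sqrt_le_one, sqrt_dotProduct_self_eq_norm]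
  exact hφ z

theorem abs_gram_inv_le {φ : S × A × A → EuclideanSpace ℝ (Fin d)} (D : Record S A)
    (k h : ℕ) (i j : Fin d) : |(gram φ D k h)⁻¹ i j| ≤ 1 := by
  have h1 : (gram φ D k h)⁻¹ i j = ((gram φ D k h)⁻¹ *ᵥ Pi.single j 1) i := by simp
  rw [h1, gram_eq_regGram]
  refine (abs_apply_le_sqrt_dotProduct _ i).trans ((sqrt_inv_mulVec_le _ k _).trans ?_)
  simp

variable [MeasurableSpace A] [Fintype A]

/-- The value functions that the algorithm can produce: the lower value of the matrix game with
payoffs `clip (wᵀφ + β √(φᵀ M φ))`. The estimate `V_h^k` has this form, with a random weight `w`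
and a random matrix `M`. -/
noncomputable def classValue (φ : S × A × A → EuclideanSpace ℝ (Fin d)) (H β : ℝ) (w : Fin d → ℝ)
    (M : Matrix (Fin d) (Fin d) ℝ) (x : S) : ℝ :=
  lowerValue fun a b => clip H (w ⬝ᵥ (φ (x, a, b)).ofLp +
    β * √((φ (x, a, b)).ofLp ⬝ᵥ (M *ᵥ (φ (x, a, b)).ofLp)))

variable [MeasurableSingletonClass A] {φ : S × A × A → EuclideanSpace ℝ (Fin d)} {H β : ℝ}

theorem abs_classValue_le (hH : 0 ≤ H) (w : Fin d → ℝ) (M : Matrix (Fin d) (Fin d) ℝ) (x : S) :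
    |classValue φ H β w M x| ≤ H :=
  abs_lowerValue_le hH fun _ _ => abs_clip_le hH _

/-- The class of value functions is Hölder continuous in its finitely many parameters. -/
theorem abs_classValue_sub_le (hφ : ∀ z, ‖φ z‖ ≤ 1) (hβ : 0 ≤ β) {w w' : Fin d → ℝ}
    {M M' : Matrix (Fin d) (Fin d) ℝ} {η : ℝ} (hη : 0 ≤ η) (hw : ∀ i, |w i - w' i| ≤ η)
    (hM : ∀ i j, |M i j - M' i j| ≤ η) (x : S) :
    |classValue φ H β w M x - classValue φ H β w' M' x| ≤ d * η + β * √(d * (d * η)) := by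
  refine abs_lowerValue_sub_le (by positivity) fun a b => (abs_clip_sub_clip_le _ _ _).trans ?_
  set u := (φ (x, a, b)).ofLp with hu
  have hu1 : ∀ i, |u i| ≤ 1 := by
    refine abs_apply_le_one ?_
    rw [← Real.sqrt_le_one, sqrt_dotProduct_self_eq_norm]
    exact hφ _
  have h1 : |w ⬝ᵥ u - w' ⬝ᵥ u| ≤ d * η := by
    rw [← sub_dotProduct]
    exact abs_dotProduct_le_of_abs_le hw hu1
  have h2 : |u ⬝ᵥ (M *ᵥ u) - u ⬝ᵥ (M' *ᵥ u)| ≤ d * (d * η) := by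
    rw [← dotProduct_sub, ← Matrix.sub_mulVec, dotProduct_comm]
    exact abs_dotProduct_le_of_abs_le (fun i => abs_dotProduct_le_of_abs_le (hM i) hu1) hu1
  have h3 : |β * √(u ⬝ᵥ (M *ᵥ u)) - β * √(u ⬝ᵥ (M' *ᵥ u))| ≤ β * √(d * (d * η)) := by
    rw [← mul_sub, abs_mul, abs_of_nonneg hβ]
    exact mul_le_mul_of_nonneg_left
      ((abs_sqrt_sub_sqrt_le _ _).trans (Real.sqrt_le_sqrt h2)) hβ
  rw [add_sub_add_comm]
  exact (abs_add_le _ _).trans (add_le_add h1 h3)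

theorem classValue_zero (hH : 0 ≤ H) (x : S) : classValue φ H β 0 0 x = 0 := by
  have h : |classValue φ H β 0 0 x| ≤ 0 :=
    abs_lowerValue_le le_rfl fun a b => by simp [clip, hH]
  simpa using h

variable [MeasurableSpace S]

theorem measurable_classValue (hφ : Measurable φ) (w : Fin d → ℝ) (M : Matrix (Fin d) (Fin d) ℝ) :
    Measurable (classValue φ H β w M) := by
  refine measurable_lowerValue.comp (measurable_pi_lambda _ fun a => measurable_pi_lambda _ fun b =>
    (measurable_clip H).comp ?_)
  have h1 : Measurable fun x : S => φ (x, a, b) := hφ.comp (by fun_prop)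
  have h2 : Measurable fun x : S => w ⬝ᵥ (φ (x, a, b)).ofLp :=
    measurable_dotProduct (fun _ => measurable_const) (measurable_coord h1)
  exact h2.add ((measurable_quadratic h1 M).sqrt.const_mul β)

variable (G : MarkovGame S A) (D : Record S A) (k : ℕ) {π B : Policy S A}

theorem optV_eq_classValue (homni : IsOmniPolicy G φ β D k π B) {h : ℕ} (h1 : 1 ≤ h)
    (hH : h ≤ G.horizon) (x : S) :
    optV G φ β D k π B h x = classValue φ G.horizon β
      (weight G φ D k h (optV G φ β D k π B (h + 1))) (gram φ D k h)⁻¹ x := by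
  rw [optV_eq_payoff G D k π B hH, (homni h h1 hH x).payoff_eq_lowerValue]
  rfl

omit [Fintype A] [MeasurableSingletonClass A] in
theorem abs_weight_le (hφ : ∀ z, ‖φ z‖ ≤ 1) (h : ℕ) {V : S → ℝ} {c : ℝ} (hV : ∀ x, |V x| ≤ c)
    (i : Fin d) : |weight G φ D k h V i| ≤ (k - 1 : ℕ) * (1 + c) := by
  refine (abs_apply_le_sqrt_dotProduct _ i).trans ?_
  rw [weight, gram_eq_regGram]
  refine (sqrt_inv_mulVec_le _ k _).trans ?_
  refine (sqrt_dotProduct_sum_smul_le (φ := fun τ => (φ (D.triple τ h)).ofLp)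
    (fun τ => dotProduct_ofLp_self_le_one hφ _) (c := 1 + c) fun τ _ => ?_).trans_eq (by simp)
  exact (abs_add_le _ _).trans (add_le_add (G.abs_reward_le _ _) (hV _))

/-- A point of the grid of parameters: a weight vector, a matrix, and a direction in which the
noise is tested. -/
abbrev NetIndex (d N : ℕ) : Type :=
  (Fin d → GridIndex N) × (Fin d → Fin d → GridIndex N) × (Fin d → GridIndex N)

/-- The point `η j` of the grid. -/
def gridVec {ι : Type*} (η : ℝ) {N : ℕ} (j : ι → GridIndex N) : ι → ℝ := fun i => η * (j i : ℤ)

/-- The element of the class of value functions with the given grid parameters. -/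
noncomputable def netValue (φ : S × A × A → EuclideanSpace ℝ (Fin d)) (H β η : ℝ) {N : ℕ}
    (j : NetIndex d N) : S → ℝ :=
  classValue φ H β (gridVec η j.1) (Matrix.of fun i => gridVec η (j.2.1 i))

theorem exists_netValue_near (hφ : ∀ z, ‖φ z‖ ≤ 1) (hβ : 0 ≤ β)
    (homni : IsOmniPolicy G φ β D k π B) {η : ℝ} (hη : 0 < η) {N : ℕ}
    (hw : (k - 1 : ℕ) * (1 + (G.horizon : ℝ)) ≤ η * N) (h1 : 1 ≤ η * N) {h : ℕ} (hh : 1 ≤ h) :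
    ∃ (j₁ : Fin d → GridIndex N) (j₂ : Fin d → Fin d → GridIndex N), ∀ j₃ x,
      |netValue φ G.horizon β η (j₁, j₂, j₃) x - optV G φ β D k π B h x|
        ≤ d * η + β * √(d * (d * η)) := by
  rcases le_or_gt h G.horizon with hH | hH
  · obtain ⟨j₁, hj₁⟩ := exists_grid_near_vec hη fun i =>
      (abs_weight_le G D k hφ h (abs_optV_le G D k π B (φ := φ) (β := β) (h + 1)) i).trans hw
    choose j₂ hj₂ using fun i => exists_grid_near_vec hη fun i' =>
      (abs_gram_inv_le D k (φ := φ) h i i').trans h1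
    refine ⟨j₁, j₂, fun _ x => ?_⟩
    rw [optV_eq_classValue G D k homni hh hH]
    exact abs_classValue_sub_le hφ hβ hη.le hj₁ hj₂ x
  -- past the last step the estimate is `0`, the element of the class with zero parameters
  · have h0 : |(0 : ℝ)| ≤ η * N := by simpa using zero_le_one.trans h1
    obtain ⟨j₁, hj₁⟩ := exists_grid_near_vec (ι := Fin d) (x := 0) hη fun _ => h0
    choose j₂ hj₂ using fun _ : Fin d => exists_grid_near_vec (ι := Fin d) (x := 0) hη fun _ => h0
    refine ⟨j₁, j₂, fun _ x => ?_⟩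
    rw [optV_of_horizon_lt G D k π B hH, ← classValue_zero (φ := φ) (β := β)
      (by positivity : (0 : ℝ) ≤ G.horizon) x]
    exact abs_classValue_sub_le hφ hβ hη.le hj₁ hj₂ x

end ValueClass

section Accuracy

variable {S A : Type*} [MeasurableSpace S] [MeasurableSpace A] {d : ℕ}

/-- The noise term of episode `τ` at step `h`, for the value function `f` and the test direction
`v`, minus its compensator. -/
noncomputable def compensatedNoise (G : MarkovGame S A) (φ : S × A × A → EuclideanSpace ℝ (Fin d))
    (h : ℕ) (v : Fin d → ℝ) (f : S → ℝ) (D : Record S A) (τ : ℕ) : ℝ :=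
  (v ⬝ᵥ (φ (D.triple τ h)).ofLp)
      * (f (D.state τ (h + 1)) - ∫ y, f y ∂G.trans h (D.triple τ h))
    - (G.horizon : ℝ) ^ 2 / 2 * (v ⬝ᵥ (φ (D.triple τ h)).ofLp) ^ 2

variable [Fintype A] [MeasurableSingletonClass A]
  {φ : S × A × A → EuclideanSpace ℝ (Fin d)} {β : ℝ}
  {G : MarkovGame S A} {D : Record S A} {k : ℕ} {π B : Policy S A}

/-- If the compensated noise is small for all parameters in the grid, then the least-squares
predictions are accurate. The prediction error is `⟨φ, Λ⁻¹ (noise - w⋆)⟩`, where `w⋆` is the weight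
of the true Bellman backup; the noise is split into that of the nearest grid function and a
remainder. -/
theorem isAccurate_of_grid (hlin : G.IsLinear φ) (hβ : 0 ≤ β)
    (homni : IsOmniPolicy G φ β D k π B) {η L : ℝ} (hη : 0 < η) {N : ℕ}
    (hrange : 2 * k * (G.horizon : ℝ) ≤ η * N) (hk : 1 ≤ k)
    (hfine : (G.horizon : ℝ) ^ 2 * ((k - 1 : ℕ) * (d * η) ^ 2 + d * η ^ 2) ≤ 2)
    (hnet : 2 * k * (d * η + β * √(d * (d * η))) ≤ 1)
    (hbeta : √(2 * (G.horizon : ℝ) ^ 2 * (L + 1)) + 1 + 2 * G.horizon * √d ≤ β)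
    (hgrid : ∀ h, 1 ≤ h → h ≤ G.horizon → ∀ j : NetIndex d N, ∑ τ ∈ Finset.Ico 1 k,
      compensatedNoise G φ h (gridVec η j.2.2) (netValue φ G.horizon β η j) D τ ≤ L) :
    IsAccurate G D k π B φ β := by
  intro h h1 hH z
  have hφm := hlin.1
  have hφ1 := hlin.2.1
  have hHpos : (1 : ℝ) ≤ G.horizon := by exact_mod_cast h1.trans hH
  have hkpos : (1 : ℝ) ≤ k := by exact_mod_cast hk
  have hk' : ((k - 1 : ℕ) : ℝ) ≤ k := by exact_mod_cast Nat.sub_le k 1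
  set H : ℝ := (G.horizon : ℝ) with hHdef
  set V := optV G φ β D k π B (h + 1) with hV
  have hVm : Measurable V := measurable_optV G D k π B hφm (h + 1)
  have hVb : ∀ x, |V x| ≤ H := abs_optV_le G D k π B (h + 1)
  obtain ⟨ws, hws, hbell⟩ := exists_weight_of_isLinear hlin h1 hH hVm hVb
  set u : ℕ → Fin d → ℝ := fun τ => (φ (D.triple τ h)).ofLp with hu
  have hu1 : ∀ τ, u τ ⬝ᵥ u τ ≤ 1 := fun τ => dotProduct_ofLp_self_le_one hφ1 _
  set M := regGram u k with hM
  have hMpos : M.PosDef := posDef_regGram u k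
  -- the approximating element of the net
  have hHk : H ≤ k * H := le_mul_of_one_le_left (by linarith) hkpos
  have hw : ((k - 1 : ℕ) : ℝ) * (1 + H) ≤ η * N := by
    refine le_trans ?_ hrange
    have : ((k - 1 : ℕ) : ℝ) * (1 + H) ≤ k * (1 + H) := by gcongr
    nlinarith
  obtain ⟨j₁, j₂, hnear⟩ := exists_netValue_near G D k hφ1 hβ homni hη hw
    (by nlinarith) (by omega : 1 ≤ h + 1)
  set δ := d * η + β * √(d * (d * η)) with hδ
  let f : S → ℝ := netValue φ H β η (j₁, j₂, j₁)
  have hfm : Measurable f := measurable_classValue hφm _ _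
  have hfb : ∀ x, |f x| ≤ H := abs_classValue_le (by linarith) _ _
  let ε : ℕ → ℝ := fun τ => f (D.state τ (h + 1)) - ∫ y, f y ∂G.trans h (D.triple τ h)
  let ε' : ℕ → ℝ := fun τ => V (D.state τ (h + 1)) - ∫ y, V y ∂G.trans h (D.triple τ h) - ε τ
  have hε : ∀ τ, |ε τ| ≤ 2 * H := fun τ => by
    have e1 := hfb (D.state τ (h + 1))
    have e2 := abs_integral_le (G.trans h (D.triple τ h)) hfb
    exact (abs_sub _ _).trans (by linarith)
  have hε' : ∀ τ, |ε' τ| ≤ 2 * δ := fun τ => by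
    have e1 := hnear j₁ (D.state τ (h + 1))
    have e2 : |∫ y, f y - V y ∂G.trans h (D.triple τ h)| ≤ δ := abs_integral_le _ (hnear j₁)
    rw [integral_sub (integrable_of_abs_le _ hfm hfb) (integrable_of_abs_le _ hVm hVb)] at e2
    have e3 : ε' τ = (∫ y, f y ∂G.trans h (D.triple τ h) - ∫ y, V y ∂G.trans h (D.triple τ h))
        - (f (D.state τ (h + 1)) - V (D.state τ (h + 1))) := by
      simp only [ε', ε]; ring
    rw [e3]
    exact (abs_sub _ _).trans (by linarith)
  set y := ∑ τ ∈ Finset.Ico 1 k, ε τ • u τ with hy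
  set y' := ∑ τ ∈ Finset.Ico 1 k, ε' τ • u τ with hy'
  have hcard : ((Finset.Ico 1 k).card : ℝ) ≤ k := by simp
  have hynorm : √(y ⬝ᵥ y) ≤ k * (2 * H) :=
    (sqrt_dotProduct_sum_smul_le hu1 fun τ _ => hε τ).trans (by gcongr)
  have hδ0 : 0 ≤ δ := by positivity
  have hy'norm : √(y' ⬝ᵥ y') ≤ 1 := by
    refine (sqrt_dotProduct_sum_smul_le hu1 fun τ _ => hε' τ).trans (le_trans ?_ hnet)
    calc ((Finset.Ico 1 k).card : ℝ) * (2 * δ) ≤ k * (2 * δ) := by gcongr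
      _ = 2 * k * δ := by ring
  have hself : y ⬝ᵥ (M⁻¹ *ᵥ y) ≤ 2 * H ^ 2 * (L + 1) := by
    refine selfNormalized_le_of_grid hu1 (by positivity) hη ?_ hfine fun j₃ =>
      hgrid h h1 hH (j₁, j₂, j₃)
    refine le_trans ?_ hrange
    calc (H ^ 2)⁻¹ * √(y ⬝ᵥ y) ≤ 1 * (k * (2 * H)) := by
          gcongr
          exact inv_le_one_of_one_le₀ (one_le_pow₀ hHpos)
      _ = 2 * k * H := by ring
  -- the prediction error
  have hweight : weight G φ D k h V = M⁻¹ *ᵥ (y + y') + ws - M⁻¹ *ᵥ ws := by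
    have e1 : ∑ τ ∈ Finset.Ico 1 k, (G.reward h (D.triple τ h) + V (D.state τ (h + 1))) • u τ
        = y + y' + (M *ᵥ ws - ws) := by
      rw [hM, regGram_mulVec, add_sub_cancel_right, hy, hy', ← Finset.sum_add_distrib,
        ← Finset.sum_add_distrib]
      refine Finset.sum_congr rfl fun τ _ => ?_
      rw [← add_smul, ← add_smul]
      congr 1
      have e2 := hbell (D.triple τ h)
      rw [dotProduct_comm] at e2
      simp only [ε', u]
      linarith
    have e3 : M⁻¹ *ᵥ (M *ᵥ ws) = ws := by
      rw [Matrix.mulVec_mulVec, Matrix.nonsing_inv_mul _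
        ((Matrix.isUnit_iff_isUnit_det _).1 hMpos.isUnit), Matrix.one_mulVec]
    have e4 : weight G φ D k h V = M⁻¹ *ᵥ (y + y' + (M *ᵥ ws - ws)) := by
      rw [← e1]; rfl
    rw [e4, Matrix.mulVec_add, Matrix.mulVec_sub, e3]
    abel
  set v := (φ z).ofLp with hv
  have hb : bonus φ D k h z = √(v ⬝ᵥ (M⁻¹ *ᵥ v)) := rfl
  have hCS := fun x => abs_dotProduct_mulVec_le hMpos.inv.posSemidef v x
  have herr : weight G φ D k h V ⬝ᵥ v - (G.reward h z + ∫ y, V y ∂G.trans h z)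
      = v ⬝ᵥ (M⁻¹ *ᵥ y) + v ⬝ᵥ (M⁻¹ *ᵥ y') - v ⬝ᵥ (M⁻¹ *ᵥ ws) := by
    rw [hbell z, hweight, dotProduct_comm, dotProduct_sub, dotProduct_add, Matrix.mulVec_add,
      dotProduct_add, dotProduct_comm ws]
    ring
  rw [herr, hb]
  set b := √(v ⬝ᵥ (M⁻¹ *ᵥ v))
  have hb0 : 0 ≤ b := Real.sqrt_nonneg _
  have t1 : |v ⬝ᵥ (M⁻¹ *ᵥ y)| ≤ b * √(2 * H ^ 2 * (L + 1)) :=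
    (hCS y).trans (mul_le_mul_of_nonneg_left (Real.sqrt_le_sqrt hself) hb0)
  have t2 : |v ⬝ᵥ (M⁻¹ *ᵥ y')| ≤ b * 1 :=
    (hCS y').trans (mul_le_mul_of_nonneg_left ((sqrt_dotProduct_inv_le u k y').trans hy'norm) hb0)
  have t3 : |v ⬝ᵥ (M⁻¹ *ᵥ ws)| ≤ b * (2 * H * √d) :=
    (hCS ws).trans (mul_le_mul_of_nonneg_left ((sqrt_dotProduct_inv_le u k ws).trans hws) hb0)
  calc |v ⬝ᵥ (M⁻¹ *ᵥ y) + v ⬝ᵥ (M⁻¹ *ᵥ y') - v ⬝ᵥ (M⁻¹ *ᵥ ws)|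
      ≤ |v ⬝ᵥ (M⁻¹ *ᵥ y)| + |v ⬝ᵥ (M⁻¹ *ᵥ y')| + |v ⬝ᵥ (M⁻¹ *ᵥ ws)| :=
        (abs_sub _ _).trans (add_le_add_left (abs_add_le _ _) _)
    _ ≤ b * (√(2 * H ^ 2 * (L + 1)) + 1 + 2 * H * √d) := by linarith
    _ ≤ b * β := by gcongr
    _ = β * b := mul_comm _ _

end Accuracy

/-! ### The noise of a run -/

section Run

variable {Ω S A : Type*} [mΩ : MeasurableSpace Ω] [mS : MeasurableSpace S] [Fintype A]
  [MeasurableSpace A] {P : Measure Ω} {G : MarkovGame S A} {d : ℕ}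
  {φ : S × A × A → EuclideanSpace ℝ (Fin d)} {β : ℝ} {K : ℕ} {D : Ω → Record S A}
  {π B ν : ℕ → Ω → Policy S A} {info infoAct : ℕ → ℕ → MeasurableSpace Ω}

namespace OnlineRun

theorem info_mono (R : OnlineRun P G φ β K D π B ν info infoAct) {k h h' : ℕ} (hk : 1 ≤ k)
    (hK : k ≤ K) (h1 : 1 ≤ h) (hh : h ≤ h') (hH : h' ≤ G.horizon + 1) :
    info k h ≤ info k h' := by
  induction h', hh using Nat.le_induction with
  | base => exact le_rfl
  | succ n hn ih =>
    exact (ih (by omega)).trans ((R.info_le_infoAct k n hk hK (by omega) (by omega)).trans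
      (R.infoAct_le_info k n hk hK (by omega) (by omega)))

theorem info_one_mono (R : OnlineRun P G φ β K D π B ν info infoAct) {k k' : ℕ} (hk : 1 ≤ k)
    (hkk : k ≤ k') (hK : k' ≤ K) : info k 1 ≤ info k' 1 := by
  induction k', hkk using Nat.le_induction with
  | base => exact le_rfl
  | succ n hn ih =>
    exact (ih (by omega)).trans ((R.info_mono (by omega) (by omega) le_rfl (by omega) le_rfl).trans
      (R.info_le_next n (by omega) (by omega)))

/-- The information of an earlier episode is available at the start of a later one. -/
theorem info_le_info_one (R : OnlineRun P G φ β K D π B ν info infoAct) {k k' h : ℕ} (hk : 1 ≤ k)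
    (hkk : k < k') (hK : k' ≤ K) (h1 : 1 ≤ h) (hH : h ≤ G.horizon + 1) :
    info k h ≤ info k' 1 :=
  (R.info_mono hk (by omega) h1 hH le_rfl).trans ((R.info_le_next k hk (by omega)).trans
    (R.info_one_mono (by omega) hkk hK))

theorem infoAct_le (R : OnlineRun P G φ β K D π B ν info infoAct) {k h : ℕ} (hk : 1 ≤ k)
    (hK : k ≤ K) (h1 : 1 ≤ h) (hH : h ≤ G.horizon) : infoAct k h ≤ mΩ :=
  (R.infoAct_le_info k h hk hK h1 hH).trans (R.info_le k (h + 1) hk hK (by omega) (by omega))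

theorem measurable_triple (R : OnlineRun P G φ β K D π B ν info infoAct) {k h : ℕ} (hk : 1 ≤ k)
    (hK : k ≤ K) (h1 : 1 ≤ h) (hH : h ≤ G.horizon) :
    Measurable[infoAct k h] fun ω => (D ω).triple k h :=
  ((R.measurable_state k h hk hK h1 (by omega)).mono (R.info_le_infoAct k h hk hK h1 hH)
    le_rfl).prodMk ((R.measurable_act1 k h hk hK h1 hH).prodMk (R.measurable_act2 k h hk hK h1 hH))

/-- Past triples are known at the start of an episode. -/
theorem measurable_triple_past (R : OnlineRun P G φ β K D π B ν info infoAct) {τ k h : ℕ}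
    (hτ : 1 ≤ τ) (hk : τ < k) (hK : k ≤ K) (h1 : 1 ≤ h) (hH : h ≤ G.horizon) :
    Measurable[info k 1] fun ω => (D ω).triple τ h :=
  (R.measurable_triple hτ (by omega) h1 hH).mono
    ((R.infoAct_le_info τ h hτ (by omega) h1 hH).trans
      (R.info_le_info_one hτ hk hK (by omega) (by omega))) le_rfl

variable [IsProbabilityMeasure P]

theorem measure_compensatedNoise_ge_le (R : OnlineRun P G φ β K D π B ν info infoAct)
    (hφ : Measurable φ) {k h : ℕ} (hk : 1 ≤ k) (hK : k ≤ K) (h1 : 1 ≤ h) (hH : h ≤ G.horizon)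
    (v : Fin d → ℝ) {f : S → ℝ} (hf : Measurable f) (hb : ∀ x, |f x| ≤ G.horizon) (L : ℝ) :
    P {ω | L ≤ ∑ τ ∈ Finset.Ico 1 k, compensatedNoise G φ h v f (D ω) τ}
      ≤ ENNReal.ofReal (Real.exp (-L)) := by
  obtain ⟨k, rfl⟩ : ∃ k', k = k' + 1 := ⟨k - 1, by omega⟩
  have hψ : Measurable fun z => v ⬝ᵥ (φ z).ofLp :=
    measurable_dotProduct (fun _ => measurable_const) (measurable_coord hφ)
  have hstate : ∀ τ, 1 ≤ τ → τ ≤ K → Measurable fun ω => (D ω).state τ (h + 1) := fun τ hτ hτK =>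
    (R.measurable_state τ (h + 1) hτ hτK (by omega) (by omega)).mono
      (R.info_le τ (h + 1) hτ hτK (by omega) (by omega)) le_rfl
  refine measure_ge_le_exp_neg ?_ ?_ L
  · refine lintegral_exp_noise_le_one (K := K) (m := fun τ => infoAct τ h)
      (Z := fun τ ω => (D ω).triple τ h) (X := fun τ ω => (D ω).state τ (h + 1))
      (κ := G.trans h) (ψ := fun z => v ⬝ᵥ (φ z).ofLp) (f := f) (H := G.horizon)
      (fun τ hτ hτK => R.infoAct_le hτ hτK h1 hH) ?_
      (fun τ hτ hτK => R.measurable_triple hτ hτK h1 hH) hstate ?_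
      (fun τ hτ hτK => R.law_state τ h hτ hτK h1 hH) hψ hf (by positivity) hb (by omega)
    · intro τ τ' hτ hττ' hτK
      rcases hττ'.eq_or_lt with rfl | hlt
      · exact le_rfl
      · exact (R.infoAct_le_info τ h hτ (by omega) h1 hH).trans
          ((R.info_le_info_one hτ hlt hτK (by omega) (by omega)).trans
          ((R.info_mono (by omega) hτK le_rfl h1 (by omega)).trans
          (R.info_le_infoAct τ' h (by omega) hτK h1 hH)))
    · intro τ τ' hτ hlt hτK
      exact (R.measurable_state τ (h + 1) hτ (by omega) (by omega) (by omega)).mono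
        ((R.info_le_info_one hτ hlt hτK (by omega) (by omega)).trans
          ((R.info_mono (by omega) hτK le_rfl h1 (by omega)).trans
          (R.info_le_infoAct τ' h (by omega) hτK h1 hH))) le_rfl
  · refine Finset.measurable_fun_sum _ fun τ hτ => ?_
    obtain ⟨hτ1, hτ2⟩ := Finset.mem_Ico.1 hτ
    have hz : Measurable fun ω => (D ω).triple τ h :=
      (R.measurable_triple hτ1 (by omega) h1 hH).mono (R.infoAct_le hτ1 (by omega) h1 hH) le_rfl
    exact ((hψ.comp hz).mul ((hf.comp (hstate τ hτ1 (by omega))).sub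
      ((measurable_integral_trans G h hf).comp hz))).sub
      (((hψ.comp hz).pow_const 2).const_mul _)

/-- Union bound over episodes, steps and the grid of parameters. -/
theorem measure_exists_noise_gt_le [MeasurableSingletonClass A]
    (R : OnlineRun P G φ β K D π B ν info infoAct)
    (hφ : Measurable φ) (η L : ℝ) (N : ℕ) :
    P {ω | ¬ ∀ k, 1 ≤ k → k ≤ K → ∀ h, 1 ≤ h → h ≤ G.horizon → ∀ j : NetIndex d N,
      ∑ τ ∈ Finset.Ico 1 k, compensatedNoise G φ h (gridVec η j.2.2)
        (netValue φ G.horizon β η j) (D ω) τ ≤ L}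
      ≤ ENNReal.ofReal (K * G.horizon * (2 * N + 1) ^ (d + d * d + d) * Real.exp (-L)) := by
  have hsub : {ω | ¬ ∀ k, 1 ≤ k → k ≤ K → ∀ h, 1 ≤ h → h ≤ G.horizon → ∀ j : NetIndex d N,
      ∑ τ ∈ Finset.Ico 1 k, compensatedNoise G φ h (gridVec η j.2.2)
        (netValue φ G.horizon β η j) (D ω) τ ≤ L}
      ⊆ ⋃ q ∈ Finset.Icc 1 K ×ˢ Finset.Icc 1 G.horizon ×ˢ (Finset.univ : Finset (NetIndex d N)),
        {ω | L ≤ ∑ τ ∈ Finset.Ico 1 q.1, compensatedNoise G φ q.2.1 (gridVec η q.2.2.2.2)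
          (netValue φ G.horizon β η q.2.2) (D ω) τ} := by
    intro ω hω
    simp only [Set.mem_ofPred_eq, not_forall, not_le] at hω
    obtain ⟨k, hk, hK, h, h1, hH, j, hj⟩ := hω
    refine Set.mem_biUnion (x := (k, h, j)) ?_ hj.le
    simp [hk, hK, h1, hH]
  refine (measure_mono hsub).trans ((measure_biUnion_finset_le _ _).trans ?_)
  refine (Finset.sum_le_sum (g := fun _ => ENNReal.ofReal (Real.exp (-L))) fun q hq => ?_).trans ?_
  · simp only [Finset.mem_product, Finset.mem_Icc] at hq
    exact R.measure_compensatedNoise_ge_le hφ hq.1.1 hq.1.2 hq.2.1.1 hq.2.1.2 _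
      (measurable_classValue hφ _ _) (abs_classValue_le (by positivity) _ _) L
  · rw [Finset.sum_const, nsmul_eq_mul, ENNReal.ofReal_mul (by positivity),
      ← ENNReal.ofReal_natCast]
    refine le_of_eq ?_
    congr 2
    simp only [Finset.card_product, Nat.card_Icc, Finset.card_univ, Fintype.card_prod,
      Fintype.card_fun, card_gridIndex, Fintype.card_fin]
    push_cast
    rw [pow_add, pow_add, pow_mul]
    ring

end OnlineRun

end Run

/-! ### Multiplicative concentration of the costs of the episodes -/

section MatrixMeasurability

/-- The entries of the inverse of a random matrix are measurable, being rational functions of the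
entries of the matrix. -/
theorem measurable_matrix_inv_apply {Ω n : Type*} [MeasurableSpace Ω] [Fintype n] [DecidableEq n]
    {M : Ω → Matrix n n ℝ} (hM : ∀ i j, Measurable fun ω => M ω i j) (i j : n) :
    Measurable fun ω => (M ω)⁻¹ i j := by
  have hof : Continuous fun f : n → n → ℝ => (Matrix.of f : Matrix n n ℝ) := continuous_id
  have h1 : Measurable fun f : n → n → ℝ => (Matrix.of f : Matrix n n ℝ).det :=
    hof.matrix_det.measurable
  have h2 : Measurable fun f : n → n → ℝ => (Matrix.of f : Matrix n n ℝ).adjugate i j :=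
    (hof.matrix_adjugate.matrix_elem i j).measurable
  have h3 : Measurable fun ω => (fun i j => M ω i j : n → n → ℝ) :=
    measurable_pi_lambda _ fun i => measurable_pi_lambda _ fun j => hM i j
  have h4 : ∀ ω, (M ω)⁻¹ i j = ((M ω).det)⁻¹ * (M ω).adjugate i j := fun ω => by
    rw [Matrix.inv_def, Ring.inverse_eq_inv', Matrix.smul_apply, smul_eq_mul]
  simp only [h4]
  exact (h1.comp h3).inv.mul (h2.comp h3)

end MatrixMeasurability

section ExponentialStep

theorem exp_neg_le_one_sub_half {x : ℝ} (h0 : 0 ≤ x) (h1 : x ≤ 1) : Real.exp (-x) ≤ 1 - x / 2 := by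
  rw [Real.exp_neg, inv_le_iff_one_le_mul₀ (Real.exp_pos x)]
  have h := Real.add_one_le_exp x
  nlinarith

/-- One step of a multiplicative Chernoff bound: a cost `X ∈ [0, R]` with the conditional mean `U`
is, up to the factor `2`, unlikely to stay below its mean. The hypothesis `hXU` says that `U` is
the conditional mean of `X`. -/
theorem integral_mul_exp_le {Ω : Type*} {m mΩ : MeasurableSpace Ω} {P : Measure Ω}
    [IsProbabilityMeasure P] (hm : m ≤ mΩ) {Λ U X : Ω → ℝ} {R c : ℝ} (hR : 0 < R)
    (hΛ : Measurable[m] Λ) (hΛ0 : ∀ ω, 0 ≤ Λ ω) (hΛc : ∀ ω, Λ ω ≤ c)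
    (hU : Measurable[m] U) (hU0 : ∀ ω, 0 ≤ U ω) (hUR : ∀ ω, U ω ≤ R)
    (hX : Measurable X) (hX0 : ∀ ω, 0 ≤ X ω) (hXR : ∀ ω, X ω ≤ R)
    (hXU : ∀ Y : Ω → ℝ, Measurable[m] Y → (∃ c, ∀ ω, |Y ω| ≤ c) →
      ∫ ω, Y ω * U ω ∂P = ∫ ω, Y ω * X ω ∂P) :
    ∫ ω, Λ ω * Real.exp ((U ω - 2 * X ω) / (2 * R)) ∂P ≤ ∫ ω, Λ ω ∂P := by
  set Y : Ω → ℝ := fun ω => Λ ω * Real.exp (U ω / (2 * R)) with hY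
  have hYm : Measurable[m] Y := hΛ.mul (Real.measurable_exp.comp (hU.div_const _))
  have hYm' : Measurable Y := hYm.mono hm le_rfl
  have hc0 : ∀ ω : Ω, 0 ≤ c := fun ω => (hΛ0 ω).trans (hΛc ω)
  have hY0 : ∀ ω, 0 ≤ Y ω := fun ω => mul_nonneg (hΛ0 ω) (Real.exp_pos _).le
  have hYb : ∀ ω, |Y ω| ≤ c * Real.exp 1 := fun ω => by
    rw [abs_of_nonneg (hY0 ω)]
    refine mul_le_mul (hΛc ω) (Real.exp_le_exp.2 ?_) (Real.exp_pos _).le (hc0 ω)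
    rw [div_le_one (by positivity)]
    linarith [hUR ω]
  have hmul : ∀ {V : Ω → ℝ}, Measurable V → (∀ ω, 0 ≤ V ω) → (∀ ω, V ω ≤ R) →
      Integrable (fun ω => Y ω * V ω) P := fun hV h0 h1 => by
    refine integrable_of_abs_le P (hYm'.mul hV) (c := c * Real.exp 1 * R) fun ω => ?_
    rw [abs_mul, abs_of_nonneg (h0 ω)]
    exact mul_le_mul (hYb ω) (h1 ω) (h0 ω) ((abs_nonneg _).trans (hYb ω))
  have hYi : Integrable Y P := integrable_of_abs_le P hYm' hYb
  have hYX := hmul hX hX0 hXR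
  have hYU := hmul (hU.mono hm le_rfl) hU0 hUR
  have hΛi : Integrable Λ P := integrable_of_abs_le P (hΛ.mono hm le_rfl) (c := c) fun ω => by
    rw [abs_of_nonneg (hΛ0 ω)]; exact hΛc ω
  have hle1 : ∀ ω, Λ ω * Real.exp ((U ω - 2 * X ω) / (2 * R)) ≤ Y ω - (2 * R)⁻¹ * (Y ω * X ω) :=
    fun ω => by
    have e1 : Real.exp ((U ω - 2 * X ω) / (2 * R))
        = Real.exp (U ω / (2 * R)) * Real.exp (-(X ω / R)) := by
      rw [← Real.exp_add]; congr 1; field_simp; ring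
    have e2 := exp_neg_le_one_sub_half (div_nonneg (hX0 ω) hR.le) ((div_le_one hR).2 (hXR ω))
    have e3 : Y ω - (2 * R)⁻¹ * (Y ω * X ω) = Y ω * (1 - X ω / R / 2) := by field_simp
    rw [e1, ← mul_assoc, e3]
    exact mul_le_mul_of_nonneg_left e2 (hY0 ω)
  have hle2 : ∀ ω, Y ω - (2 * R)⁻¹ * (Y ω * U ω) ≤ Λ ω := fun ω => by
    have e1 := Real.add_one_le_exp (-(U ω / (2 * R)))
    have e2 : Y ω - (2 * R)⁻¹ * (Y ω * U ω) = Y ω * (-(U ω / (2 * R)) + 1) := by field_simp; ring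
    rw [e2]
    refine (mul_le_mul_of_nonneg_left e1 (hY0 ω)).trans_eq ?_
    rw [hY, mul_assoc, ← Real.exp_add, add_neg_cancel, Real.exp_zero, mul_one]
  calc ∫ ω, Λ ω * Real.exp ((U ω - 2 * X ω) / (2 * R)) ∂P
      ≤ ∫ ω, (Y ω - (2 * R)⁻¹ * (Y ω * X ω)) ∂P :=
        integral_mono_of_nonneg (.of_forall fun ω => mul_nonneg (hΛ0 ω) (Real.exp_pos _).le)
          (hYi.sub (hYX.const_mul _)) (.of_forall hle1)
    _ = ∫ ω, (Y ω - (2 * R)⁻¹ * (Y ω * U ω)) ∂P := by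
        rw [integral_sub hYi (hYX.const_mul _), integral_sub hYi (hYU.const_mul _),
          integral_const_mul, integral_const_mul, hXU Y hYm ⟨_, hYb⟩]
    _ ≤ ∫ ω, Λ ω ∂P := integral_mono (hYi.sub (hYU.const_mul _)) hΛi hle2

end ExponentialStep

section JointMeasurability

/-- The expected total cost is jointly measurable in the initial state and in the randomness that
determines the policies and the costs. -/
theorem measurable_cumul_joint {Ω S A : Type*} [m : MeasurableSpace Ω] [MeasurableSpace S]
    [Fintype A] [MeasurableSpace A] {G : MarkovGame S A} {π ν : Ω → Policy S A}
    (hπ : PolicyMeasurable G.horizon m π) (hν : PolicyMeasurable G.horizon m ν)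
    {g : Ω → ℕ → S × A × A → ℝ}
    (hg : ∀ h, 1 ≤ h → h ≤ G.horizon → Measurable fun q : Ω × (S × A × A) => g q.1 h q.2)
    (n : ℕ) : ∀ h, 1 ≤ h → h + n ≤ G.horizon + 1 →
      Measurable fun q : Ω × S => cumul G (π q.1) (ν q.1) (g q.1) n h q.2 := by
  induction n with
  | zero => intro h _ _; exact measurable_const
  | succ n ih =>
    intro h h1 hH
    refine measurable_payoff (p := fun q : Ω × S => (π q.1).act h q.2)
      (q := fun q : Ω × S => (ν q.1).act h q.2) (hπ h h1 (by omega)) (hν h h1 (by omega))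
      fun a b => ?_
    have e1 : Measurable fun q : Ω × S => (q.1, (q.2, a, b)) := by fun_prop
    have e2 : Measurable fun q : Ω × S => (q.2, a, b) := by fun_prop
    have e3 : Measurable fun q : (Ω × S) × S =>
        cumul G (π q.1.1) (ν q.1.1) (g q.1.1) n (h + 1) q.2 :=
      (ih (h + 1) (by omega) (by omega)).comp
        (by fun_prop : Measurable fun q : (Ω × S) × S => (q.1.1, q.2))
    exact ((hg h h1 (by omega)).comp e1).add (e3.stronglyMeasurable.integral_kernel_prod_right'
      (κ := (G.trans h).comap _ e2)).measurable

theorem measurable_integral_cumul_joint {Ω S A : Type*} [m : MeasurableSpace Ω]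
    [MeasurableSpace S] [MeasurableSpace A] {G : MarkovGame S A} {f : Ω → S → ℝ}
    (hf : Measurable fun q : Ω × S => f q.1 q.2) (h : ℕ) :
    Measurable fun q : Ω × (S × A × A) => ∫ y, f q.1 y ∂G.trans h q.2 := by
  have e3 : Measurable fun q : (Ω × (S × A × A)) × S => f q.1.1 q.2 :=
    hf.comp (by fun_prop : Measurable fun q : (Ω × (S × A × A)) × S => (q.1.1, q.2))
  exact (e3.stronglyMeasurable.integral_kernel_prod_right'
      (κ := (G.trans h).comap Prod.snd measurable_snd)).measurable

end JointMeasurability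

section EpisodeCost

variable {Ω S A : Type*} [mΩ : MeasurableSpace Ω] [mS : MeasurableSpace S] [Fintype A]
  [mA : MeasurableSpace A] [MeasurableSingletonClass A] {P : Measure Ω} [IsProbabilityMeasure P]
  {G : MarkovGame S A} {d : ℕ}
  {φ : S × A × A → EuclideanSpace ℝ (Fin d)} {β : ℝ} {K : ℕ} {D : Ω → Record S A}
  {π B ν : ℕ → Ω → Policy S A} {info infoAct : ℕ → ℕ → MeasurableSpace Ω}

namespace OnlineRun

/-- Averaging over the actions of step `h`. -/
theorem integral_payoff_eq (R : OnlineRun P G φ β K D π B ν info infoAct) {k h : ℕ}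
    (hk : 1 ≤ k) (hK : k ≤ K) (h1 : 1 ≤ h) (hH : h ≤ G.horizon) {F : Ω → S × A × A → ℝ}
    (hF : Measurable[(info k 1).prod (mS.prod (mA.prod mA))]
      fun q : Ω × (S × A × A) => F q.1 q.2) {c : ℝ}
    (hc : ∀ ω z, |F ω z| ≤ c) :
    ∫ ω, payoff (fun a b => F ω ((D ω).state k h, a, b)) ((π k ω).act h ((D ω).state k h))
      ((ν k ω).act h ((D ω).state k h)) ∂P = ∫ ω, F ω ((D ω).triple k h) ∂P := by
  have hle : info k 1 ≤ info k h := R.info_mono hk hK le_rfl h1 (by omega)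
  have hle' : info k h ≤ mΩ := R.info_le k h hk hK h1 (by omega)
  have hs : Measurable[info k h] fun ω => (D ω).state k h :=
    R.measurable_state k h hk hK h1 (by omega)
  have hid : Measurable[info k h, info k 1] (id : Ω → Ω) := measurable_id'' hle
  have hFab : ∀ a b, Measurable[info k h] fun ω => F ω ((D ω).state k h, a, b) := fun a b => by
    have e : Measurable[info k h] fun ω => ((D ω).state k h, a, b) :=
      hs.prodMk (measurable_const (a := (a, b)))
    exact hF.comp (hid.prodMk e)
  have hpol : ∀ {ρ : ℕ → Ω → Policy S A}, PolicyMeasurable G.horizon (info k 1) (ρ k) → ∀ a,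
      Measurable fun ω => ((ρ k ω).act h ((D ω).state k h)).real {a} := fun hρ a =>
    ((hρ h h1 hH a).comp (hid.prodMk hs)).mono hle' le_rfl
  have hev : ∀ a b, MeasurableSet {ω | (D ω).act1 k h = a ∧ (D ω).act2 k h = b} := fun a b => by
    have e := R.infoAct_le hk hK h1 hH
    exact (((R.measurable_act1 k h hk hK h1 hH).mono e le_rfl) (measurableSet_singleton a)).inter
      (((R.measurable_act2 k h hk hK h1 hH).mono e le_rfl) (measurableSet_singleton b))
  have hcell := fun a b => integral_mul_indicator_of_condLaw hle' (hev a b)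
    (R.law_act k h hk hK h1 hH a b) (hFab a b) (fun ω => hc ω _)
  have hint1 : ∀ a b, Integrable (fun ω => ((π k ω).act h ((D ω).state k h)).real {a}
      * ((ν k ω).act h ((D ω).state k h)).real {b} * F ω ((D ω).state k h, a, b)) P := fun a b => by
    refine integrable_of_abs_le P (((hpol (R.measurable_pi k hk hK) a).mul
      (hpol (R.measurable_nu k hk hK) b)).mul ((hFab a b).mono hle' le_rfl)) (c := 1 * 1 * c)
      fun ω => ?_
    rw [abs_mul, abs_mul, abs_of_nonneg measureReal_nonneg, abs_of_nonneg measureReal_nonneg]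
    gcongr
    · exact measureReal_le_one
    · exact measureReal_le_one
    · exact hc _ _
  have hint2 : ∀ a b, Integrable (fun ω => F ω ((D ω).state k h, a, b) *
      {ω | (D ω).act1 k h = a ∧ (D ω).act2 k h = b}.indicator (fun _ => (1 : ℝ)) ω) P :=
    fun a b => ((integrable_const (1 : ℝ)).indicator (hev a b)).bdd_mul
      ((hFab a b).mono hle' le_rfl).aestronglyMeasurable (.of_forall fun ω => hc ω _)
  have hsum : ∀ ω, ∑ a, ∑ b, F ω ((D ω).state k h, a, b) *
      {ω | (D ω).act1 k h = a ∧ (D ω).act2 k h = b}.indicator (fun _ => (1 : ℝ)) ω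
        = F ω ((D ω).triple k h) := fun ω => by
    classical
    simp [Set.indicator_apply, ite_and, Finset.sum_ite_eq, Record.triple]
  calc _ = ∑ a, ∑ b, ∫ ω, ((π k ω).act h ((D ω).state k h)).real {a}
        * ((ν k ω).act h ((D ω).state k h)).real {b} * F ω ((D ω).state k h, a, b) ∂P := by
        simp only [payoff]
        rw [integral_finsetSum _ fun a _ => integrable_finsetSum _ fun b _ => hint1 a b]
        exact Finset.sum_congr rfl fun a _ => integral_finsetSum _ fun b _ => hint1 a b
    _ = ∑ a, ∑ b, ∫ ω, F ω ((D ω).state k h, a, b) *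
        {ω | (D ω).act1 k h = a ∧ (D ω).act2 k h = b}.indicator (fun _ => (1 : ℝ)) ω ∂P := by
        refine Finset.sum_congr rfl fun a _ => Finset.sum_congr rfl fun b _ => ?_
        rw [hcell a b]
        exact integral_congr_ae (.of_forall fun ω => mul_comm _ _)
    _ = ∫ ω, F ω ((D ω).triple k h) ∂P := by
        rw [← integral_congr_ae (.of_forall hsum),
          integral_finsetSum _ fun a _ => integrable_finsetSum _ fun b _ => hint2 a b]
        exact Finset.sum_congr rfl fun a _ => (integral_finsetSum _ fun b _ => hint2 a b).symm

/-- The mean of the cost of an episode, weighted by anything known at its start, is the mean of the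
expected total cost computed from the policies. -/
theorem integral_mul_cumul_eq (R : OnlineRun P G φ β K D π B ν info infoAct) {k : ℕ}
    (hk : 1 ≤ k) (hK : k ≤ K) {g : Ω → ℕ → S × A × A → ℝ}
    (hg : ∀ h, 1 ≤ h → h ≤ G.horizon →
      Measurable[(info k 1).prod (mS.prod (mA.prod mA))] fun q : Ω × (S × A × A) => g q.1 h q.2)
    {c : ℝ} (hc : ∀ ω h z, |g ω h z| ≤ c) {Y : Ω → ℝ} (hY : Measurable[info k 1] Y) {cY : ℝ}
    (hYc : ∀ ω, |Y ω| ≤ cY) (n : ℕ) : ∀ h, 1 ≤ h → h + n = G.horizon + 1 →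
      ∫ ω, Y ω * cumul G (π k ω) (ν k ω) (g ω) n h ((D ω).state k h) ∂P
        = ∫ ω, Y ω * ∑ i ∈ Finset.Ico h (G.horizon + 1), g ω i ((D ω).triple k i) ∂P := by
  induction n with
  | zero =>
    intro h _ hn
    simp [cumul, ← hn]
  | succ n ih =>
    intro h h1 hn
    have hH : h ≤ G.horizon := by omega
    have hm1 : info k 1 ≤ mΩ := R.info_le k 1 hk hK le_rfl (by omega)
    have hcum := measurable_cumul_joint (m := info k 1) (R.measurable_pi k hk hK)
      (R.measurable_nu k hk hK) hg n (h + 1) (by omega) (by omega)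
    have hcumb : ∀ ω x, |cumul G (π k ω) (ν k ω) (g ω) n (h + 1) x| ≤ n * c := fun ω =>
      abs_cumul_le G _ _ (hc ω) n (h + 1)
    have hYfst : Measurable[(info k 1).prod (mS.prod (mA.prod mA))]
        fun q : Ω × (S × A × A) => Y q.1 :=
      hY.comp (@measurable_fst Ω (S × A × A) (info k 1) _)
    set F₁ : Ω → S × A × A → ℝ := fun ω z => Y ω * g ω h z with hF₁
    set F₂ : Ω → S × A × A → ℝ := fun ω z =>
      Y ω * ∫ y, cumul G (π k ω) (ν k ω) (g ω) n (h + 1) y ∂G.trans h z with hF₂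
    have hF₁m : Measurable[(info k 1).prod (mS.prod (mA.prod mA))]
        fun q : Ω × (S × A × A) => F₁ q.1 q.2 := hYfst.mul (hg h h1 hH)
    have hF₂m : Measurable[(info k 1).prod (mS.prod (mA.prod mA))]
        fun q : Ω × (S × A × A) => F₂ q.1 q.2 :=
      hYfst.mul (measurable_integral_cumul_joint (m := info k 1)
        (f := fun ω => cumul G (π k ω) (ν k ω) (g ω) n (h + 1)) hcum h)
    have hF₁b : ∀ ω z, |F₁ ω z| ≤ cY * c := fun ω z => by
      rw [hF₁, abs_mul]
      exact mul_le_mul (hYc ω) (hc ω h z) (abs_nonneg _) ((abs_nonneg _).trans (hYc ω))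
    have hF₂b : ∀ ω z, |F₂ ω z| ≤ cY * (n * c) := fun ω z => by
      rw [hF₂, abs_mul]
      exact mul_le_mul (hYc ω) (abs_integral_le _ (hcumb ω)) (abs_nonneg _)
        ((abs_nonneg _).trans (hYc ω))
    have hAct : infoAct k h ≤ mΩ := R.infoAct_le hk hK h1 hH
    have h1Act : info k 1 ≤ infoAct k h :=
      (R.info_mono hk hK le_rfl h1 (by omega)).trans (R.info_le_infoAct k h hk hK h1 hH)
    have hz : ∀ i, 1 ≤ i → i ≤ G.horizon → Measurable fun ω => (D ω).triple k i :=
      fun i hi hiH => (R.measurable_triple hk hK hi hiH).mono (R.infoAct_le hk hK hi hiH) le_rfl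
    have hid : Measurable[mΩ, info k 1] (id : Ω → Ω) := measurable_id'' hm1
    have hF₁i : Integrable (fun ω => F₁ ω ((D ω).triple k h)) P :=
      integrable_of_abs_le P (hF₁m.comp (hid.prodMk (hz h h1 hH))) fun ω => hF₁b ω _
    have hF₂i : Integrable (fun ω => F₂ ω ((D ω).triple k h)) P :=
      integrable_of_abs_le P (hF₂m.comp (hid.prodMk (hz h h1 hH))) fun ω => hF₂b ω _
    have hgi : ∀ i, 1 ≤ i → i ≤ G.horizon →
        Measurable fun ω => g ω i ((D ω).triple k i) := fun i hi hiH =>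
      (hg i hi hiH).comp (hid.prodMk (hz i hi hiH))
    have hrest : Integrable (fun ω => Y ω * ∑ i ∈ Finset.Ico (h + 1) (G.horizon + 1),
        g ω i ((D ω).triple k i)) P := by
      refine integrable_of_abs_le P ((hY.mono hm1 le_rfl).mul
        (Finset.measurable_fun_sum _ fun i hi => ?_))
        (c := cY * ∑ i ∈ Finset.Ico (h + 1) (G.horizon + 1), c) fun ω => ?_
      · exact hgi i (by have := (Finset.mem_Ico.1 hi).1; omega)
          (by have := (Finset.mem_Ico.1 hi).2; omega)
      · rw [abs_mul]
        exact mul_le_mul (hYc ω) ((Finset.abs_sum_le_sum_abs _ _).trans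
          (Finset.sum_le_sum fun i _ => hc ω i _)) (abs_nonneg _) ((abs_nonneg _).trans (hYc ω))
    -- the next state is averaged out given the actions
    have hstate : ∫ ω, F₂ ω ((D ω).triple k h) ∂P
        = ∫ ω, Y ω * cumul G (π k ω) (ν k ω) (g ω) n (h + 1) ((D ω).state k (h + 1)) ∂P := by
      have hnext : Measurable fun ω => (D ω).state k (h + 1) :=
        (R.measurable_state k (h + 1) hk hK (by omega) (by omega)).mono
          (R.info_le k (h + 1) hk hK (by omega) (by omega)) le_rfl
      have hm' : Measurable[(infoAct k h).prod mS]
          fun q : Ω × S => Y q.1 * cumul G (π k q.1) (ν k q.1) (g q.1) n (h + 1) q.2 := by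
        have e : Measurable[(info k 1).prod mS]
            fun q : Ω × S => Y q.1 * cumul G (π k q.1) (ν k q.1) (g q.1) n (h + 1) q.2 :=
          (hY.comp (@measurable_fst Ω S (info k 1) mS)).mul hcum
        exact e.mono (sup_le_sup (MeasurableSpace.comap_mono h1Act) le_rfl) le_rfl
      rw [integral_of_condLaw hAct (R.measurable_triple hk hK h1 hH) hnext (G.trans h)
        (R.law_state k h hk hK h1 hH) hm' (c := cY * (n * c)) fun q => ?_]
      · simp only [hF₂, integral_const_mul]
      · rw [abs_mul]
        exact mul_le_mul (hYc _) (hcumb _ _) (abs_nonneg _) ((abs_nonneg _).trans (hYc q.1))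
    calc _ = ∫ ω, payoff (fun a b => F₁ ω ((D ω).state k h, a, b) + F₂ ω ((D ω).state k h, a, b))
          ((π k ω).act h ((D ω).state k h)) ((ν k ω).act h ((D ω).state k h)) ∂P := by
          refine integral_congr_ae (.of_forall fun ω => ?_)
          simp only [cumul, payoff, Finset.mul_sum, hF₁, hF₂]
          refine Finset.sum_congr rfl fun a _ => Finset.sum_congr rfl fun b _ => ?_
          ring
      _ = ∫ ω, (F₁ ω ((D ω).triple k h) + F₂ ω ((D ω).triple k h)) ∂P :=
          R.integral_payoff_eq hk hK h1 hH (F := fun ω z => F₁ ω z + F₂ ω z) (hF₁m.add hF₂m)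
            (c := cY * c + cY * (n * c))
            fun ω z => (abs_add_le _ _).trans (add_le_add (hF₁b ω z) (hF₂b ω z))
      _ = ∫ ω, F₁ ω ((D ω).triple k h) ∂P + ∫ ω, Y ω *
          ∑ i ∈ Finset.Ico (h + 1) (G.horizon + 1), g ω i ((D ω).triple k i) ∂P := by
          rw [integral_add hF₁i hF₂i, hstate, ih (h + 1) (by omega) (by omega)]
      _ = _ := by
          rw [← integral_add hF₁i hrest]
          refine integral_congr_ae (.of_forall fun ω => ?_)
          simp only [hF₁]
          rw [Finset.sum_eq_sum_Ico_succ_bot (by omega : h < G.horizon + 1), mul_add]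

/-- Multiplicative concentration of the realized costs around their conditional means, one
exponential supermartingale step for each episode. -/
theorem integral_exp_cost_le_one (R : OnlineRun P G φ β K D π B ν info infoAct)
    {g : ℕ → Ω → ℕ → S × A × A → ℝ}
    (hg : ∀ k, 1 ≤ k → k ≤ K → ∀ h, 1 ≤ h → h ≤ G.horizon →
      Measurable[(info k 1).prod (mS.prod (mA.prod mA))] fun q : Ω × (S × A × A) => g k q.1 h q.2)
    (hg0 : ∀ k ω h z, 0 ≤ g k ω h z) {c : ℝ} (hc : ∀ k ω h z, |g k ω h z| ≤ c)
    {r : ℝ} (hr : 0 < r) (hrc : G.horizon * c ≤ r) {k : ℕ} (hk : k ≤ K) :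
    Measurable (fun ω => ∑ j ∈ Finset.Icc 1 k,
      (cumul G (π j ω) (ν j ω) (g j ω) G.horizon 1 ((D ω).state j 1)
        - 2 * ∑ i ∈ Finset.Ico 1 (G.horizon + 1), g j ω i ((D ω).triple j i)) / (2 * r)) ∧
    (∀ ω, ∑ j ∈ Finset.Icc 1 k,
      (cumul G (π j ω) (ν j ω) (g j ω) G.horizon 1 ((D ω).state j 1)
        - 2 * ∑ i ∈ Finset.Ico 1 (G.horizon + 1), g j ω i ((D ω).triple j i)) / (2 * r) ≤ k) ∧
    ∫ ω, Real.exp (∑ j ∈ Finset.Icc 1 k,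
      (cumul G (π j ω) (ν j ω) (g j ω) G.horizon 1 ((D ω).state j 1)
        - 2 * ∑ i ∈ Finset.Ico 1 (G.horizon + 1), g j ω i ((D ω).triple j i)) / (2 * r)) ∂P
      ≤ 1 := by
  set U : ℕ → Ω → ℝ := fun j ω =>
    cumul G (π j ω) (ν j ω) (g j ω) G.horizon 1 ((D ω).state j 1) with hU
  set X : ℕ → Ω → ℝ := fun j ω =>
    ∑ i ∈ Finset.Ico 1 (G.horizon + 1), g j ω i ((D ω).triple j i) with hX
  have hUm : ∀ j, 1 ≤ j → j ≤ K → Measurable[info j 1] (U j) := fun j hj hjK => by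
    have hid : Measurable[info j 1, info j 1] (id : Ω → Ω) := @measurable_id Ω (info j 1)
    exact (measurable_cumul_joint (m := info j 1) (R.measurable_pi j hj hjK)
      (R.measurable_nu j hj hjK) (hg j hj hjK) G.horizon 1 le_rfl (by omega)).comp
      (hid.prodMk (R.measurable_state j 1 hj hjK le_rfl (by omega)))
  have hXm : ∀ j, 1 ≤ j → j ≤ K → Measurable (X j) := fun j hj hjK => by
    have hid : Measurable[mΩ, info j 1] (id : Ω → Ω) :=
      measurable_id'' (R.info_le j 1 hj hjK le_rfl (by omega))
    refine Finset.measurable_fun_sum _ fun i hi => ?_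
    obtain ⟨hi1, hi2⟩ := Finset.mem_Ico.1 hi
    exact (hg j hj hjK i hi1 (by omega)).comp (hid.prodMk ((R.measurable_triple hj hjK hi1
      (by omega)).mono (R.infoAct_le hj hjK hi1 (by omega)) le_rfl))
  have hXm' : ∀ j j', 1 ≤ j → j < j' → j' ≤ K → Measurable[info j' 1] (X j) :=
    fun j j' hj hjj hjK => by
    have hid : Measurable[info j' 1, info j 1] (id : Ω → Ω) :=
      measurable_id'' (R.info_one_mono hj hjj.le hjK)
    refine Finset.measurable_fun_sum _ fun i hi => ?_
    obtain ⟨hi1, hi2⟩ := Finset.mem_Ico.1 hi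
    exact (hg j hj (by omega) i hi1 (by omega)).comp
      (hid.prodMk (R.measurable_triple_past hj hjj hjK hi1 (by omega)))
  have hU0 : ∀ j ω, 0 ≤ U j ω := fun j ω => cumul_nonneg G _ _ (hg0 j ω) _ _ _
  have hUr : ∀ j ω, U j ω ≤ r := fun j ω =>
    ((abs_le.1 (abs_cumul_le G _ _ (hc j ω) _ _ _)).2).trans hrc
  have hX0 : ∀ j ω, 0 ≤ X j ω := fun j ω => Finset.sum_nonneg fun i _ => hg0 j ω i _
  have hXr : ∀ j ω, X j ω ≤ r := fun j ω => by
    refine le_trans (Finset.sum_le_sum fun i _ => (abs_le.1 (hc j ω i _)).2) ?_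
    simpa using hrc
  have hle : ∀ (k : ℕ) ω, ∑ j ∈ Finset.Icc 1 k, (U j ω - 2 * X j ω) / (2 * r) ≤ k := fun k ω => by
    refine (Finset.sum_le_sum (g := fun _ => (1 : ℝ)) fun j _ => ?_).trans_eq (by simp)
    rw [div_le_one (by positivity)]
    linarith [hUr j ω, hX0 j ω]
  refine ⟨Finset.measurable_fun_sum _ fun j hj => ?_, hle k, ?_⟩
  · obtain ⟨hj1, hj2⟩ := Finset.mem_Icc.1 hj
    exact (((hUm j hj1 (by omega)).mono (R.info_le j 1 hj1 (by omega) le_rfl (by omega))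
      le_rfl).sub ((hXm j hj1 (by omega)).const_mul 2)).div_const _
  induction k with
  | zero => simp
  | succ k ih =>
    have ih := ih (by omega)
    have h1 : 1 ≤ k + 1 := by omega
    have hm : info (k + 1) 1 ≤ mΩ := R.info_le (k + 1) 1 h1 hk le_rfl (by omega)
    set Λ : Ω → ℝ := fun ω => Real.exp (∑ j ∈ Finset.Icc 1 k, (U j ω - 2 * X j ω) / (2 * r))
    have hΛ : Measurable[info (k + 1) 1] Λ := by
      refine Real.measurable_exp.comp (Finset.measurable_fun_sum _ fun j hj => ?_)
      obtain ⟨hj1, hj2⟩ := Finset.mem_Icc.1 hj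
      exact (((hUm j hj1 (by omega)).mono (R.info_one_mono hj1 (by omega) hk) le_rfl).sub
        ((hXm' j (k + 1) hj1 (by omega) hk).const_mul 2)).div_const _
    have hΛc : ∀ ω, Λ ω ≤ Real.exp k := fun ω => Real.exp_le_exp.2 (hle k ω)
    refine le_trans (le_of_eq ?_) ((integral_mul_exp_le (P := P) hm hr hΛ
      (fun ω => (Real.exp_pos _).le) hΛc (hUm (k + 1) h1 hk) (hU0 (k + 1)) (hUr (k + 1))
      (hXm (k + 1) h1 hk) (hX0 (k + 1)) (hXr (k + 1)) fun Y hY ⟨cY, hYc⟩ => ?_).trans ih)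
    · refine integral_congr_ae (.of_forall fun ω => ?_)
      simp only [Λ]
      rw [Finset.sum_Icc_succ_top h1, Real.exp_add]
    · exact R.integral_mul_cumul_eq h1 hk (hg (k + 1) h1 hk) (hc (k + 1)) hY hYc G.horizon 1 le_rfl
        (by omega)

/-- With high probability the expected costs of all episodes together are at most twice the
realized ones, up to a term independent of the number of episodes. -/
theorem measure_sum_cumul_gt_le (R : OnlineRun P G φ β K D π B ν info infoAct)
    {g : ℕ → Ω → ℕ → S × A × A → ℝ}
    (hg : ∀ k, 1 ≤ k → k ≤ K → ∀ h, 1 ≤ h → h ≤ G.horizon →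
      Measurable[(info k 1).prod (mS.prod (mA.prod mA))] fun q : Ω × (S × A × A) => g k q.1 h q.2)
    (hg0 : ∀ k ω h z, 0 ≤ g k ω h z) {c : ℝ} (hc : ∀ k ω h z, |g k ω h z| ≤ c)
    {r : ℝ} (hr : 0 < r) (hrc : G.horizon * c ≤ r) (L : ℝ) :
    P {ω | ¬ ∑ k ∈ Finset.Icc 1 K, cumul G (π k ω) (ν k ω) (g k ω) G.horizon 1 ((D ω).state k 1)
        ≤ 2 * ∑ k ∈ Finset.Icc 1 K, ∑ i ∈ Finset.Ico 1 (G.horizon + 1), g k ω i ((D ω).triple k i)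
          + 2 * r * L} ≤ ENNReal.ofReal (Real.exp (-L)) := by
  obtain ⟨hmeas, hbdd, hle⟩ := R.integral_exp_cost_le_one hg hg0 hc hr hrc (le_refl K)
  refine le_trans (measure_mono fun ω hω => ?_) (measure_ge_le_exp_neg ?_ hmeas L)
  · rw [Set.mem_ofPred_eq, not_le] at hω
    rw [Set.mem_ofPred_eq, ← Finset.sum_div, le_div_iff₀ (by positivity), Finset.sum_sub_distrib,
      ← Finset.mul_sum]
    linarith
  · rw [← ofReal_integral_eq_lintegral_ofReal (integrable_of_abs_le P hmeas.exp
      (c := Real.exp K) fun ω => ?_) (.of_forall fun ω => (Real.exp_pos _).le)]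
    · exact ENNReal.ofReal_le_one.2 hle
    · rw [abs_of_pos (Real.exp_pos _)]
      exact Real.exp_le_exp.2 (hbdd ω)

end OnlineRun

end EpisodeCost

/-! ### The regret bound -/

section RegretBound

variable {S A : Type*} [MeasurableSpace S] [MeasurableSpace A] {d : ℕ} {G : MarkovGame S A}
  {φ : S × A × A → EuclideanSpace ℝ (Fin d)} {β : ℝ}

/-- The capped bonuses of an episode are jointly measurable in the past data and in the point where
they are evaluated. -/
theorem measurable_cappedBonus_joint {Ω : Type*} [m : MeasurableSpace Ω] (hφ : Measurable φ)
    {D : Ω → Record S A} {k h : ℕ}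
    (hD : ∀ τ, 1 ≤ τ → τ < k → Measurable fun ω => (D ω).triple τ h) :
    Measurable fun q : Ω × (S × A × A) => cappedBonus G φ β (D q.1) k h q.2 := by
  have hgram : ∀ i j, Measurable fun ω => gram φ (D ω) k h i j := fun i j => by
    simp only [gram, Matrix.add_apply, Matrix.sum_apply, Matrix.vecMulVec_apply]
    refine (Finset.measurable_fun_sum _ fun τ hτ => ?_).add_const _
    obtain ⟨hτ1, hτ2⟩ := Finset.mem_Ico.1 hτ
    exact (measurable_coord (hφ.comp (hD τ hτ1 hτ2)) i).mul
      (measurable_coord (hφ.comp (hD τ hτ1 hτ2)) j)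
  have hφ2 : Measurable fun q : Ω × (S × A × A) => φ q.2 := hφ.comp measurable_snd
  have hquad : Measurable fun q : Ω × (S × A × A) =>
      (φ q.2).ofLp ⬝ᵥ ((gram φ (D q.1) k h)⁻¹ *ᵥ (φ q.2).ofLp) :=
    measurable_dotProduct (measurable_coord hφ2) fun i =>
      measurable_dotProduct
        (fun j => (measurable_matrix_inv_apply hgram i j).comp measurable_fst)
        (measurable_coord hφ2)
  exact (hquad.sqrt.const_mul _).min measurable_const

omit [MeasurableSpace S] [MeasurableSpace A] in
/-- Elliptical potential bound for the realized bonuses of one step. -/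
theorem sum_bonus_le (hφ : ∀ z, ‖φ z‖ ≤ 1) (D : Record S A) (K h : ℕ) :
    ∑ k ∈ Finset.Icc 1 K, bonus φ D k h (D.triple k h) ≤ √(K * (2 * (d * Real.log (K + d)))) := by
  refine Real.le_sqrt_of_sq_le ?_
  have h1 := sq_sum_le_card_mul_sum_sq (s := Finset.Icc 1 K)
    (f := fun k => bonus φ D k h (D.triple k h))
  have h2 := sum_dotProduct_inv_regGram_le (fun τ => (φ (D.triple τ h)).ofLp)
    (fun τ => dotProduct_ofLp_self_le_one hφ _) K
  have h3 : ∑ k ∈ Finset.Icc 1 K, bonus φ D k h (D.triple k h) ^ 2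
      ≤ 2 * (d * Real.log (K + d)) := by
    refine le_trans (le_of_eq (Finset.sum_congr rfl fun k _ => ?_)) (by simpa using h2)
    rw [bonus, Real.sq_sqrt, gram_eq_regGram]
    rw [gram_eq_regGram]
    exact dotProduct_mulVec_self_nonneg (posDef_regGram _ k).inv.posSemidef _
  refine h1.trans ?_
  rw [Nat.card_Icc, Nat.add_sub_cancel]
  gcongr

theorem sum_cappedBonus_le (hφ : ∀ z, ‖φ z‖ ≤ 1) (hβ : 0 ≤ β) (D : Record S A) (K : ℕ) :
    ∑ k ∈ Finset.Icc 1 K, ∑ i ∈ Finset.Ico 1 (G.horizon + 1),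
      cappedBonus G φ β D k i (D.triple k i)
        ≤ G.horizon * (2 * β * √(K * (2 * (d * Real.log (K + d))))) := by
  rw [Finset.sum_comm]
  refine (Finset.sum_le_sum (g := fun _ => 2 * β * √(K * (2 * (d * Real.log (K + d)))))
    fun i _ => ?_).trans_eq (by simp)
  refine (Finset.sum_le_sum fun k _ => min_le_left _ _).trans ?_
  rw [← Finset.mul_sum]
  exact mul_le_mul_of_nonneg_left (sum_bonus_le hφ D K i) (by positivity)

/-- Against the auxiliary policy `B`, the equilibrium policy `πs` earns at least the equilibrium
value; together with optimism this bounds the regret by the expected bonuses. -/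
theorem regret_le_sum_cumul [Fintype A] [MeasurableSingletonClass A] (hφ : Measurable φ)
    (hβ : 0 ≤ β) {πs νs : Policy S A} (hN : G.IsNash πs νs) {D : Record S A} {K : ℕ}
    {π B ν : ℕ → Policy S A}
    (hacc : ∀ k, 1 ≤ k → k ≤ K → IsAccurate G D k (π k) (B k) φ β)
    (homni : ∀ k, 1 ≤ k → k ≤ K → IsOmniPolicy G φ β D k (π k) (B k)) :
    regret G πs νs K D π ν ≤ ∑ k ∈ Finset.Icc 1 K,
      cumul G (π k) (ν k) (cappedBonus G φ β D k) G.horizon 1 (D.state k 1) := by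
  refine Finset.sum_le_sum fun k hk => ?_
  obtain ⟨hk1, hk2⟩ := Finset.mem_Icc.1 hk
  have h1 : G.value πs νs 1 (D.state k 1) ≤ G.value πs (B k) 1 (D.state k 1) :=
    (hN (D.state k 1)).2.2 ⟨B k, rfl⟩
  have h2 := cumul_reward_le_optV hφ (hacc k hk1 hk2) (homni k hk1 hk2) πs G.horizon 1 le_rfl
    (by omega) (D.state k 1)
  have h3 := optV_sub_cumul_reward_le hφ hβ (hacc k hk1 hk2) (homni k hk1 hk2) (ν k) G.horizon 1
    le_rfl (by omega) (D.state k 1)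
  rw [value_eq_cumul G πs (B k), Nat.add_sub_cancel] at h1
  rw [value_eq_cumul G (π k) (ν k), Nat.add_sub_cancel]
  linarith

end RegretBound

section Constants

/-- The union bound over the net: its cardinality is a power of `X` with exponent of order `d²`. -/
theorem card_net_mul_exp_le {d : ℕ} (hd : 1 ≤ d) {X Y p : ℝ} (hX2 : 2 ≤ X) (hY : Y ≤ X * p / 2)
    (hY0 : 0 ≤ Y) :
    Y * (2 * (⌈X ^ 21⌉₊ : ℝ) + 1) ^ (d + d * d + d) * Real.exp (-(70 * (d : ℝ) ^ 2 * Real.log X))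
      ≤ p / 2 := by
  have hX0 : 0 < X := by linarith
  have hX1 : 1 ≤ X := by linarith
  have hp : 0 ≤ p := by
    by_contra h
    linarith [mul_neg_of_pos_of_neg hX0 (not_le.1 h)]
  have hN : (2 * (⌈X ^ 21⌉₊ : ℝ) + 1) ≤ X ^ 23 := by
    have h1 := (Nat.ceil_lt_add_one (by positivity : 0 ≤ X ^ 21)).le
    have h2 : X ^ 23 = X ^ 2 * X ^ 21 := by ring
    have h3 : (2 : ℝ) ^ 2 ≤ X ^ 2 := pow_le_pow_left₀ (by norm_num) hX2 2
    have h4 : X ≤ X ^ 21 := le_self_pow₀ hX1 (by norm_num)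
    have h5 := mul_le_mul_of_nonneg_right h3 (by positivity : 0 ≤ X ^ 21)
    rw [h2]
    linarith
  have hpow : (2 * (⌈X ^ 21⌉₊ : ℝ) + 1) ^ (d + d * d + d) ≤ X ^ (69 * d ^ 2) := by
    calc (2 * (⌈X ^ 21⌉₊ : ℝ) + 1) ^ (d + d * d + d) ≤ (X ^ 23) ^ (d + d * d + d) := by gcongr
      _ ≤ (X ^ 23) ^ (3 * d ^ 2) :=
          pow_le_pow_right₀ (one_le_pow₀ hX1) (by linarith [Nat.le_mul_self d, sq d])
      _ = X ^ (69 * d ^ 2) := by rw [← pow_mul]; congr 1; ring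
  have hexp : Real.exp (-(70 * (d : ℝ) ^ 2 * Real.log X)) = (X ^ (70 * d ^ 2))⁻¹ := by
    rw [Real.exp_neg, show 70 * (d : ℝ) ^ 2 * Real.log X = ((70 * d ^ 2 : ℕ) : ℝ) * Real.log X by
      push_cast; ring, Real.exp_nat_mul, Real.exp_log hX0]
  rw [hexp, ← div_eq_mul_inv, div_le_iff₀ (by positivity)]
  have hXpow : X ^ (69 * d ^ 2) * X ≤ X ^ (70 * d ^ 2) := by
    rw [← pow_succ]
    exact pow_le_pow_right₀ hX1 (by linarith [Nat.one_le_pow 2 d hd])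
  calc Y * (2 * (⌈X ^ 21⌉₊ : ℝ) + 1) ^ (d + d * d + d)
      ≤ Y * X ^ (69 * d ^ 2) := by gcongr
    _ ≤ (X * p / 2) * X ^ (69 * d ^ 2) := by gcongr
    _ = p / 2 * (X ^ (69 * d ^ 2) * X) := by ring
    _ ≤ p / 2 * X ^ (70 * d ^ 2) := by gcongr

/-- The bonus parameter dominates the concentration radius. -/
theorem radius_le_bonus {d H s ι : ℝ} (hd : 1 ≤ d) (hH : 1 ≤ H) (hs : 4 / 5 ≤ s) (hs2 : s ^ 2 = ι) :
    √(2 * H ^ 2 * (70 * d ^ 2 * ι + 1)) + 1 + 2 * H * √d ≤ 16 * d * H * s := by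
  have hdH : 1 ≤ d * H := one_le_mul_of_one_le_of_one_le hd hH
  have hι : 16 / 25 ≤ ι := by
    rw [← hs2]
    nlinarith
  have e1 : √(2 * H ^ 2 * (70 * d ^ 2 * ι + 1)) ≤ 12 * (d * H * s) := by
    refine Real.sqrt_le_iff.2 ⟨by positivity, ?_⟩
    have h1 : (12 * (d * H * s)) ^ 2 = 144 * (d ^ 2 * H ^ 2 * ι) := by
      rw [← hs2]; ring
    have h2 : H ^ 2 ≤ d ^ 2 * H ^ 2 := le_mul_of_one_le_left (by positivity) (one_le_pow₀ hd)
    have h3 : d ^ 2 * H ^ 2 * (16 / 25) ≤ d ^ 2 * H ^ 2 * ι := by gcongr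
    have h4 : 2 * H ^ 2 * (70 * d ^ 2 * ι + 1) = 140 * (d ^ 2 * H ^ 2 * ι) + 2 * H ^ 2 := by ring
    have h5 : 0 ≤ d ^ 2 * H ^ 2 := by positivity
    rw [h1, h4]
    linarith
  have e2 : d * H * (4 / 5) ≤ d * H * s := by gcongr
  have e3 : 2 * H * √d ≤ 2 * (d * H) := by
    have : √d ≤ d := Real.sqrt_le_iff.2 ⟨by positivity, le_self_pow₀ hd (by norm_num)⟩
    calc 2 * H * √d ≤ 2 * H * d := by gcongr
      _ = 2 * (d * H) := by ring
  linarith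

/-- Choice of the mesh `η` and size `N` of the grid and of the level `L`. All are powers of
`X = exp ι = 2 d K H / p`, so that the logarithm of the size of the net is of order `d² ι`. -/
theorem exists_grid_parameters {d K H : ℕ} (hd : 1 ≤ d) (hK : 1 ≤ K) (hH : 1 ≤ H) {p : ℝ}
    (hp0 : 0 < p) (hp1 : p < 1) :
    ∃ (η L : ℝ) (N : ℕ), 0 < η ∧
      (∀ k : ℕ, 1 ≤ k → k ≤ K →
        2 * (k : ℝ) * H ≤ η * N ∧
        (H : ℝ) ^ 2 * ((k - 1 : ℕ) * (d * η) ^ 2 + d * η ^ 2) ≤ 2 ∧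
        2 * (k : ℝ) * (d * η + 16 * d * H * √(iota d K H p) * √(d * (d * η))) ≤ 1) ∧
      √(2 * (H : ℝ) ^ 2 * (L + 1)) + 1 + 2 * H * √d ≤ 16 * d * H * √(iota d K H p) ∧
      K * H * (2 * N + 1) ^ (d + d * d + d) * Real.exp (-L) ≤ p / 2 := by
  have hd' : (1 : ℝ) ≤ d := by exact_mod_cast hd
  have hK' : (1 : ℝ) ≤ K := by exact_mod_cast hK
  have hH' : (1 : ℝ) ≤ H := by exact_mod_cast hH
  set X : ℝ := 2 * d * (K * H) / p with hX
  have hι : iota d K H p = Real.log X := rfl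
  rw [hι]
  have hXp : X * p = 2 * d * (K * H) := by rw [hX]; field_simp
  have hdK : (d : ℝ) * (K * H) ≥ 1 := by
    have := mul_le_mul hd' (mul_le_mul hK' hH' zero_le_one (by positivity)) (by positivity)
      (by positivity : (0 : ℝ) ≤ d)
    linarith
  have hXge : 2 * (d : ℝ) * (K * H) ≤ X := by
    rw [hX, le_div_iff₀ hp0]
    exact mul_le_of_le_one_right (by positivity) hp1.le
  have hX2 : 2 ≤ X := by linarith
  have hX0 : 0 < X := by linarith
  have hX1 : 1 ≤ X := by linarith
  set s := √(Real.log X) with hs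
  have hι64 : 16 / 25 ≤ Real.log X := by
    have h1 := Real.log_le_log (by norm_num) hX2
    have h2 := Real.log_two_gt_d9
    linarith
  have hs8 : 4 / 5 ≤ s := Real.le_sqrt_of_sq_le (by norm_num at hι64 ⊢; linarith)
  have hs2 : s ^ 2 = Real.log X := Real.sq_sqrt (by linarith)
  have hsX : s ≤ X := Real.sqrt_le_iff.2 ⟨hX0.le,
    (Real.log_le_self hX0.le).trans (le_self_pow₀ hX1 (by norm_num))⟩
  have hdH : (1 : ℝ) ≤ d * H := one_le_mul_of_one_le_of_one_le hd' hH'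
  have hdHX : (d : ℝ) * H ≤ X := by
    have : (d : ℝ) * H ≤ K * (d * H) := le_mul_of_one_le_left (by positivity) hK'
    linarith
  -- the mesh is a negative power of `X`, and the grid covers `[-X, X]`
  set η : ℝ := (X ^ 20)⁻¹ with hη
  have hη0 : 0 < η := by positivity
  have hXη : X * η ≤ 1 / 2 := by
    rw [hη, ← div_eq_mul_inv, div_le_iff₀ (by positivity)]
    have h2 : X ^ 2 ≤ X ^ 20 := pow_le_pow_right₀ hX1 (by norm_num)
    have h3 : 2 * X ≤ X * X := by gcongr
    rw [← sq] at h3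
    linarith
  have hσ : √(d * (d * η)) = d * (X ^ 10)⁻¹ := by
    rw [show (d : ℝ) * (d * η) = (d * (X ^ 10)⁻¹) ^ 2 by rw [hη]; field_simp]
    exact Real.sqrt_sq (by positivity)
  have hσ4 : 16 * X ^ 3 * (X ^ 10)⁻¹ ≤ 1 / 2 := by
    rw [← div_eq_mul_inv, div_le_iff₀ (by positivity)]
    have h2 : (2 : ℝ) ^ 7 ≤ X ^ 7 := pow_le_pow_left₀ (by norm_num) hX2 7
    have h3 : X ^ 10 = X ^ 3 * X ^ 7 := by ring
    have h4 : 0 < X ^ 3 := by positivity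
    have h5 := mul_le_mul_of_nonneg_left h2 h4.le
    rw [h3]
    linarith
  refine ⟨η, 70 * (d : ℝ) ^ 2 * Real.log X, ⌈X ^ 21⌉₊, hη0, fun k hk hkK => ⟨?_, ?_, ?_⟩, ?_, ?_⟩
  · have hN : X ^ 21 ≤ (⌈X ^ 21⌉₊ : ℝ) := Nat.le_ceil _
    have hk' : (k : ℝ) ≤ K := by exact_mod_cast hkK
    calc 2 * (k : ℝ) * H ≤ 2 * K * H := by gcongr
      _ ≤ d * (2 * K * H) := le_mul_of_one_le_left (by positivity) hd'
      _ ≤ X := by linarith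
      _ = η * X ^ 21 := by rw [hη]; field_simp
      _ ≤ η * ⌈X ^ 21⌉₊ := by gcongr
  · have hk' : (k : ℝ) ≤ K := by exact_mod_cast hkK
    have hk1 : ((k - 1 : ℕ) : ℝ) ≤ K := le_trans (by exact_mod_cast Nat.sub_le k 1) hk'
    have hsq : (X * η) ^ 2 ≤ 1 := by
      have : 0 ≤ X * η := by positivity
      nlinarith
    have e1 : (H : ℝ) ^ 2 * ((k - 1 : ℕ) * (d * η) ^ 2) ≤ (X * η) ^ 2 := by
      calc (H : ℝ) ^ 2 * ((k - 1 : ℕ) * (d * η) ^ 2) ≤ H ^ 2 * (K * (d * η) ^ 2) := by gcongr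
        _ ≤ H ^ 2 * (K ^ 2 * (d * η) ^ 2) := by
            gcongr
            exact le_self_pow₀ hK' (by norm_num)
        _ = (d * (K * H) * η) ^ 2 := by ring
        _ ≤ (X * η) ^ 2 := by
            gcongr
            linarith
    have e2 : (H : ℝ) ^ 2 * (d * η ^ 2) ≤ (X * η) ^ 2 := by
      calc (H : ℝ) ^ 2 * (d * η ^ 2) ≤ H ^ 2 * (d ^ 2 * η ^ 2) := by
            gcongr
            exact le_self_pow₀ hd' (by norm_num)
        _ = (d * H * η) ^ 2 := by ring
        _ ≤ (X * η) ^ 2 := by gcongr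
    rw [mul_add]
    linarith
  · have hk' : (k : ℝ) ≤ K := by exact_mod_cast hkK
    have hkd : 2 * (k : ℝ) * d ≤ X := by
      calc 2 * (k : ℝ) * d ≤ 2 * K * d := by gcongr
        _ ≤ 2 * K * d * H := le_mul_of_one_le_right (by positivity) hH'
        _ ≤ X := by linarith
    rw [hσ]
    calc 2 * (k : ℝ) * (d * η + 16 * d * H * s * (d * (X ^ 10)⁻¹))
        = 2 * k * d * η + 16 * ((2 * k * d) * (d * H) * s) * (X ^ 10)⁻¹ := by ring
      _ ≤ X * η + 16 * (X * X * X) * (X ^ 10)⁻¹ := by gcongr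
      _ = X * η + 16 * X ^ 3 * (X ^ 10)⁻¹ := by ring
      _ ≤ 1 := by linarith
  · exact radius_le_bonus hd' hH' hs8 hs2
  · refine card_net_mul_exp_le hd hX2 ?_ (by positivity)
    have : (K : ℝ) * H ≤ d * (K * H) := le_mul_of_one_le_left (by positivity) hd'
    linarith

/-- The sum of the bonus term and of the remainder of the multiplicative Chernoff bound has the
order of the regret bound. -/
theorem bonus_total_le {d K H : ℕ} (hd : 1 ≤ d) (hK : 1 ≤ K) (hH : 1 ≤ H) {p : ℝ}
    (hp0 : 0 < p) (hp1 : p < 1) :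
    2 * (H * (2 * (16 * d * H * √(iota d K H p)) * √(K * (2 * (d * Real.log (K + d))))))
        + 2 * (3 * (H : ℝ) ^ 2) * Real.log (2 / p)
      ≤ 100 * √(d ^ 3 * H ^ 3 * (K * H) * iota d K H p ^ 2) := by
  have hd' : (1 : ℝ) ≤ d := by exact_mod_cast hd
  have hK' : (1 : ℝ) ≤ K := by exact_mod_cast hK
  have hH' : (1 : ℝ) ≤ H := by exact_mod_cast hH
  have hKH : (1 : ℝ) ≤ K * H := one_le_mul_of_one_le_of_one_le hK' hH'
  have hdKH : (1 : ℝ) ≤ d * (K * H) := one_le_mul_of_one_le_of_one_le hd' hKH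
  set ι := iota d K H p with hι
  have hι0 : 0 ≤ ι := Real.log_nonneg (by
    rw [le_div_iff₀ hp0]
    linarith)
  have hlog : Real.log (K + d) ≤ ι := by
    refine Real.log_le_log (by positivity) ?_
    have h1 : (K : ℝ) + d ≤ 2 * d * (K * H) := by
      have e1 : (K : ℝ) ≤ d * (K * H) :=
        (le_mul_of_one_le_right (by positivity) hH').trans
          (le_mul_of_one_le_left (by positivity) hd')
      have e2 : (d : ℝ) ≤ d * (K * H) := le_mul_of_one_le_right (by positivity) hKH
      linarith
    refine h1.trans ?_
    rw [le_div_iff₀ hp0]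
    exact mul_le_of_le_one_right (by positivity) hp1.le
  have hlog2 : Real.log (2 / p) ≤ ι := by
    refine Real.log_le_log (by positivity) ?_
    gcongr
    linarith
  set Q := √((d : ℝ) ^ 3 * H ^ 3 * (K * H)) with hQ
  have hrhs : √((d : ℝ) ^ 3 * H ^ 3 * (K * H) * ι ^ 2) = Q * ι := by
    rw [Real.sqrt_mul (by positivity), Real.sqrt_sq hι0]
  have hH2 : (H : ℝ) ^ 2 ≤ Q := by
    refine Real.le_sqrt_of_sq_le ?_
    have e1 : (1 : ℝ) ≤ d ^ 3 * K := one_le_mul_of_one_le_of_one_le (one_le_pow₀ hd') hK'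
    calc ((H : ℝ) ^ 2) ^ 2 ≤ (d ^ 3 * K) * (H ^ 2) ^ 2 := le_mul_of_one_le_left (by positivity) e1
      _ = (d : ℝ) ^ 3 * H ^ 3 * (K * H) := by ring
  have hmain : (H : ℝ) * (d * H * √ι * √(K * (2 * (d * Real.log (K + d))))) ≤ √2 * (Q * ι) := by
    have e1 : √(K * (2 * (d * Real.log (K + d)))) ≤ √(K * (2 * (d * ι))) := by gcongr
    have e2 : (d : ℝ) * H ^ 2 * √ι * √(K * (2 * (d * ι))) = √2 * (Q * ι) := by
      rw [← hrhs, ← Real.sqrt_mul (by norm_num),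
        show (d : ℝ) * H ^ 2 = √(((d : ℝ) * H ^ 2) ^ 2) from (Real.sqrt_sq (by positivity)).symm,
        ← Real.sqrt_mul (by positivity), ← Real.sqrt_mul (by positivity)]
      congr 1
      ring
    calc (H : ℝ) * (d * H * √ι * √(K * (2 * (d * Real.log (K + d)))))
        = d * H ^ 2 * √ι * √(K * (2 * (d * Real.log (K + d)))) := by ring
      _ ≤ d * H ^ 2 * √ι * √(K * (2 * (d * ι))) := by gcongr
      _ = √2 * (Q * ι) := e2
  have hrem : (H : ℝ) ^ 2 * Real.log (2 / p) ≤ Q * ι :=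
    (mul_le_mul_of_nonneg_left hlog2 (by positivity)).trans (by gcongr)
  have hsqrt2 : √2 ≤ 1.45 := Real.sqrt_le_iff.2 ⟨by norm_num, by norm_num⟩
  have hQι : 0 ≤ Q * ι := by positivity
  have h145 : √2 * (Q * ι) ≤ 1.45 * (Q * ι) := by gcongr
  rw [hrhs]
  linarith

end Constants

end OmniVI

/-- Regret of one-sided online optimistic minimax value iteration. -/
theorem theorem2 :
    ∃ c : ℝ, 0 < c ∧ ∃ C : ℝ, 0 < C ∧
      ∀ (S : Type*) [MeasurableSpace S]
        (A : Type*) [Fintype A] [MeasurableSpace A] [MeasurableSingletonClass A]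
        (G : MarkovGame S A) (d : ℕ) (φ : S × A × A → EuclideanSpace ℝ (Fin d)),
        G.IsLinear φ →
      ∀ πs νs : Policy S A, G.IsNash πs νs →
      ∀ (K : ℕ) (p : ℝ), 0 < p → p < 1 →
      ∀ (Ω : Type*) [MeasurableSpace Ω] (P : Measure Ω) [IsProbabilityMeasure P]
        (D : Ω → Record S A) (π B ν : ℕ → Ω → Policy S A)
        (info infoAct : ℕ → ℕ → MeasurableSpace Ω),
        OnlineRun P G φ (c * d * G.horizon * √(iota d K G.horizon p)) K D π B ν info infoAct →
      1 - p ≤ P.real {ω |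
        regret G πs νs K (D ω) (fun k => π k ω) (fun k => ν k ω) ≤
          C * √(d ^ 3 * G.horizon ^ 3 * (K * G.horizon) * iota d K G.horizon p ^ 2)} := by
  refine ⟨16, by norm_num, 100, by norm_num, ?_⟩
  intro S _ A _ _ _ G d φ hlin πs νs hN K p hp0 hp1 Ω _ P _ D π B ν info infoAct R
  set H := G.horizon with hH
  set ι := iota d K H p with hι
  -- without episodes or without steps the regret vanishes
  by_cases htriv : K = 0 ∨ H = 0
  · have h0 : ∀ ω, regret G πs νs K (D ω) (fun k => π k ω) (fun k => ν k ω) = 0 := fun ω => by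
      rcases htriv with h | h
      · simp [regret, h]
      · simp [regret, value_eq_cumul, ← hH, h, cumul]
    have huniv : {ω | regret G πs νs K (D ω) (fun k => π k ω) (fun k => ν k ω) ≤
        100 * √(d ^ 3 * H ^ 3 * (K * H) * ι ^ 2)} = Set.univ :=
      Set.eq_univ_of_forall fun ω => by
        rw [Set.mem_ofPred_eq, h0 ω]
        positivity
    rw [huniv, probReal_univ]
    linarith
  push Not at htriv
  have hK1 : 1 ≤ K := by omega
  have hH1 : 1 ≤ H := by omega
  -- a transition law of mass one needs a nonzero feature vector
  have hd1 : 1 ≤ d := by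
    by_contra hd
    obtain rfl : d = 0 := by omega
    obtain ⟨-, -, θ, μ, hμ⟩ := hlin
    obtain ⟨ω⟩ := nonempty_of_isProbabilityMeasure P
    obtain ⟨a⟩ := nonempty_of_isProbabilityMeasure (πs.act 1 ((D ω).state 1 1))
    have h1 := (hμ 1 le_rfl hH1).2.1 ((D ω).state 1 1, a, a) Set.univ .univ
    simp at h1
  have hι0 : 0 ≤ √ι := Real.sqrt_nonneg _
  set β : ℝ := 16 * d * H * √ι with hβ
  have hβ0 : 0 ≤ β := by positivity
  have hφm := hlin.1
  have hφ1 := hlin.2.1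
  obtain ⟨η, L, N, hη, hpar, hbeta, hprob⟩ := exists_grid_parameters hd1 hK1 hH1 hp0 hp1
  have hH0 : (0 : ℝ) < H := by exact_mod_cast hH1
  have hbad₁ := R.measure_exists_noise_gt_le hφm η L N
  have hbad₂ := R.measure_sum_cumul_gt_le (g := fun k ω => cappedBonus G φ β (D ω) k)
    (fun k hk hkK h h1 hh => measurable_cappedBonus_joint (m := info k 1) hφm fun τ hτ hτk =>
      R.measurable_triple_past hτ hτk hkK h1 hh)
    (fun k ω h z => cappedBonus_nonneg G φ hβ0 (D ω) k h z)
    (fun k ω h z => abs_cappedBonus_le G φ hβ0 (D ω) k h z)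
    (r := 3 * (H : ℝ) ^ 2) (by positivity) (by rw [← hH]; linarith) (Real.log (2 / p))
  rw [Real.exp_neg, Real.exp_log (by positivity), inv_div] at hbad₂
  set target := {ω | regret G πs νs K (D ω) (fun k => π k ω) (fun k => ν k ω) ≤
    100 * √(d ^ 3 * H ^ 3 * (K * H) * ι ^ 2)} with htarget
  have hsub : targetᶜ ⊆
      {ω | ¬ ∀ k, 1 ≤ k → k ≤ K → ∀ h, 1 ≤ h → h ≤ G.horizon → ∀ j : NetIndex d N,
        ∑ τ ∈ Finset.Ico 1 k, compensatedNoise G φ h (gridVec η j.2.2)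
          (netValue φ G.horizon β η j) (D ω) τ ≤ L} ∪
      {ω | ¬ ∑ k ∈ Finset.Icc 1 K, cumul G (π k ω) (ν k ω) (cappedBonus G φ β (D ω) k)
          G.horizon 1 ((D ω).state k 1)
        ≤ 2 * ∑ k ∈ Finset.Icc 1 K, ∑ i ∈ Finset.Ico 1 (G.horizon + 1),
            cappedBonus G φ β (D ω) k i ((D ω).triple k i)
          + 2 * (3 * (H : ℝ) ^ 2) * Real.log (2 / p)} := by
    intro ω hω
    by_contra hgood
    rw [Set.mem_union, not_or, Set.mem_ofPred_eq, Set.mem_ofPred_eq, not_not, not_not] at hgood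
    obtain ⟨hgood₁, hgood₂⟩ := hgood
    refine hω ?_
    have hreg := regret_le_sum_cumul hφm hβ0 hN (D := D ω) (K := K) (π := fun k => π k ω)
      (B := fun k => B k ω) (ν := fun k => ν k ω)
      (fun k hk hkK => isAccurate_of_grid hlin hβ0 (R.omni k hk hkK ω) hη (hpar k hk hkK).1 hk
        (hpar k hk hkK).2.1 (hpar k hk hkK).2.2 hbeta (hgood₁ k hk hkK))
      (fun k hk hkK => R.omni k hk hkK ω)
    have hbonus := sum_cappedBonus_le (G := G) hφ1 hβ0 (D ω) K
    have htotal := bonus_total_le hd1 hK1 hH1 hp0 hp1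
    rw [htarget, Set.mem_ofPred_eq]
    linarith
  have hcompl : P targetᶜ ≤ ENNReal.ofReal p := by
    refine (measure_mono hsub).trans ((measure_union_le _ _).trans ?_)
    refine (add_le_add (hbad₁.trans (ENNReal.ofReal_le_ofReal hprob)) hbad₂).trans_eq ?_
    rw [← ENNReal.ofReal_add (by positivity) (by positivity)]
    congr 1
    ring
  have hcompl' : P.real targetᶜ ≤ p := ENNReal.toReal_le_of_le_ofReal hp0.le hcompl
  have hone : 1 ≤ P.real target + P.real targetᶜ := by
    rw [← probReal_univ (μ := P), ← Set.union_compl_self target]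
    exact measureReal_union_le _ _
  linarith
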